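/- Let $\mathfrak f$ be a perfect field, $k\supseteq\mathfrak f$ an algebraically closed field, and $F=\mathfrak f(t)$. Let $n$ be a prime, $L$ a commutative semisimple $\mathfrak f$-algebra of dimension $n$, $g$ an $\mathfrak f$-algebra automorphism of $L$ of order $n$, and $\dot g$ another generator of the cyclic group $\langle g\rangle$. (For example, $L/\mathfrak f$ is a cyclic Galois field extension of degree $n$ and $g,\dot g$ generate its Galois group.) Let $D=D_{g,t}$ be the $F$-algebra generated over $F$ by $L$ and an element $s$ subject to $sa=g(a)s$ for $a\in L$ and $s^n=t$, and for a field extension $M/F$ put $D(M)=M\otimes_F D$. Let $\dot D=D_{\dot g,t}$. For a place $v$ of $k(t)$ over $k$, let $k(t)_v$ be the Henselization of $k(t)$ at $v$ and $\mathcal O_v$ its valuation ring. Let $d_1,\dots,d_n$ be an $\mathfrak f$-basis of $L$. If $v(t)=0$, let $R_v\subseteq D(k(t)_v)$ be the ring of all $\sum_{i=0}^{n-1}\sum_{j=1}^{n} x_{ij}d_js^i$ with $x_{ij}\in\mathcal O_v$; if $v(t)\neq 0$, let $R_v=D(k(t)_v)$. Define $\dot R_v\subseteq\dot D(k(t)_v)$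 in the same way. For $c\in D(F)$ let $T_c$ denote the centralizer of $c$ in $D$, so that $T_c(M)$ is the centralizer of $c$ in $D(M)$ for each field extension $M/F$; similarly for $\dot D$. Then for every $c\in D(F)$ there is $\dot c\in\dot D(F)$ such that, for every place $v$ of $k(t)$ over $k$, the triples $(D,R_v,c)$ and $(\dot D,\dot R_v,\dot c)$ are isomorphic over $k(t)_v$: there is an isomorphism of $k(t)_v$-algebras $D(k(t)_v)\to\dot D(k(t)_v)$ that maps $c$ to $\dot c$ and $R_v$ onto $\dot R_v$. Moreover, if $c$ is not central in $D(F)$ (in particular, if $c$ is regular semisimple), then for this $\dot c$ there is an isomorphism $T_c\to T_{\dot c}$ of algebras defined over $F$, mapping $c$ to $\dot c$ (that is, an isomorphism of $F$-algebras $T_c(F)\to T_{\dot c}(F)$ with $c\mapsto\dot c$), whose extension of scalars $T_c(k(t)_v)\to T_{\dot c}(k(t)_v)$ maps $T_c(k(t)_v)\cap R_v$ onto $T_{\dot c}(k(t)_v)\cap\dot R_v$ for every place $v$ of $k(t)$ over $k$. -/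

import Mathlib

open scoped TensorProduct

/-- The defining relations of `D_{g,t} = L[s] / (s a = g(a) s, s ^ n = t)`, as an algebra over an
`𝔣`-algebra `A` containing `t`.  The generators are the elements `some a` for `a : L`, and
`none`, which stands for `s`. The first three relations say that `L` is embedded as an
`𝔣`-algebra. -/
inductive CyclicRel (𝔣 A L : Type*) [Field 𝔣] [CommRing A] [Algebra 𝔣 A] [CommRing L]
    [Algebra 𝔣 L] (g : L ≃ₐ[𝔣] L) (n : ℕ) (t : A) :
    FreeAlgebra A (Option L) → FreeAlgebra A (Option L) → Prop
  | add (a b : L) : CyclicRel 𝔣 A L g n t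
      (FreeAlgebra.ι A (some (a + b))) (FreeAlgebra.ι A (some a) + FreeAlgebra.ι A (some b))
  | mul (a b : L) : CyclicRel 𝔣 A L g n t
      (FreeAlgebra.ι A (some (a * b))) (FreeAlgebra.ι A (some a) * FreeAlgebra.ι A (some b))
  | scalar (r : 𝔣) : CyclicRel 𝔣 A L g n t
      (FreeAlgebra.ι A (some (algebraMap 𝔣 L r)))
      (algebraMap A (FreeAlgebra A (Option L)) (algebraMap 𝔣 A r))
  | comm (a : L) : CyclicRel 𝔣 A L g n t
      (FreeAlgebra.ι A none * FreeAlgebra.ι A (some a))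
      (FreeAlgebra.ι A (some (g a)) * FreeAlgebra.ι A none)
  | pow : CyclicRel 𝔣 A L g n t
      (FreeAlgebra.ι A none ^ n) (algebraMap A (FreeAlgebra A (Option L)) t)

/-- The `𝔣(t)`-algebra `D(F)`, where `F = 𝔣(t)` and `D = D_{g,t}`. -/
def CyclicAlg (𝔣 L : Type*) [Field 𝔣] [CommRing L] [Algebra 𝔣 L] (g : L ≃ₐ[𝔣] L) (n : ℕ) :
    Type _ :=
  RingQuot (CyclicRel 𝔣 (RatFunc 𝔣) L g n RatFunc.X)

namespace CyclicAlg

noncomputable instance instRing (𝔣 L : Type*) [Field 𝔣] [CommRing L] [Algebra 𝔣 L]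
    (g : L ≃ₐ[𝔣] L) (n : ℕ) : Ring (CyclicAlg 𝔣 L g n) :=
  inferInstanceAs (Ring (RingQuot (CyclicRel 𝔣 (RatFunc 𝔣) L g n RatFunc.X)))

noncomputable instance instAlgebra (𝔣 L : Type*) [Field 𝔣] [CommRing L] [Algebra 𝔣 L]
    (g : L ≃ₐ[𝔣] L) (n : ℕ) : Algebra (RatFunc 𝔣) (CyclicAlg 𝔣 L g n) :=
  inferInstanceAs (Algebra (RatFunc 𝔣) (RingQuot (CyclicRel 𝔣 (RatFunc 𝔣) L g n RatFunc.X)))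

/-- The canonical map `L → D(F)`. -/
noncomputable def ofL {𝔣 L : Type*} [Field 𝔣] [CommRing L] [Algebra 𝔣 L]
    (g : L ≃ₐ[𝔣] L) (n : ℕ) (a : L) : CyclicAlg 𝔣 L g n :=
  RingQuot.mkAlgHom (RatFunc 𝔣) (CyclicRel 𝔣 (RatFunc 𝔣) L g n RatFunc.X)
    (FreeAlgebra.ι (RatFunc 𝔣) (some a))

/-- The element `s` of `D(F)`. -/
noncomputable def s {𝔣 L : Type*} [Field 𝔣] [CommRing L] [Algebra 𝔣 L]
    (g : L ≃ₐ[𝔣] L) (n : ℕ) : CyclicAlg 𝔣 L g n :=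
  RingQuot.mkAlgHom (RatFunc 𝔣) (CyclicRel 𝔣 (RatFunc 𝔣) L g n RatFunc.X)
    (FreeAlgebra.ι (RatFunc 𝔣) none)

open Classical in
/-- For a field extension `M` of `F = 𝔣(t)` with a valuation ring `O`, the ring
`R ⊆ D(M) = M ⊗ D(F)`: if `t` is a unit of `O` it is the set of all `∑ x_{ij} d_j s ^ i`
with `x_{ij} ∈ O`, `i < n`, where `d_j` is a basis of `L` over `𝔣`, that is, the `O`-span of the
elements `a s ^ i`, `a ∈ L`, `i < n`; otherwise it is all of `D(M)`. -/
noncomputable def integralRing {𝔣 L M : Type*} [Field 𝔣] [CommRing L] [Algebra 𝔣 L]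
    (g : L ≃ₐ[𝔣] L) (n : ℕ) [Field M] [Algebra (RatFunc 𝔣) M] (O : ValuationSubring M) :
    Submodule O (M ⊗[RatFunc 𝔣] CyclicAlg 𝔣 L g n) :=
  if O.valuation (algebraMap (RatFunc 𝔣) M RatFunc.X) = 1 then
    Submodule.span O {x | ∃ a : L, ∃ i < n, x = 1 ⊗ₜ[RatFunc 𝔣] (ofL g n a * s g n ^ i)}
  else ⊤

end CyclicAlg

/-- The inclusion `𝔣(t) → k(t)` induced by `𝔣 → k`. -/
noncomputable def ratFuncInclusion (𝔣 k : Type*) [Field 𝔣] [Field k] [Algebra 𝔣 k] :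
    RatFunc 𝔣 →+* RatFunc k :=
  RatFunc.mapRingHom (Polynomial.mapRingHom (algebraMap 𝔣 k))
    (nonZeroDivisors_le_comap_nonZeroDivisors_of_injective _
      (Polynomial.map_injective _ (algebraMap 𝔣 k).injective))

/-- A place of `k(t)` over `k`, given by its valuation ring: a nontrivial valuation ring
of `k(t)` that contains `k`. -/
structure IsPlace {k : Type*} [Field k] (v : ValuationSubring (RatFunc k)) : Prop where
  const_mem : ∀ a : k, RatFunc.C a ∈ v
  ne_top : v ≠ ⊤

/-- `w` is a prolongation of `v` to the separable closure of `k(t)`. -/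
def Prolongs {k : Type*} [Field k] (w : ValuationSubring (SeparableClosure (RatFunc k)))
    (v : ValuationSubring (RatFunc k)) : Prop :=
  w.comap (algebraMap (RatFunc k) (SeparableClosure (RatFunc k))) = v

/-- The Henselization `k(t)_v` of `k(t)` at a place `v`, computed from a prolongation `w` of `v`
to the separable closure: the fixed field of the decomposition group of `w`. -/
def HenselField {k : Type*} [Field k] (w : ValuationSubring (SeparableClosure (RatFunc k))) :
    Type _ :=
  ↥(IntermediateField.fixedField (w.decompositionSubgroup (RatFunc k)))

namespace HenselField

noncomputable instance instField {k : Type*} [Field k]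
    (w : ValuationSubring (SeparableClosure (RatFunc k))) : Field (HenselField w) :=
  inferInstanceAs (Field ↥(IntermediateField.fixedField (w.decompositionSubgroup (RatFunc k))))

/-- The inclusion `k(t) → k(t)_v`. -/
noncomputable def ofRatFunc {k : Type*} [Field k]
    (w : ValuationSubring (SeparableClosure (RatFunc k))) : RatFunc k →+* HenselField w :=
  algebraMap (RatFunc k) ↥(IntermediateField.fixedField (w.decompositionSubgroup (RatFunc k)))

/-- The inclusion of `k(t)_v` in the separable closure. -/
noncomputable def toSepClosure {k : Type*} [Field k]
    (w : ValuationSubring (SeparableClosure (RatFunc k))) :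
    HenselField w →+* SeparableClosure (RatFunc k) :=
  algebraMap ↥(IntermediateField.fixedField (w.decompositionSubgroup (RatFunc k)))
    (SeparableClosure (RatFunc k))

/-- The valuation ring `O_v` of `k(t)_v`. -/
noncomputable def integers {k : Type*} [Field k]
    (w : ValuationSubring (SeparableClosure (RatFunc k))) : ValuationSubring (HenselField w) :=
  w.comap (toSepClosure w)

noncomputable instance instAlgebra {𝔣 k : Type*} [Field 𝔣] [Field k] [Algebra 𝔣 k]
    (w : ValuationSubring (SeparableClosure (RatFunc k))) :
    Algebra (RatFunc 𝔣) (HenselField w) :=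
  ((ofRatFunc w).comp (ratFuncInclusion 𝔣 k)).toAlgebra

end HenselField

namespace CyclicAlg

/-- `R_v ⊆ D(k(t)_v)`. -/
noncomputable def localRing {𝔣 L k : Type*} [Field 𝔣] [CommRing L] [Algebra 𝔣 L]
    (g : L ≃ₐ[𝔣] L) (n : ℕ) [Field k] [Algebra 𝔣 k]
    (w : ValuationSubring (SeparableClosure (RatFunc k))) :
    Submodule (HenselField.integers w) (HenselField w ⊗[RatFunc 𝔣] CyclicAlg 𝔣 L g n) :=
  integralRing g n (HenselField.integers w)

/-- `(D, R_v, c)` and `(D', R'_v, c')` are `k(t)_v`-isomorphic. -/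
def MatchAt {𝔣 L k : Type*} [Field 𝔣] [CommRing L] [Algebra 𝔣 L] {g g' : L ≃ₐ[𝔣] L} {n : ℕ}
    [Field k] [Algebra 𝔣 k] (w : ValuationSubring (SeparableClosure (RatFunc k)))
    (c : CyclicAlg 𝔣 L g n) (c' : CyclicAlg 𝔣 L g' n) : Prop :=
  ∃ h : (HenselField w ⊗[RatFunc 𝔣] CyclicAlg 𝔣 L g n) ≃ₐ[HenselField w]
      (HenselField w ⊗[RatFunc 𝔣] CyclicAlg 𝔣 L g' n),
    h (1 ⊗ₜ c) = 1 ⊗ₜ c' ∧ ∀ x, x ∈ localRing g n w ↔ h x ∈ localRing g' n w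

/-- The `F`-points of the centralizer `T_c` of `c`. -/
noncomputable def centralizer {𝔣 L : Type*} [Field 𝔣] [CommRing L] [Algebra 𝔣 L] {g : L ≃ₐ[𝔣] L} {n : ℕ}
    (c : CyclicAlg 𝔣 L g n) : Subalgebra (RatFunc 𝔣) (CyclicAlg 𝔣 L g n) :=
  Subalgebra.centralizer (RatFunc 𝔣) {c}

/-- The `k(t)_v`-points of the centralizer `T_c` of `c`. -/
noncomputable def localCentralizer {𝔣 L k : Type*} [Field 𝔣] [CommRing L] [Algebra 𝔣 L] {g : L ≃ₐ[𝔣] L}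
    {n : ℕ} [Field k] [Algebra 𝔣 k] (w : ValuationSubring (SeparableClosure (RatFunc k)))
    (c : CyclicAlg 𝔣 L g n) :
    Subalgebra (HenselField w) (HenselField w ⊗[RatFunc 𝔣] CyclicAlg 𝔣 L g n) :=
  Subalgebra.centralizer (HenselField w) {1 ⊗ₜ c}

/-- The isomorphism `T_c → T_{c'}` given over `F` by `e` maps `T_c ∩ R_v` onto `T_{c'} ∩ R'_v`;
here `j` is the `k(t)_v`-linear extension of `e`. -/
def PreservesIntegralAt {𝔣 L k : Type*} [Field 𝔣] [CommRing L] [Algebra 𝔣 L]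
    {g g' : L ≃ₐ[𝔣] L} {n : ℕ} [Field k] [Algebra 𝔣 k]
    (w : ValuationSubring (SeparableClosure (RatFunc k)))
    {c : CyclicAlg 𝔣 L g n} {c' : CyclicAlg 𝔣 L g' n}
    (e : centralizer c ≃ₐ[RatFunc 𝔣] centralizer c') : Prop :=
  ∃ j : localCentralizer w c ≃ₐ[HenselField w] localCentralizer w c',
    (∀ (x : centralizer c) (y : localCentralizer w c),
      (y : HenselField w ⊗[RatFunc 𝔣] CyclicAlg 𝔣 L g n) = 1 ⊗ₜ (x : CyclicAlg 𝔣 L g n) →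
      (j y : HenselField w ⊗[RatFunc 𝔣] CyclicAlg 𝔣 L g' n) =
        1 ⊗ₜ (e x : CyclicAlg 𝔣 L g' n)) ∧
    ∀ y : localCentralizer w c,
      (y : HenselField w ⊗[RatFunc 𝔣] CyclicAlg 𝔣 L g n) ∈ localRing g n w ↔
      (j y : HenselField w ⊗[RatFunc 𝔣] CyclicAlg 𝔣 L g' n) ∈ localRing g' n w

end CyclicAlg

/-! ### Cyclic algebras over an arbitrary coefficient ring, and their universal property. -/

section Basics

variable {𝔣 L : Type*} [Field 𝔣] [CommRing L] [Algebra 𝔣 L]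

/-! Suppose first that `L` is not a field. Then some maximal ideal `m` is moved by `g`, hence by the
other generator (`isField_of_forall_mem`). As `n` is prime, the translates of `m` are distinct, and
`L` becomes a product of `n` copies of `L ⧸ m` on which either generator acts as the cyclic shift
(`bijective_residue`). So `g` and `g'` are conjugate in `Aut L`, and the conjugating automorphism
extends to an isomorphism `D → D'` over `F` with `s ↦ s`, which settles everything at once.

Now let `L` be a field, so that `D` and `D'` are division algebras, and let `c ∉ F`. View `D` as a
bimodule with `c` acting on the left and `L` on the right. It is a cyclic bimodule, so its
automorphism group `E` (`bimod`) is commutative. To make `D` a right `D'`-module on which `c` still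
acts linearly from the left, one needs a `g ^ a`-semilinear bimodule operator `ρ` with `ρ ^ n = t`,
where `g ^ a * g' = 1`. A Frobenius operator `w` (`g`-semilinear, commuting with `c`, fixing a
cyclic vector) satisfies `w ^ n = 1`. Right multiplication by `s` equals `Z * w⁻¹` with `Z ∈ E`, and
`ρ = Z * w ^ a` works: `(Z * w ^ a) ^ n` and `(Z * w⁻¹) ^ n = t` are both the product of the
conjugates of `Z` under the powers of `w` (`mul_pow_pow_eq`). Then `D` is free of rank one over
`D'`, and after the choice of a generator, left multiplication by `c` becomes left multiplication by
some `c' ∈ D'`.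

The generator has to be chosen integrally. At a prime `v ≠ (t)` of `𝔣[t]` there is a Frobenius
operator that preserves the standard lattice (`exists_isFrobenius`). If the residue algebra is a
division algebra, a cyclic vector lifts from it. Otherwise `t⁻¹` is a norm over the residue field
(`exists_nm_mul_eq_one`), and a suitable vector is found by approximation
(`exists_generator_of_nm`). All Frobenius operators are conjugate under `E`, and a cocycle
computation (`exists_conj_eq`) gives `f_v ∈ E` such that `f_v ρ f_v⁻¹` preserves the lattice at `v`.
The preimages of the lattices under the `f_v` glue to a right module over the twisted Laurent ring
`L[s, s⁻¹]` inside `D'`. Its right ideals are principal by Euclidean division (`exists_generator`),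
and a generator of the module defines `c'` (`exists_global`).

Over `k(t)_v` both algebras split, because `L` embeds in the algebraically closed `k`. The
comparison `D' → D` at a prime yields a matrix over `F ⊗ L` that intertwines `c` and `c'` and is
invertible over the valuation ring when `v(t) = 0`. Conjugation by it is the local isomorphism
(`exists_local`).

Finally, `T_c = F[c]` since `n` is prime, and `c`, `c'` are annihilated by the same polynomials. So
`p(c) ↦ p(c')` is an isomorphism over `F`, and every local isomorphism restricts to its scalar
extension. -/

/-- The cyclic algebra `A ⊗ L [s] / (s a = g(a) s, s ^ n = t)` over an `𝔣`-algebra `A`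
with a unit `t`. -/
def Cyc (A : Type*) [CommRing A] [Algebra 𝔣 A] (g : L ≃ₐ[𝔣] L) (n : ℕ) (t : Aˣ) : Type _ :=
  RingQuot (CyclicRel 𝔣 A L g n (t : A))

/-- The extension of scalars of an automorphism of `L`. -/
noncomputable def sg (A : Type*) [CommRing A] [Algebra 𝔣 A] :
    (L ≃ₐ[𝔣] L) →* (A ⊗[𝔣] L ≃ₐ[A] A ⊗[𝔣] L) where
  toFun h := Algebra.TensorProduct.congr AlgEquiv.refl h
  map_one' := by
    ext x
    induction x with
    | zero => simp
    | add x y hx hy => rw [map_add, hx, hy]; rfl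
    | tmul a x => simp
  map_mul' h h' := by
    ext x
    induction x with
    | zero => simp
    | add x y hx hy => simp_all
    | tmul a x => simp

@[simp] lemma sg_tmul (A : Type*) [CommRing A] [Algebra 𝔣 A] (h : L ≃ₐ[𝔣] L) (a : A) (x : L) :
    sg A h (a ⊗ₜ x) = a ⊗ₜ h x := by
  simp [sg]

namespace Cyc

variable {A : Type*} [CommRing A] [Algebra 𝔣 A] {g : L ≃ₐ[𝔣] L} {n : ℕ} {t : Aˣ}

noncomputable instance : Ring (Cyc A g n t) :=
  inferInstanceAs (Ring (RingQuot (CyclicRel 𝔣 A L g n (t : A))))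

noncomputable instance : Algebra A (Cyc A g n t) :=
  inferInstanceAs (Algebra A (RingQuot (CyclicRel 𝔣 A L g n (t : A))))

/-- The quotient map from the free algebra. -/
noncomputable def mk : FreeAlgebra A (Option L) →ₐ[A] Cyc A g n t :=
  RingQuot.mkAlgHom A (CyclicRel 𝔣 A L g n (t : A))

lemma mk_rel {x y : FreeAlgebra A (Option L)} (h : CyclicRel 𝔣 A L g n (t : A) x y) :
    (mk x : Cyc A g n t) = mk y :=
  RingQuot.mkAlgHom_rel A h

lemma mk_surjective : Function.Surjective (mk : FreeAlgebra A (Option L) →ₐ[A] Cyc A g n t) :=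
  RingQuot.mkAlgHom_surjective A _

/-- The image of `a : L`. -/
noncomputable def ι (a : L) : Cyc A g n t := mk (FreeAlgebra.ι A (some a))

/-- The generator `s`. -/
noncomputable def S : Cyc A g n t := mk (FreeAlgebra.ι A none)

lemma ι_add (a b : L) : (ι (a + b) : Cyc A g n t) = ι a + ι b := by
  simpa [ι] using mk_rel (t := t) (.add a b)

lemma ι_mul (a b : L) : (ι (a * b) : Cyc A g n t) = ι a * ι b := by
  simpa [ι] using mk_rel (t := t) (.mul a b)

lemma ι_algebraMap (r : 𝔣) :
    (ι (algebraMap 𝔣 L r) : Cyc A g n t) = algebraMap A _ (algebraMap 𝔣 A r) := by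
  have := mk_rel (t := t) (.scalar (g := g) (n := n) r)
  rwa [AlgHom.commutes] at this

lemma S_mul_ι (a : L) : (S * ι a : Cyc A g n t) = ι (g a) * S := by
  simpa [ι, S] using mk_rel (t := t) (.comm a)

lemma S_pow : (S ^ n : Cyc A g n t) = algebraMap A _ t := by
  have := mk_rel (t := t) (CyclicRel.pow (𝔣 := 𝔣) (L := L) (g := g) (n := n))
  rwa [AlgHom.commutes, map_pow] at this

lemma ι_one : (ι 1 : Cyc A g n t) = 1 := by
  have := ι_algebraMap (t := t) (g := g) (n := n) (A := A) 1
  simpa using this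

/-- The inclusion of `L` as a ring homomorphism. -/
noncomputable def ιHom : L →+* Cyc A g n t where
  toFun := ι
  map_one' := ι_one
  map_mul' := ι_mul
  map_zero' := by
    have := ι_algebraMap (t := t) (g := g) (n := n) (A := A) 0
    simpa using this
  map_add' := ι_add

/-- The inclusion of `A ⊗ L`. -/
noncomputable def inc : A ⊗[𝔣] L →ₐ[A] Cyc A g n t :=
  letI : Algebra 𝔣 (Cyc A g n t) := Algebra.compHom _ (algebraMap 𝔣 A)
  haveI : IsScalarTower 𝔣 A (Cyc A g n t) := IsScalarTower.of_algebraMap_eq (fun _ => rfl)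
  Algebra.TensorProduct.lift (Algebra.ofId A _) ({ ιHom with commutes' := ι_algebraMap })
    (fun a _ => Algebra.commutes a _)

@[simp] lemma inc_tmul (a : A) (x : L) :
    (inc (a ⊗ₜ x) : Cyc A g n t) = algebraMap A _ a * ι x := by
  let : Algebra 𝔣 (Cyc A g n t) := Algebra.compHom _ (algebraMap 𝔣 A)
  have : IsScalarTower 𝔣 A (Cyc A g n t) := IsScalarTower.of_algebraMap_eq (fun _ => rfl)
  exact Algebra.TensorProduct.lift_tmul _ _ _ _ _

lemma S_mul_inc (z : A ⊗[𝔣] L) : (S * inc z : Cyc A g n t) = inc (sg A g z) * S := by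
  induction z with
  | zero => simp
  | add x y hx hy => simp [mul_add, add_mul, hx, hy]
  | tmul a x =>
    simp only [inc_tmul, sg_tmul, mul_assoc, ← S_mul_ι]
    rw [← mul_assoc, ← Algebra.commutes, mul_assoc]

lemma inc_mul_S (z : A ⊗[𝔣] L) : (inc z * S : Cyc A g n t) = S * inc (sg A g⁻¹ z) := by
  rw [S_mul_inc, ← AlgEquiv.mul_apply, ← map_mul]; simp

/-- A subalgebra that contains `L` and `s` is everything. -/
lemma eq_top_of_mem {T : Subalgebra A (Cyc A g n t)} (h : ∀ a, ι a ∈ T) (hS : S ∈ T) : T = ⊤ := by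
  rw [eq_top_iff]
  rintro x -
  obtain ⟨x, rfl⟩ := mk_surjective x
  have : (⊤ : Subalgebra A (FreeAlgebra A (Option L))) ≤ T.comap mk := by
    rw [← FreeAlgebra.adjoin_range_ι, Algebra.adjoin_le_iff]
    rintro _ ⟨_ | a, rfl⟩
    exacts [hS, h a]
  exact this trivial

/-- The universal property. -/
noncomputable def lift {B : Type*} [Ring B] [Algebra A B] (f : L →+* B) (σ : B)
    (hf : ∀ r, f (algebraMap 𝔣 L r) = algebraMap A B (algebraMap 𝔣 A r))
    (hσ : ∀ a, σ * f a = f (g a) * σ) (hn : σ ^ n = algebraMap A B t) : Cyc A g n t →ₐ[A] B :=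
  RingQuot.liftAlgHom A ⟨FreeAlgebra.lift A (fun o => o.elim σ f), by
    intro x y h
    induction h <;> simp [hf, hσ, hn]⟩

section lift
variable {B : Type*} [Ring B] [Algebra A B] (f : L →+* B) (σ : B)
    (hf : ∀ r, f (algebraMap 𝔣 L r) = algebraMap A B (algebraMap 𝔣 A r))
    (hσ : ∀ a, σ * f a = f (g a) * σ) (hn : σ ^ n = algebraMap A B t)

@[simp] lemma lift_ι (a : L) : lift f σ hf hσ hn (ι a : Cyc A g n t) = f a := by
  have := RingQuot.liftAlgHom_mkAlgHom_apply (S := A) (FreeAlgebra.lift A (fun o => o.elim σ f))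
    (s := CyclicRel 𝔣 A L g n (t : A)) (by intro x y h; induction h <;> simp [hf, hσ, hn])
    (FreeAlgebra.ι A (some a))
  exact this.trans (by simp)

@[simp] lemma lift_S : lift f σ hf hσ hn (S : Cyc A g n t) = σ := by
  have := RingQuot.liftAlgHom_mkAlgHom_apply (S := A) (FreeAlgebra.lift A (fun o => o.elim σ f))
    (s := CyclicRel 𝔣 A L g n (t : A)) (by intro x y h; induction h <;> simp [hf, hσ, hn])
    (FreeAlgebra.ι A none)
  exact this.trans (by simp)

end lift

lemma algHom_ext {B : Type*} [Ring B] [Algebra A B] {φ ψ : Cyc A g n t →ₐ[A] B}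
    (h : ∀ a, φ (ι a) = ψ (ι a)) (hS : φ S = ψ S) : φ = ψ := by
  have : AlgHom.equalizer φ ψ = ⊤ := eq_top_of_mem h hS
  ext x
  exact (this ▸ trivial : x ∈ AlgHom.equalizer φ ψ)

end Cyc
end Basics

/-! ### Normal form: every element is uniquely `∑ s ^ i z_i` with `i < n` and `z_i` in `A ⊗ L`. -/

section Coordinates

variable {𝔣 L : Type*} [Field 𝔣] [CommRing L] [Algebra 𝔣 L]
namespace Cyc

variable {A : Type*} [CommRing A] [Algebra 𝔣 A] {g : L ≃ₐ[𝔣] L} {n : ℕ} {t : Aˣ}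

/-- The quasi-periodic functions `ℤ → A ⊗ L`, a model for the regular module. -/
def model (𝔣 L : Type*) [Field 𝔣] [CommRing L] [Algebra 𝔣 L] {A : Type*} [CommRing A]
    [Algebra 𝔣 A] (n : ℕ) (t : Aˣ) : Submodule A (ℤ → A ⊗[𝔣] L) where
  carrier := {f | ∀ i, f (i - n) = (t : A) • f i}
  add_mem' hf hg i := by simp [hf i, hg i]
  zero_mem' i := by simp
  smul_mem' a f hf i := by simp [hf i, smul_comm a]

/-- The action of `L` on the model. -/
noncomputable def modelL (hg : g ^ n = 1) : L →+* Module.End A (model 𝔣 L n t) where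
  toFun a :=
    { toFun := fun f => ⟨fun i => (1 ⊗ₜ (g ^ (-i)) a) * f.1 i, fun i => by
        have : g ^ (-(i - n)) = g ^ (-i) := by
          rw [neg_sub, sub_eq_add_neg, zpow_add, zpow_natCast, hg, one_mul]
        simp only [this, f.2 i, mul_smul_comm]⟩
      map_add' := fun f f' => by ext i; simp [mul_add]
      map_smul' := fun c f => by ext i; simp }
  map_one' := by ext f i; simp [← Algebra.TensorProduct.one_def]
  map_mul' a b := by
    ext f i
    have : (1 : A) ⊗ₜ[𝔣] ((g ^ (-i)) a * (g ^ (-i)) b) = (1 ⊗ₜ (g ^ (-i)) a) * (1 ⊗ₜ (g ^ (-i)) b) := by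
      simp
    simp only [map_mul, this, mul_assoc, LinearMap.coe_mk, AddHom.coe_mk, Module.End.mul_apply]
  map_zero' := by ext f i; simp
  map_add' a b := by ext f i; simp [TensorProduct.tmul_add, add_mul]

/-- The action of `s` on the model. -/
noncomputable def modelS : Module.End A (model 𝔣 L n t) where
  toFun f := ⟨fun i => f.1 (i - 1), fun i => by
    simp only [sub_right_comm i (n : ℤ) 1]; exact f.2 _⟩
  map_add' f f' := by ext i; simp
  map_smul' c f := by ext i; simp

lemma modelS_pow (k : ℕ) (f : model 𝔣 L n t) (i : ℤ) : ((modelS ^ k) f).1 i = f.1 (i - k) := by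
  induction k generalizing i with
  | zero => simp
  | succ k ih =>
    rw [pow_succ', Module.End.mul_apply]
    change ((modelS ^ k) f).1 (i - 1) = _
    rw [ih]; push_cast; ring_nf

lemma modelL_algebraMap (hg : g ^ n = 1) (r : 𝔣) : modelL (t := t) hg (algebraMap 𝔣 L r) =
    algebraMap A (Module.End A (model 𝔣 L n t)) (algebraMap 𝔣 A r) := by
  ext f i
  change (1 ⊗ₜ (g ^ (-i)) (algebraMap 𝔣 L r)) * f.1 i = algebraMap 𝔣 A r • f.1 i
  rw [AlgEquiv.commutes, Algebra.algebraMap_eq_smul_one (A := L), TensorProduct.tmul_smul,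
    smul_mul_assoc, ← Algebra.TensorProduct.one_def, one_mul, algebraMap_smul]

lemma modelS_mul_modelL (hg : g ^ n = 1) (a : L) :
    (modelS * modelL hg a : Module.End A (model 𝔣 L n t)) = modelL hg (g a) * modelS := by
  ext f i
  change (1 ⊗ₜ (g ^ (-(i - 1))) a) * f.1 (i - 1) = (1 ⊗ₜ (g ^ (-i)) (g a)) * f.1 (i - 1)
  rw [neg_sub, sub_eq_neg_add, zpow_add, zpow_one]; rfl

lemma modelS_pow_n : (modelS ^ n : Module.End A (model 𝔣 L n t)) = algebraMap A _ (t : A) := by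
  ext f i
  rw [modelS_pow, f.2, Module.algebraMap_end_apply]; rfl

/-- The action of the cyclic algebra on the model. -/
noncomputable def toModel (hg : g ^ n = 1) : Cyc A g n t →ₐ[A] Module.End A (model 𝔣 L n t) :=
  lift (B := Module.End A (model 𝔣 L n t)) (modelL hg) modelS
    (fun r => by exact modelL_algebraMap hg r) (fun a => by exact modelS_mul_modelL hg a)
    (by exact modelS_pow_n)

/-- The element of the model that corresponds to `1`. -/
noncomputable def modelOne (n : ℕ) [NeZero n] (t : Aˣ) : model 𝔣 L n t :=
  ⟨fun i => if (n : ℤ) ∣ i then algebraMap A _ ((t ^ (-(i / n)) : Aˣ) : A) else 0, fun i => by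
    have hn : (n : ℤ) ≠ 0 := by exact_mod_cast NeZero.ne n
    change (if _ then _ else _) = (t : A) • (if _ then _ else _)
    by_cases h : (n : ℤ) ∣ i
    · rw [if_pos h, if_pos (dvd_sub h dvd_rfl), Int.sub_ediv_of_dvd _ dvd_rfl, Int.ediv_self hn,
        Algebra.smul_def, ← map_mul, neg_sub, sub_eq_add_neg, zpow_add, zpow_one, Units.val_mul]
    · rw [if_neg h, if_neg (by rwa [dvd_sub_self_right]), smul_zero]⟩

lemma modelOne_zero (n : ℕ) [NeZero n] (t : Aˣ) : (modelOne n t : model 𝔣 L n t).1 0 = 1 := by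
  simp [modelOne, Algebra.TensorProduct.one_def]

lemma modelOne_of_lt (n : ℕ) [NeZero n] (t : Aˣ) {i : ℕ} (h0 : 0 < i) (hi : i < n) :
    (modelOne n t : model 𝔣 L n t).1 i = 0 := by
  simp only [modelOne]
  rw [if_neg]
  exact_mod_cast Nat.not_dvd_of_pos_of_lt h0 hi

variable [NeZero n]

/-- Multiplication by `s` shifts the index, and the top term wraps around through `s ^ n = t`;
quasi-periodicity is exactly what absorbs this factor `t`. -/
lemma sum_S_mul_eq (f : ℤ → A ⊗[𝔣] L) (hf : ∀ i, f (i - n) = (t : A) • f i) :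
    ∑ j ∈ Finset.range n, S ^ j * (S * inc (f j)) =
      (∑ j ∈ Finset.range n, S ^ j * inc (f ((j : ℤ) - 1)) : Cyc A g n t) := by
  obtain ⟨m, rfl⟩ := Nat.exists_eq_succ_of_ne_zero (NeZero.ne n)
  rw [Finset.sum_range_succ, Finset.sum_range_succ' (fun j => S ^ j * inc (f ((j : ℤ) - 1)))]
  congr 1
  · refine Finset.sum_congr rfl fun j _ => ?_
    rw [← mul_assoc, ← pow_succ]; simp
  · have h2 : ((0 : ℕ) : ℤ) - 1 = m - (m.succ : ℕ) := by push_cast; ring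
    rw [h2, hf, map_smul, ← mul_assoc, ← pow_succ, ← Nat.succ_eq_add_one, S_pow, pow_zero, one_mul,
      Algebra.smul_def]

/-- The element `∑ s ^ i f(i)` for `f` in the model. -/
noncomputable def ofModel : model 𝔣 L n t →ₗ[A] Cyc A g n t where
  toFun f := ∑ i ∈ Finset.range n, S ^ i * inc (f.1 i)
  map_add' f f' := by simp [mul_add, Finset.sum_add_distrib]
  map_smul' c f := by simp [Finset.smul_sum]

/-- The elements `d` with this property form a subalgebra, so the generators suffice. Applied to the
vector `1` of the model, it says that an element can be recovered from its coordinates. -/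
lemma ofModel_toModel (hg : g ^ n = 1) (d : Cyc A g n t) (f : model 𝔣 L n t) :
    ofModel (toModel hg d f) = d * ofModel f := by
  let T : Subalgebra A (Cyc A g n t) :=
    { carrier := {d | ∀ f, ofModel (toModel hg d f) = d * ofModel f}
      mul_mem' := fun {a b} ha hb f => by
        rw [map_mul, Module.End.mul_apply, ha, hb, mul_assoc]
      add_mem' := fun {a b} ha hb f => by
        rw [map_add, LinearMap.add_apply, map_add, ha, hb, add_mul]
      algebraMap_mem' := fun r f => by
        rw [AlgHom.commutes, Module.algebraMap_end_apply, map_smul, Algebra.smul_def] }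
  have hT : T = ⊤ := by
    refine eq_top_of_mem (fun a f => ?_) (fun f => ?_)
    · rw [toModel, lift_ι]
      simp only [ofModel, LinearMap.coe_mk, AddHom.coe_mk, Finset.mul_sum]
      refine Finset.sum_congr rfl fun i _ => ?_
      change S ^ i * inc ((1 ⊗ₜ (g ^ (-(i : ℤ))) a) * f.1 i) = _
      rw [map_mul, ← mul_assoc, ← mul_assoc]
      congr 1
      have : ∀ (i : ℕ) (b : L), S ^ i * ι b = (ι ((g ^ i) b) * S ^ i : Cyc A g n t) := by
        intro i
        induction i with
        | zero => simp
        | succ i ih =>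
          intro b
          rw [pow_succ, mul_assoc, S_mul_ι, ← mul_assoc, ih, mul_assoc, pow_succ g]; rfl
      rw [inc_tmul, map_one, one_mul, this]
      congr 2
      rw [← AlgEquiv.mul_apply, ← zpow_natCast, ← zpow_add]; simp
    · rw [toModel, lift_S]
      simp only [ofModel, LinearMap.coe_mk, AddHom.coe_mk, Finset.mul_sum]
      change ∑ i ∈ Finset.range n, S ^ i * inc (f.1 (i - 1)) = _
      rw [← sum_S_mul_eq f.1 f.2]
      simp only [← mul_assoc, ← pow_succ, ← pow_succ']
  exact (hT ▸ trivial : d ∈ T) f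

lemma ofModel_modelOne : ofModel (modelOne n t) = (1 : Cyc A g n t) := by
  simp only [ofModel, LinearMap.coe_mk, AddHom.coe_mk]
  rw [Finset.sum_eq_single_of_mem 0 (Finset.mem_range.2 (NeZero.pos n))]
  · simp [modelOne_zero]
  · intro i hi h0
    rw [modelOne_of_lt n t (Nat.pos_of_ne_zero h0) (Finset.mem_range.1 hi)]; simp

/-- The coordinates of an element, as a quasi-periodic function: `d = ∑_{i < n} s ^ i coord d i`. -/
noncomputable def coord (hg : g ^ n = 1) (d : Cyc A g n t) : ℤ → A ⊗[𝔣] L :=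
  (toModel hg d (modelOne n t)).1

variable (hg : g ^ n = 1)

lemma sum_coord (d : Cyc A g n t) : ∑ i ∈ Finset.range n, S ^ i * inc (coord hg d i) = d := by
  have := ofModel_toModel hg d (modelOne n t)
  rwa [ofModel_modelOne, mul_one] at this

lemma coord_add (d d' : Cyc A g n t) : coord hg (d + d') = coord hg d + coord hg d' := by
  simp [coord]

lemma coord_smul (a : A) (d : Cyc A g n t) : coord hg (a • d) = a • coord hg d := by
  simp [coord]

lemma coord_S_mul (d : Cyc A g n t) (i : ℤ) : coord hg (S * d) i = coord hg d (i - 1) := by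
  rw [coord, map_mul, Module.End.mul_apply, toModel, lift_S]; rfl

lemma coord_ι_mul (a : L) (d : Cyc A g n t) (i : ℤ) :
    coord hg (ι a * d) i = (1 ⊗ₜ (g ^ (-i)) a) * coord hg d i := by
  rw [coord, map_mul, Module.End.mul_apply, toModel, lift_ι]; rfl

lemma coord_inc_mul (z : A ⊗[𝔣] L) (d : Cyc A g n t) (i : ℤ) :
    coord hg (inc z * d) i = sg A (g ^ (-i)) z * coord hg d i := by
  induction z with
  | zero => simp [coord]
  | add x y hx hy => simp only [map_add, add_mul, coord_add, Pi.add_apply, hx, hy]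
  | tmul a x =>
    rw [inc_tmul, mul_assoc, ← Algebra.smul_def, coord_smul, Pi.smul_apply, coord_ι_mul, sg_tmul,
      ← smul_mul_assoc, TensorProduct.smul_tmul', smul_eq_mul, mul_one]

lemma coord_one_zero : coord hg (1 : Cyc A g n t) 0 = 1 := by
  simp [coord, modelOne_zero]

lemma coord_sub_n (d : Cyc A g n t) (i : ℤ) : coord hg d (i - n) = (t : A) • coord hg d i :=
  (toModel hg d (modelOne n t)).2 i

lemma coord_S_pow_mul (d : Cyc A g n t) (k : ℕ) (i : ℤ) :
    coord hg (S ^ k * d) i = coord hg d (i - k) := by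
  induction k generalizing i with
  | zero => simp
  | succ k ih => rw [pow_succ', mul_assoc, coord_S_mul, ih]; congr 1; push_cast; ring

lemma coord_one_eq_zero {i : ℤ} (h : ¬ (n : ℤ) ∣ i) : coord hg (1 : Cyc A g n t) i = 0 := by
  simp [coord, modelOne, h]

lemma coord_sum {α : Type*} (s : Finset α) (d : α → Cyc A g n t) :
    coord hg (∑ a ∈ s, d a) = ∑ a ∈ s, coord hg (d a) := by
  simp [coord, map_sum, LinearMap.sum_apply]

lemma coord_ofModel (f : ℕ → A ⊗[𝔣] L) {i : ℕ} (hi : i < n) :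
    coord hg (∑ j ∈ Finset.range n, S ^ j * inc (f j) : Cyc A g n t) i = f i := by
  rw [coord_sum, Finset.sum_apply, Finset.sum_eq_single_of_mem i (Finset.mem_range.2 hi)]
  · rw [coord_S_pow_mul, ← mul_one (inc (f i)), coord_inc_mul]; simp [coord_one_zero]
  · intro j hj hji
    rw [coord_S_pow_mul, ← mul_one (inc (f j)), coord_inc_mul, coord_one_eq_zero, mul_zero]
    intro h
    have hj := Finset.mem_range.1 hj
    have := Int.eq_zero_of_abs_lt_dvd h (by rw [abs_lt]; omega)
    omega

lemma ext_coord {d d' : Cyc A g n t} (h : ∀ i < n, coord hg d (i : ℕ) = coord hg d' (i : ℕ)) :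
    d = d' := by
  rw [← sum_coord hg d, ← sum_coord hg d']
  exact Finset.sum_congr rfl fun i hi => by rw [h i (Finset.mem_range.1 hi)]

lemma model_sub_mul (f : model 𝔣 L n t) (i q : ℤ) :
    f.1 (i - n * q) = ((t ^ q : Aˣ) : A) • f.1 i := by
  induction q with
  | zero => simp
  | succ q ih =>
    have h := f.2 (i - n * q)
    rw [ih] at h
    rw [zpow_add, zpow_one, mul_comm (t ^ _), Units.val_mul, mul_smul, ← h]
    congr 1; ring
  | pred q ih =>
    have h := f.2 (i - n * (-q - 1))
    have h2 : i - n * (-q - 1) - n = i - n * -q := by ring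
    rw [h2, ih] at h
    rw [zpow_sub, zpow_one, mul_comm (t ^ _), Units.val_mul, mul_smul, h, ← mul_smul, Units.inv_mul,
      one_smul]

lemma model_ext {f f' : model 𝔣 L n t} (h : ∀ i < n, f.1 (i : ℕ) = f'.1 (i : ℕ)) : f = f' := by
  ext i
  have hn : (0 : ℤ) < n := by exact_mod_cast NeZero.pos n
  have hi : i = (i % n).toNat - n * (-(i / n)) := by
    rw [Int.toNat_of_nonneg (Int.emod_nonneg _ hn.ne')]
    linarith [Int.emod_add_mul_ediv i n]
  rw [hi, model_sub_mul, model_sub_mul, h]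
  have := Int.emod_lt_of_pos i hn
  omega

/-- Coordinates stand to the right of the powers of `s`, so they are linear for right multiplication
by `A ⊗ L`. This is what turns left multiplications into matrices over `A ⊗ L`. -/
lemma coord_mul_inc (d : Cyc A g n t) (z : A ⊗[𝔣] L) (i : ℤ) :
    coord hg (d * inc z) i = coord hg d i * z := by
  let f : model 𝔣 L n t := ⟨fun i => coord hg d i * z, fun i => by
    change coord hg d (i - n) * z = (t : A) • (coord hg d i * z)
    rw [coord_sub_n, smul_mul_assoc]⟩
  have : toModel hg (d * inc z) (modelOne n t) = f := by
    refine model_ext fun i hi => ?_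
    change coord hg (d * inc z) i = coord hg d i * z
    conv_lhs => rw [← sum_coord hg d, Finset.sum_mul]
    simp only [mul_assoc, ← map_mul]
    exact coord_ofModel hg (fun j => coord hg d j * z) hi
  exact congrFun (congrArg Subtype.val this) i

lemma coord_mul_S (d : Cyc A g n t) (i : ℤ) :
    coord hg (d * S) i = sg A g⁻¹ (coord hg d (i - 1)) := by
  let f : model 𝔣 L n t := ⟨fun i => sg A g⁻¹ (coord hg d (i - 1)), fun i => by
    change sg A g⁻¹ (coord hg d (i - n - 1)) = (t : A) • sg A g⁻¹ (coord hg d (i - 1))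
    rw [sub_right_comm, coord_sub_n, map_smul]⟩
  have : toModel hg (d * S) (modelOne n t) = f := by
    refine model_ext fun i hi => ?_
    change coord hg (d * S) i = sg A g⁻¹ (coord hg d (i - 1))
    conv_lhs => rw [← sum_coord hg d, Finset.sum_mul]
    simp only [mul_assoc, inc_mul_S]
    have key := sum_S_mul_eq (g := g) (t := t) (fun j => sg A g⁻¹ (coord hg d j))
      (fun i => by rw [coord_sub_n, map_smul])
    rw [key]
    exact coord_ofModel hg (fun j => sg A g⁻¹ (coord hg d ((j : ℤ) - 1))) hi
  exact congrFun (congrArg Subtype.val this) i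

/-- The coordinates as a linear equivalence. -/
noncomputable def coordEquiv : Cyc A g n t ≃ₗ[A] (Fin n → A ⊗[𝔣] L) where
  toFun d i := coord hg d (i : ℕ)
  map_add' d d' := by ext i; simp [coord_add]
  map_smul' a d := by ext i; simp [coord_smul]
  invFun f := ∑ i : Fin n, S ^ (i : ℕ) * inc (f i)
  left_inv d := by
    conv_rhs => rw [← sum_coord hg d, Finset.sum_range]
  right_inv f := by
    ext i
    have := coord_ofModel hg (t := t) (fun j => if h : j < n then f ⟨j, h⟩ else 0) i.2
    rw [Finset.sum_range] at this
    simpa using this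

lemma coordEquiv_apply (d : Cyc A g n t) (i : Fin n) : coordEquiv hg d i = coord hg d (i : ℕ) := rfl

lemma coordEquiv_mul_inc (d : Cyc A g n t) (z : A ⊗[𝔣] L) :
    coordEquiv hg (d * inc z) = fun i => coordEquiv hg d i * z := by
  ext i; exact coord_mul_inc hg d z i

end Cyc
end Coordinates

/-! ### Trace, norm and descent for `A ⊗ L` over `A`. -/

section Galois

variable {𝔣 L : Type*} [Field 𝔣] [Field L] [Algebra 𝔣 L]

/-- A basis of `L` over `𝔣` with the dual family for the trace form of the cyclic group
generated by `g`, and an element of trace one. -/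
structure DualBasis (g : L ≃ₐ[𝔣] L) (n : ℕ) where
  /-- the basis -/
  b : Module.Basis (Fin n) 𝔣 L
  /-- the dual family -/
  μ : Fin n → L
  pow_eq_one : g ^ n = 1
  dual : ∀ i : ℤ, ∑ j, (g ^ i) (b j) * μ j = if (n : ℤ) ∣ i then 1 else 0
  fixed : ∀ x, g x = x → x ∈ (algebraMap 𝔣 L).range

/-- By independence of characters the matrix of the `g ^ i (b_j)` is invertible, and the column of
index `0` of its inverse is the dual family. Since `g` already has `[L : 𝔣]` powers, the extension
is Galois with group generated by `g`, which gives the statement on fixed elements. -/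
lemma exists_dualBasis {n : ℕ} [NeZero n] {g : L ≃ₐ[𝔣] L} (hg : orderOf g = n)
    (hL : Module.finrank 𝔣 L = n) : Nonempty (DualBasis g n) := by
  have hgn : g ^ n = 1 := hg ▸ pow_orderOf_eq_one g
  have hfin : FiniteDimensional 𝔣 L :=
    Module.finite_of_finrank_pos (hL ▸ NeZero.pos n)
  let b : Module.Basis (Fin n) 𝔣 L := Module.finBasisOfFinrankEq 𝔣 L hL
  let M : Matrix (Fin n) (Fin n) L := Matrix.of fun i j => (g ^ (i : ℕ)) (b j)
  have hinj : Function.Injective (fun i : Fin n => ((g ^ (i : ℕ) : L ≃ₐ[𝔣] L) : L →* L)) := by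
    intro i j hij
    have : g ^ (i : ℕ) = g ^ (j : ℕ) := by
      ext x; exact DFunLike.congr_fun hij x
    exact Fin.ext (pow_injOn_Iio_orderOf (by simp [hg]) (by simp [hg]) this)
  have hM : IsUnit M := by
    rw [← Matrix.linearIndependent_rows_iff_isUnit]
    have h := (linearIndependent_monoidHom L L).comp _ hinj
    rw [Fintype.linearIndependent_iff] at h ⊢
    intro c hc
    refine h c ?_
    have hlin : (∑ i, c i • ((g ^ (i : ℕ) : L ≃ₐ[𝔣] L) : L →ₗ[𝔣] L)) = 0 := by
      refine b.ext fun j => ?_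
      have := congrFun hc j
      simpa [M, Matrix.row] using this
    ext x
    have := LinearMap.congr_fun hlin x
    simpa using this
  obtain ⟨U, hU⟩ := hM
  have hMM : M * (U⁻¹ : (Matrix (Fin n) (Fin n) L)ˣ) = 1 := by rw [← hU]; simp
  refine ⟨⟨b, fun j => (U⁻¹ : (Matrix (Fin n) (Fin n) L)ˣ).1 j 0, hgn, fun i => ?_, fun x hx => ?_⟩⟩
  · have hn : (0 : ℤ) < n := by exact_mod_cast NeZero.pos n
    have h0 := Int.emod_nonneg i hn.ne'
    have h1 := Int.emod_lt_of_pos i hn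
    obtain ⟨r, hr⟩ := Int.eq_ofNat_of_zero_le h0
    have hgi : g ^ i = g ^ r := by
      conv_lhs => rw [← Int.emod_add_mul_ediv i n, zpow_add, zpow_mul, zpow_natCast, hgn, one_zpow,
        mul_one, hr]
      simp
    have hrn : r < n := by omega
    have := congrFun (congrFun hMM ⟨r, hrn⟩) 0
    rw [Matrix.mul_apply, Matrix.one_apply] at this
    simp only [M, Matrix.of_apply] at this
    simp only [hgi, this]
    congr 1
    rw [Fin.ext_iff, Int.dvd_iff_emod_eq_zero, hr]
    simp
  · have hcard : n ≤ Nat.card (L ≃ₐ[𝔣] L) := hg ▸ orderOf_le_card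
    have hcard' : Nat.card (L ≃ₐ[𝔣] L) = n := le_antisymm
      (hL ▸ (Nat.card_eq_fintype_card (α := L ≃ₐ[𝔣] L) ▸ AlgEquiv.card_le)) hcard
    have hgal : IsGalois 𝔣 L := IsGalois.of_card_aut_eq_finrank 𝔣 L (by rw [hcard', hL])
    rw [← hL] at hcard'
    have : x ∈ (⊥ : IntermediateField 𝔣 L) := by
      rw [IsGalois.mem_bot_iff_fixed]
      intro h
      have hz : Subgroup.zpowers g = ⊤ := by
        rw [← Subgroup.card_eq_iff_eq_top, Nat.card_zpowers, hg, hcard', hL]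
      obtain ⟨k, rfl⟩ := Subgroup.mem_zpowers_iff.1 (hz ▸ trivial : h ∈ Subgroup.zpowers g)
      have hx' : g ∈ MulAction.stabilizer (L ≃ₐ[𝔣] L) x := hx
      exact (MulAction.stabilizer (L ≃ₐ[𝔣] L) x).zpow_mem hx' k
    obtain ⟨y, hy⟩ := IntermediateField.mem_bot.1 this
    exact ⟨y, hy⟩

variable {g : L ≃ₐ[𝔣] L} {n : ℕ} [NeZero n]

namespace DualBasis

variable (A : Type*) [CommRing A] [Algebra 𝔣 A]

/-- The basis of `A ⊗ L` over `A`. -/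
noncomputable def bA (G : DualBasis g n) : Module.Basis (Fin n) A (A ⊗[𝔣] L) := Algebra.TensorProduct.basis A G.b

lemma bA_apply (G : DualBasis g n) (j : Fin n) : G.bA A j = 1 ⊗ₜ G.b j := by simp [bA]

lemma dual_tensor (G : DualBasis g n) (i : ℤ) :
    ∑ j, sg A (g ^ i) (1 ⊗ₜ G.b j) * (1 ⊗ₜ[𝔣] G.μ j) =
      if (n : ℤ) ∣ i then (1 : A ⊗[𝔣] L) else 0 := by
  simp only [sg_tmul, Algebra.TensorProduct.tmul_mul_tmul, mul_one, ← TensorProduct.tmul_sum,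
    G.dual]
  split_ifs <;> simp [Algebra.TensorProduct.one_def]

variable {A}

/-- The trace to the fixed points. -/
noncomputable def tr (g : L ≃ₐ[𝔣] L) (n : ℕ) (z : A ⊗[𝔣] L) : A ⊗[𝔣] L :=
  ∑ k ∈ Finset.range n, sg A (g ^ k) z

/-- The norm to the fixed points. -/
noncomputable def nm (g : L ≃ₐ[𝔣] L) (n : ℕ) (z : A ⊗[𝔣] L) : A ⊗[𝔣] L :=
  ∏ k ∈ Finset.range n, sg A (g ^ k) z

/-- After interchanging the sums, duality kills every conjugate except the identity. The main use:
an element is zero as soon as all traces of its multiples vanish. -/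
lemma sum_tr_mul (G : DualBasis g n) (z : A ⊗[𝔣] L) :
    ∑ j, tr g n ((1 ⊗ₜ G.b j) * z) * (1 ⊗ₜ[𝔣] G.μ j) = z := by
  simp only [tr, Finset.sum_mul]
  rw [Finset.sum_comm, Finset.sum_eq_single_of_mem 0 (Finset.mem_range.2 (NeZero.pos n))]
  · have := G.dual_tensor A 0
    simp only [zpow_zero, dvd_zero, if_true, map_one, AlgEquiv.one_apply] at this
    simp only [pow_zero, map_one, AlgEquiv.one_apply, mul_right_comm _ z, ← Finset.sum_mul, this,
      one_mul]
  · intro k hk h0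
    have := G.dual_tensor A k
    have hnk : ¬ (n : ℤ) ∣ k := by
      exact_mod_cast Nat.not_dvd_of_pos_of_lt (Nat.pos_of_ne_zero h0) (Finset.mem_range.1 hk)
    rw [if_neg hnk, zpow_natCast] at this
    simp only [map_mul, mul_right_comm _ (sg A (g ^ k) z), ← Finset.sum_mul, this, zero_mul]


lemma range_prod_shift {M : Type*} [CommMonoid M] (f : ℕ → M) (h : f n = f 0) :
    ∏ k ∈ Finset.range n, f (k + 1) = ∏ k ∈ Finset.range n, f k := by
  obtain ⟨m, rfl⟩ := Nat.exists_eq_succ_of_ne_zero (NeZero.ne n)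
  rw [Finset.prod_range_succ, Finset.prod_range_succ', ← h]

lemma sg_nm (hg : g ^ n = 1) (z : A ⊗[𝔣] L) : sg A g (nm g n z) = nm g n z := by
  rw [nm, map_prod]
  have := range_prod_shift (n := n) (fun k => (sg A (g ^ k) z)) (by simp [hg])
  refine Eq.trans (Finset.prod_congr rfl fun k _ => ?_) this
  rw [← AlgEquiv.mul_apply, ← map_mul, ← pow_succ']

lemma exists_tr_eq (G : DualBasis g n) (z : A ⊗[𝔣] L) : ∃ a, tr g n z = algebraMap A _ a := by
  induction z with
  | zero => exact ⟨0, by simp [tr]⟩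
  | add x y hx hy =>
    obtain ⟨a, ha⟩ := hx
    obtain ⟨b, hb⟩ := hy
    exact ⟨a + b, by rw [map_add, ← ha, ← hb]; simp [tr, Finset.sum_add_distrib]⟩
  | tmul a x =>
    obtain ⟨r, hr⟩ := G.fixed (∑ k ∈ Finset.range n, (g ^ k) x) (by
      have := range_prod_shift (M := Multiplicative L) (n := n)
        (fun k => Multiplicative.ofAdd ((g ^ k) x)) (by simp [G.pow_eq_one])
      rw [map_sum]
      refine Eq.trans (Finset.sum_congr rfl fun k _ => ?_) this
      rw [pow_succ']; rfl)
    refine ⟨r • a, ?_⟩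
    simp only [tr, sg_tmul, ← TensorProduct.tmul_sum, ← hr]
    rw [Algebra.TensorProduct.algebraMap_apply, Algebra.algebraMap_eq_smul_one,
      TensorProduct.tmul_smul, TensorProduct.smul_tmul']
    simp

/-- An element of `L` of trace one. -/
lemma exists_tr_one (G : DualBasis g n) : ∃ x : L, tr g n ((1 : A) ⊗ₜ[𝔣] x) = 1 := by
  have h1 := G.sum_tr_mul (A := 𝔣) 1
  -- If all traces of basis elements vanished, the reconstruction formula applied to `1` would give
  -- `1 = 0`.
  obtain ⟨j, hj⟩ : ∃ j, tr g n ((1 : 𝔣) ⊗ₜ[𝔣] G.b j) ≠ 0 := by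
    by_contra! h
    simp [h] at h1
  have key : ∀ (B : Type _) [CommRing B] [Algebra 𝔣 B] (x : L), tr g n ((1 : B) ⊗ₜ[𝔣] x) =
      1 ⊗ₜ (∑ k ∈ Finset.range n, (g ^ k) x) := by
    intro B _ _ x; simp only [tr, sg_tmul, TensorProduct.tmul_sum]
  rw [key] at hj
  obtain ⟨r, hr⟩ := G.fixed (∑ k ∈ Finset.range n, (g ^ k) (G.b j)) (by
      have := range_prod_shift (M := Multiplicative L) (n := n)
        (fun k => Multiplicative.ofAdd ((g ^ k) (G.b j))) (by simp [G.pow_eq_one])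
      rw [map_sum]
      refine Eq.trans (Finset.sum_congr rfl fun k _ => ?_) this
      rw [pow_succ']; rfl)
  have hr0 : r ≠ 0 := by
    rintro rfl
    rw [← hr] at hj; simp at hj
  refine ⟨r⁻¹ • G.b j, ?_⟩
  have : ∑ k ∈ Finset.range n, (g ^ k) (r⁻¹ • G.b j) = 1 := by
    simp only [map_smul, ← Finset.smul_sum, ← hr]
    rw [Algebra.smul_def, ← map_mul, inv_mul_cancel₀ hr0, map_one]
  simp only [tr, sg_tmul, ← TensorProduct.tmul_sum, this, Algebra.TensorProduct.one_def]

/-- Multiply by an element `x` of trace one: `tr (x z) = tr (x) z = z` for fixed `z`, and traces are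
scalars. -/
lemma exists_eq_of_fixed (G : DualBasis g n) {z : A ⊗[𝔣] L} (hz : sg A g z = z) : ∃ a, z = algebraMap A _ a := by
  obtain ⟨x, hx⟩ := G.exists_tr_one (A := A)
  obtain ⟨a, ha⟩ := G.exists_tr_eq ((1 ⊗ₜ x) * z)
  refine ⟨a, ha ▸ ?_⟩
  have hk : ∀ k : ℕ, sg A (g ^ k) z = z := by
    intro k
    induction k with
    | zero => simp
    | succ k ih => rw [pow_succ, map_mul, AlgEquiv.mul_apply, hz, ih]
  simp only [tr, map_mul, hk, ← Finset.sum_mul]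
  rw [tr] at hx
  rw [hx, one_mul]

lemma exists_nm_eq (G : DualBasis g n) (z : A ⊗[𝔣] L) : ∃ a, nm g n z = algebraMap A _ a :=
  G.exists_eq_of_fixed (sg_nm G.pow_eq_one z)

lemma nm_mul (z w : A ⊗[𝔣] L) : nm g n (z * w) = nm g n z * nm g n w := by
  simp [nm, Finset.prod_mul_distrib]

lemma dvd_nm (z : A ⊗[𝔣] L) : z ∣ nm g n z := by
  have : sg A (g ^ 0) z = z := by simp
  conv_lhs => rw [← this]
  exact Finset.dvd_prod_of_mem _ (Finset.mem_range.2 (NeZero.pos n))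

lemma algebraMap_injective (G : DualBasis g n) : Function.Injective (algebraMap A (A ⊗[𝔣] L)) := by
  intro a b h
  exact Algebra.TensorProduct.includeLeft_injective (R := 𝔣) (S := 𝔣) (A := A) (B := L)
    (algebraMap 𝔣 L).injective h

end DualBasis

/-- The extension of scalars of an algebra homomorphism. -/
noncomputable def mapL (L : Type*) [Field L] [Algebra 𝔣 L] {A B : Type*} [CommRing A]
    [Algebra 𝔣 A] [CommRing B] [Algebra 𝔣 B] (f : A →ₐ[𝔣] B) : A ⊗[𝔣] L →ₐ[𝔣] B ⊗[𝔣] L :=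
  Algebra.TensorProduct.map f (AlgHom.id 𝔣 L)

section mapL
variable {A B : Type*} [CommRing A] [Algebra 𝔣 A] [CommRing B] [Algebra 𝔣 B] (f : A →ₐ[𝔣] B)

@[simp] lemma mapL_tmul (a : A) (x : L) : mapL L f (a ⊗ₜ x) = f a ⊗ₜ x := by simp [mapL]

lemma mapL_sg (h : L ≃ₐ[𝔣] L) (z : A ⊗[𝔣] L) : mapL L f (sg A h z) = sg B h (mapL L f z) := by
  induction z with
  | zero => simp
  | add x y hx hy => simp [hx, hy]
  | tmul a x => simp

lemma mapL_smul (a : A) (z : A ⊗[𝔣] L) : mapL L f (a • z) = f a • mapL L f z := by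
  induction z with
  | zero => simp
  | add x y hx hy => simp [hx, hy]
  | tmul a x => simp [TensorProduct.smul_tmul']

lemma mapL_algebraMap (a : A) : mapL L f (algebraMap A _ a) = algebraMap B _ (f a) := by
  simp [Algebra.TensorProduct.algebraMap_apply]

lemma mapL_nm (z : A ⊗[𝔣] L) : mapL L f (DualBasis.nm g n z) = DualBasis.nm g n (mapL L f z) := by
  simp only [DualBasis.nm, map_prod, mapL_sg]

lemma mapL_repr (G : DualBasis g n) (z : A ⊗[𝔣] L) (j : Fin n) :
    (G.bA B).repr (mapL L f z) j = f ((G.bA A).repr z j) := by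
  conv_lhs => rw [← (G.bA A).sum_repr z]
  rw [map_sum]
  simp only [mapL_smul, G.bA_apply A, mapL_tmul, map_one]
  simp only [← G.bA_apply B]
  rw [Module.Basis.repr_sum_self]

lemma mapL_injective (G : DualBasis g n) (hf : Function.Injective f) :
    Function.Injective (mapL L f) := by
  rw [injective_iff_map_eq_zero]
  intro z hz
  refine (G.bA A).ext_elem fun j => hf ?_
  rw [← mapL_repr, hz]; simp

lemma mapL_surjective (hf : Function.Surjective f) : Function.Surjective (mapL L f) := by
  exact TensorProduct.map_surjective hf Function.surjective_id

lemma mapL_eq_zero (G : DualBasis g n) {π : A} (hf : ∀ a, f a = 0 → π ∣ a) {z : A ⊗[𝔣] L}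
    (hz : mapL L f z = 0) : ∃ w, z = π • w := by
  have : ∀ j, ∃ c, (G.bA A).repr z j = π * c := fun j => hf _ (by rw [← mapL_repr, hz]; simp)
  choose c hc using this
  refine ⟨∑ j, c j • G.bA A j, ?_⟩
  conv_lhs => rw [← (G.bA A).sum_repr z]
  simp [hc, Finset.smul_sum, mul_smul]

end mapL

end Galois

/-! ### Integral powers of `s`, change of coefficients, and the basis `s ^ i b_j`. -/

section BaseChange

variable {𝔣 L : Type*} [Field 𝔣] [Field L] [Algebra 𝔣 L] {g : L ≃ₐ[𝔣] L} {n : ℕ}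

namespace Cyc

section S
variable {A : Type*} [CommRing A] [Algebra 𝔣 A] {t : Aˣ}

lemma S_pow_mul_inc (k : ℕ) (z : A ⊗[𝔣] L) :
    (S ^ k * inc z : Cyc A g n t) = inc (sg A (g ^ k) z) * S ^ k := by
  induction k generalizing z with
  | zero => simp
  | succ k ih =>
    rw [pow_succ, mul_assoc, S_mul_inc, ← mul_assoc, ih, mul_assoc, pow_succ g, map_mul]; rfl

variable [NeZero n]

/-- The unit `s`. -/
noncomputable def Su : (Cyc A g n t)ˣ where
  val := S
  inv := algebraMap A _ ((t⁻¹ : Aˣ) : A) * S ^ (n - 1)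
  val_inv := by
    rw [← mul_assoc, ← Algebra.commutes, mul_assoc, ← pow_succ', Nat.sub_add_cancel (NeZero.pos n),
      S_pow, ← map_mul, Units.inv_mul, map_one]
  inv_val := by
    rw [mul_assoc, ← pow_succ, Nat.sub_add_cancel (NeZero.pos n),
      S_pow, ← map_mul, Units.inv_mul, map_one]

@[simp] lemma Su_val : ((Su : (Cyc A g n t)ˣ) : Cyc A g n t) = S := rfl

/-- The integral powers of `s`. -/
noncomputable def sz (k : ℤ) : Cyc A g n t := ((Su ^ k : (Cyc A g n t)ˣ) : Cyc A g n t)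

@[simp] lemma sz_zero : (sz 0 : Cyc A g n t) = 1 := by simp [sz]

lemma sz_add (k l : ℤ) : (sz (k + l) : Cyc A g n t) = sz k * sz l := by simp [sz, zpow_add]

lemma sz_natCast (k : ℕ) : (sz k : Cyc A g n t) = S ^ k := by simp [sz]

lemma sz_one : (sz 1 : Cyc A g n t) = S := by simp [sz]

lemma sz_mul_neg (k : ℤ) : (sz k * sz (-k) : Cyc A g n t) = 1 := by simp [← sz_add]

lemma sz_neg_mul (k : ℤ) : (sz (-k) * sz k : Cyc A g n t) = 1 := by simp [← sz_add]

lemma sz_mul_inc (k : ℤ) (z : A ⊗[𝔣] L) :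
    (sz k * inc z : Cyc A g n t) = inc (sg A (g ^ k) z) * sz k := by
  have hneg : ∀ z : A ⊗[𝔣] L,
      (sz (-1) * inc z : Cyc A g n t) = inc (sg A g⁻¹ z) * sz (-1) := by
    intro z
    have h := S_mul_inc (A := A) (g := g) (n := n) (t := t) (sg A g⁻¹ z)
    rw [← AlgEquiv.mul_apply, ← map_mul, mul_inv_cancel, map_one, AlgEquiv.one_apply,
      ← sz_one] at h
    calc (sz (-1) * inc z : Cyc A g n t) = sz (-1) * (inc z * sz 1) * sz (-1) := by
          rw [mul_assoc, mul_assoc, sz_mul_neg, mul_one]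
      _ = inc (sg A g⁻¹ z) * sz (-1) := by rw [← h, ← mul_assoc, sz_neg_mul, one_mul]
  induction k generalizing z with
  | zero => simp
  | succ k ih =>
    rw [sz_add, mul_assoc, sz_one, S_mul_inc, ← mul_assoc, ih, mul_assoc,
      zpow_add_one g, map_mul]; rfl
  | pred k ih =>
    rw [sub_eq_add_neg, sz_add, mul_assoc, hneg, ← mul_assoc, ih, mul_assoc,
      zpow_add, zpow_neg_one, map_mul]; rfl

lemma inc_one_tmul (x : L) : (inc ((1 : A) ⊗ₜ[𝔣] x) : Cyc A g n t) = ι x := by simp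

lemma sz_mul_ι (k : ℤ) (x : L) : (sz k * ι x : Cyc A g n t) = ι ((g ^ k) x) * sz k := by
  rw [← inc_one_tmul, sz_mul_inc, sg_tmul, inc_one_tmul]

lemma inc_injective (hg : g ^ n = 1) : Function.Injective (inc : A ⊗[𝔣] L →ₐ[A] Cyc A g n t) := by
  intro z w h
  have := congrFun (congrArg (coord hg) h) 0
  rw [← one_mul (inc z), ← one_mul (inc w), coord_mul_inc, coord_mul_inc, coord_one_zero] at this
  simpa using this

lemma coord_inc (hg : g ^ n = 1) (z : A ⊗[𝔣] L) (i : ℤ) :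
    coord hg (inc z : Cyc A g n t) i = coord hg (1 : Cyc A g n t) i * z := by
  rw [← coord_mul_inc, one_mul]

end S

section bc
variable {A B : Type*} [CommRing A] [Algebra 𝔣 A] [CommRing B] [Algebra 𝔣 B] {t : Aˣ}

/-- Functoriality of the cyclic algebra in the ring of coefficients. -/
noncomputable def bc (f : A →ₐ[𝔣] B) :
    Cyc A g n t →+* Cyc B g n (Units.map (f : A →* B) t) :=
  letI : Algebra A (Cyc B g n (Units.map (f : A →* B) t)) :=
    Algebra.compHom (Cyc B g n (Units.map (f : A →* B) t)) (f : A →+* B)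
  (lift (A := A) (B := Cyc B g n (Units.map (f : A →* B) t)) ιHom S
    (fun r => (ι_algebraMap r).trans (congrArg (algebraMap B _) (f.commutes r).symm))
    (fun a => S_mul_ι a) S_pow).toRingHom

variable (f : A →ₐ[𝔣] B)

@[simp] lemma bc_ι (a : L) : bc f (ι a : Cyc A g n t) = ι a := by
  let : Algebra A (Cyc B g n (Units.map (f : A →* B) t)) :=
    Algebra.compHom (Cyc B g n (Units.map (f : A →* B) t)) (f : A →+* B)
  exact lift_ι (A := A) _ _ _ _ _ a

@[simp] lemma bc_S : bc f (S : Cyc A g n t) = S := by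
  let : Algebra A (Cyc B g n (Units.map (f : A →* B) t)) :=
    Algebra.compHom (Cyc B g n (Units.map (f : A →* B) t)) (f : A →+* B)
  exact lift_S (A := A) _ _ _ _ _

@[simp] lemma bc_algebraMap (a : A) :
    bc f (algebraMap A (Cyc A g n t) a) = algebraMap B _ (f a) := by
  let : Algebra A (Cyc B g n (Units.map (f : A →* B) t)) :=
    Algebra.compHom (Cyc B g n (Units.map (f : A →* B) t)) (f : A →+* B)
  exact AlgHom.commutes (lift (A := A) (B := Cyc B g n (Units.map (f : A →* B) t)) _ _ _ _ _) a

lemma bc_smul (a : A) (d : Cyc A g n t) : bc f (a • d) = f a • bc f d := by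
  rw [Algebra.smul_def, map_mul, bc_algebraMap, Algebra.smul_def]

@[simp] lemma bc_inc (z : A ⊗[𝔣] L) : bc f (inc z : Cyc A g n t) = inc (mapL L f z) := by
  induction z with
  | zero => simp
  | add x y hx hy => simp only [map_add, hx, hy]
  | tmul a x => simp

variable [NeZero n]

lemma coord_bc (hg : g ^ n = 1) (d : Cyc A g n t) {i : ℕ} (hi : i < n) :
    coord hg (bc f d) i = mapL L f (coord hg d i) := by
  conv_lhs => rw [← sum_coord hg d]
  simp only [map_sum, map_mul, map_pow, bc_S, bc_inc]
  exact coord_ofModel hg (fun j : ℕ => mapL L f (coord hg d j)) hi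

lemma bc_injective (G : DualBasis g n) (hf : Function.Injective f) :
    Function.Injective (bc f : Cyc A g n t →+* _) := by
  intro d d' h
  refine ext_coord G.pow_eq_one fun i hi => mapL_injective f G hf ?_
  rw [← coord_bc f G.pow_eq_one d hi, h, coord_bc f G.pow_eq_one d' hi]

lemma bc_surjective (hg : g ^ n = 1) (hf : Function.Surjective f) :
    Function.Surjective (bc f : Cyc A g n t →+* _) := by
  intro d
  choose z hz using fun i => mapL_surjective (L := L) f hf (coord hg d i)
  refine ⟨∑ i ∈ Finset.range n, S ^ i * inc (z i), ?_⟩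
  simp only [map_sum, map_mul, map_pow, bc_S, bc_inc, hz]
  exact sum_coord hg d

lemma bc_eq_zero (G : DualBasis g n) {π : A} (hf : ∀ a, f a = 0 → π ∣ a) {d : Cyc A g n t}
    (hd : bc f d = 0) : ∃ d', d = π • d' := by
  have h : ∀ i : ℕ, ∃ w, i < n → coord G.pow_eq_one d i = π • w := by
    intro i
    by_cases hi : i < n
    · obtain ⟨w, hw⟩ := mapL_eq_zero f G hf (z := coord G.pow_eq_one d i) (by
        rw [← coord_bc f G.pow_eq_one d hi, hd, ← zero_smul B (0 : Cyc B g n _), coord_smul]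
        simp)
      exact ⟨w, fun _ => hw⟩
    · exact ⟨0, fun h => absurd h hi⟩
  choose w hw using h
  refine ⟨∑ i ∈ Finset.range n, S ^ i * inc (w i), ?_⟩
  conv_lhs => rw [← sum_coord G.pow_eq_one d]
  rw [Finset.smul_sum]
  refine Finset.sum_congr rfl fun i hi => ?_
  rw [hw i (Finset.mem_range.1 hi), map_smul, mul_smul_comm]

end bc

section basis
variable {A : Type*} [CommRing A] [Algebra 𝔣 A] {t : Aˣ} [NeZero n]

/-- The basis `s ^ i ℓ_j`. -/
noncomputable def basis (G : DualBasis g n) (A : Type*) [CommRing A] [Algebra 𝔣 A] (t : Aˣ) :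
    Module.Basis (Σ _ : Fin n, Fin n) A (Cyc A g n t) :=
  (Pi.basis fun _ : Fin n => G.bA A).map (coordEquiv G.pow_eq_one).symm

lemma basis_apply (G : DualBasis g n) (p : Σ _ : Fin n, Fin n) :
    basis G A t p = S ^ (p.1 : ℕ) * ι (G.b p.2) := by
  rw [basis, Module.Basis.map_apply, Pi.basis_apply]
  change ∑ i : Fin n, S ^ (i : ℕ) * inc ((Pi.single p.1 (G.bA A p.2) : Fin n → A ⊗[𝔣] L) i) = _
  rw [Finset.sum_eq_single p.1]
  · rw [Pi.single_eq_same, G.bA_apply A, inc_one_tmul]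
  · intro i _ hi; rw [Pi.single_eq_of_ne hi]; simp
  · simp

lemma finrank_eq [Nontrivial A] (G : DualBasis g n) : Module.finrank A (Cyc A g n t) = n * n := by
  rw [Module.finrank_eq_card_basis (basis G A t)]; simp

lemma finite_of_dual (G : DualBasis g n) : Module.Finite A (Cyc A g n t) :=
  Module.Finite.of_basis (basis G A t)

lemma free_of_dual (G : DualBasis g n) : Module.Free A (Cyc A g n t) :=
  Module.Free.of_basis (basis G A t)

end basis

end Cyc
end BaseChange

/-! ### Subfields of division algebras of dimension `n ^ 2` with `n` prime, and cyclic vectors. -/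

section Degree

/-- A subalgebra of a finite-dimensional division algebra is a division ring, over which the whole
algebra is free. -/
lemma Subalgebra.finrank_dvd {K Λ : Type*} [Field K] [Ring Λ] [IsDomain Λ] [Algebra K Λ]
    [FiniteDimensional K Λ] (B : Subalgebra K Λ) : Module.finrank K B ∣ Module.finrank K Λ := by
  letI : DivisionRing B := divisionRingOfFiniteDimensional K B
  have hfree : Module.Free B Λ := Module.Free.of_divisionRing B Λ
  have hrank : StrongRankCondition B := inferInstance
  exact ⟨_, (Module.finrank_mul_finrank K B Λ).symm⟩

lemma finrank_adjoin_singleton {K Λ : Type*} [Field K] [Ring Λ] [Algebra K Λ]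
    [FiniteDimensional K Λ] (c : Λ) :
    Module.finrank K (Algebra.adjoin K {c}) = (minpoly K c).natDegree := by
  classical
  have h := Submodule.span_range_natDegree_eq_adjoin (minpoly.monic (Algebra.IsIntegral.isIntegral (R := K) c))
    (minpoly.aeval K c)
  have h2 : Set.range (fun i : Fin (minpoly K c).natDegree => c ^ (i : ℕ)) =
      ↑(Finset.image (fun i => c ^ i) (Finset.range (minpoly K c).natDegree)) := by
    ext x
    simp only [Set.mem_range, Finset.coe_image, Finset.coe_range, Set.mem_image, Set.mem_Iio]
    exact ⟨fun ⟨i, hi⟩ => ⟨i, i.2, hi⟩, fun ⟨i, hi, h⟩ => ⟨⟨i, hi⟩, h⟩⟩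
  rw [← h2] at h
  have h3 := finrank_span_eq_card (linearIndependent_pow (K := K) c)
  rw [h, Fintype.card_fin] at h3
  exact h3

variable {K Λ : Type*} [Field K] [Ring Λ] [IsDomain Λ] [Algebra K Λ] [FiniteDimensional K Λ]
  {n : ℕ}

/-- In a noncommutative division algebra of dimension `n * n`, `n` prime, a commutative subalgebra
other than the base field has dimension `n`. -/
lemma Subalgebra.finrank_eq_of_commute (hn : n.Prime) (hΛ : Module.finrank K Λ = n * n)
    (hnc : ∃ x y : Λ, x * y ≠ y * x) (B : Subalgebra K Λ) (hB : ∀ x ∈ B, ∀ y ∈ B, x * y = y * x)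
    (h1 : B ≠ ⊥) : Module.finrank K B = n := by
  have hd := B.finrank_dvd
  rw [hΛ, ← pow_two, Nat.dvd_prime_pow hn] at hd
  obtain ⟨m, hm, hd⟩ := hd
  interval_cases m
  · rw [pow_zero, Subalgebra.finrank_eq_one_iff] at hd
    exact absurd hd h1
  · simpa using hd
  · exfalso
    have : B = ⊤ := Subalgebra.eq_of_le_of_finrank_eq le_top (by
      rw [hd, pow_two, ← hΛ]; exact (Subalgebra.topEquiv (R := K) (A := Λ)).toLinearEquiv.finrank_eq.symm)
    obtain ⟨x, y, hxy⟩ := hnc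
    exact hxy (hB x (this ▸ Algebra.mem_top) y (this ▸ Algebra.mem_top))

lemma adjoin_commute {s : Set Λ} (hs : ∀ x ∈ s, ∀ y ∈ s, x * y = y * x) :
    ∀ x ∈ Algebra.adjoin K s, ∀ y ∈ Algebra.adjoin K s, x * y = y * x := by
  intro x hx y hy
  have := Algebra.isMulCommutative_adjoin K hs
  exact congrArg Subtype.val (mul_comm' (⟨x, hx⟩ : Algebra.adjoin K s) ⟨y, hy⟩)

lemma adjoin_ne_bot {c : Λ} (hc : c ∉ (algebraMap K Λ).range) {s : Set Λ} (hs : c ∈ s) :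
    Algebra.adjoin K s ≠ ⊥ := fun h => hc (by
  have := Algebra.subset_adjoin (R := K) hs
  rw [h] at this
  obtain ⟨x, hx⟩ := this
  exact ⟨x, hx⟩)

lemma natDegree_minpoly_eq (hn : n.Prime) (hΛ : Module.finrank K Λ = n * n)
    (hnc : ∃ x y : Λ, x * y ≠ y * x) {c : Λ} (hc : c ∉ (algebraMap K Λ).range) :
    (minpoly K c).natDegree = n := by
  rw [← finrank_adjoin_singleton]
  exact Subalgebra.finrank_eq_of_commute hn hΛ hnc _ (adjoin_commute (by simp))
    (adjoin_ne_bot hc rfl)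

/-- If `y` commutes with `c`, then `K[c] ⊆ K[c, y]` are both commutative and larger than `K`, so
both have dimension `n` and coincide. -/
lemma centralizer_singleton_eq_adjoin (hn : n.Prime) (hΛ : Module.finrank K Λ = n * n)
    (hnc : ∃ x y : Λ, x * y ≠ y * x) {c : Λ} (hc : c ∉ (algebraMap K Λ).range) :
    Subalgebra.centralizer K {c} = Algebra.adjoin K {c} := by
  apply le_antisymm
  · intro y hy
    rw [Subalgebra.mem_centralizer_iff] at hy
    have hy : c * y = y * c := hy c rfl
    have h2 : Algebra.adjoin K {c} = Algebra.adjoin K {c, y} := by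
      apply Subalgebra.eq_of_le_of_finrank_eq (Algebra.adjoin_mono (by simp))
      rw [Subalgebra.finrank_eq_of_commute hn hΛ hnc _ (adjoin_commute (s := {c}) (by simp))
        (adjoin_ne_bot hc rfl), Subalgebra.finrank_eq_of_commute hn hΛ hnc _ (adjoin_commute (s := {c, y}) ?_)
        (adjoin_ne_bot hc (by simp))]
      rintro x (rfl | rfl) z (rfl | rfl) <;> simp [hy]
    rw [h2]
    exact Algebra.subset_adjoin (by simp)
  · rw [Algebra.adjoin_le_iff, Set.singleton_subset_iff]
    exact Subalgebra.mem_centralizer_iff K |>.2 (by simp)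

/-- A cyclic vector theorem. -/
lemma exists_cyclic_vector {E : Type*} [Field E] {V : Type*} [AddCommGroup V] [Module E V]
    [FiniteDimensional E V] (T : V →ₗ[E] V)
    (hT : ∀ z : Fin n → E, ∑ i, z i • T ^ (i : ℕ) = 0 → z = 0) :
    ∃ v : V, ∀ z : Fin n → E, ∑ i, z i • (T ^ (i : ℕ)) v = 0 → z = 0 := by
  -- Over the principal ideal domain `E[X]` some vector has the same annihilator as the whole
  -- module; a relation among the `T ^ i v` is then a relation among the `T ^ i`.
  obtain ⟨x, hx⟩ := Module.exists_ker_toSpanSingleton_eq_annihilator (Polynomial E)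
    (Module.AEval' T)
  refine ⟨(Module.AEval'.of T).symm x, fun z hz => hT z ?_⟩
  set p : Polynomial E := ∑ i : Fin n, Polynomial.monomial (i : ℕ) (z i) with hp
  have hpT : Polynomial.aeval T p = ∑ i, z i • T ^ (i : ℕ) := by
    simp [hp, Polynomial.aeval_monomial, Algebra.smul_def]
  have h1 : p ∈ (LinearMap.toSpanSingleton (Polynomial E) (Module.AEval' T) x).ker := by
    rw [LinearMap.mem_ker, LinearMap.toSpanSingleton_apply]
    have h2 : p • x = Module.AEval'.of T (Polynomial.aeval T p ((Module.AEval'.of T).symm x)) := rfl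
    rw [h2, hpT, LinearMap.sum_apply]
    simp only [LinearMap.smul_apply, hz, map_zero]
  rw [hx, Module.mem_annihilator] at h1
  ext y
  have h2 := h1 (Module.AEval'.of T y)
  have h3 : p • (Module.AEval'.of T y) = Module.AEval'.of T (Polynomial.aeval T p y) := rfl
  rw [h3, hpT, LinearEquiv.map_eq_zero_iff] at h2
  exact h2

lemma Matrix.exists_cyclic_vector {E : Type*} [CommRing E] (hE : IsField E)
    (T : Matrix (Fin n) (Fin n) E)
    (hT : ∀ z : Fin n → E, ∑ i, z i • T ^ (i : ℕ) = 0 → z = 0) :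
    ∃ v : Fin n → E, (Matrix.of fun i j : Fin n => ((T ^ (j : ℕ)).mulVec v) i).det ≠ 0 := by
  letI := hE.toField
  obtain ⟨v, hv⟩ := _root_.exists_cyclic_vector (E := E) (Matrix.toLin' T) (fun z hz => hT z (by
    apply (Matrix.toLin' (R := E)).injective
    rw [map_zero, ← hz, map_sum]
    exact Finset.sum_congr rfl fun i _ => by rw [map_smul, Matrix.toLin'_pow]))
  refine ⟨v, fun h => ?_⟩
  obtain ⟨z, hz0, hz⟩ := Matrix.exists_mulVec_eq_zero_iff.2 h
  refine hz0 (hv z ?_)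
  ext i
  have := congrFun hz i
  simpa [Matrix.mulVec, dotProduct, ← Matrix.toLin'_pow, mul_comm] using this

end Degree

/-! ### Left multiplication as a matrix over `A ⊗ L`; cyclic vectors for the pair `(c, L)`. -/

section Generic

variable {𝔣 L : Type*} [Field 𝔣] [Field L] [Algebra 𝔣 L] {g : L ≃ₐ[𝔣] L} {n : ℕ} [NeZero n]

namespace Cyc

section
variable {A : Type*} [CommRing A] [Algebra 𝔣 A] {t : Aˣ} (hg : g ^ n = 1)

lemma mul_eq_sum_coord (d e : Cyc A g n t) :
    d * e = ∑ j : Fin n, d * S ^ (j : ℕ) * inc (coord hg e j) := by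
  conv_lhs => rw [← sum_coord hg e, Finset.mul_sum, Finset.sum_range]
  simp only [mul_assoc]

lemma coord_mul (d e : Cyc A g n t) (i : ℤ) :
    coord hg (d * e) i = ∑ j : Fin n, coord hg (d * S ^ (j : ℕ)) i * coord hg e j := by
  rw [mul_eq_sum_coord hg, coord_sum, Finset.sum_apply]
  simp only [coord_mul_inc]

/-- The matrix over `A ⊗ L` of left multiplication. -/
noncomputable def lmat (d : Cyc A g n t) : Matrix (Fin n) (Fin n) (A ⊗[𝔣] L) :=
  Matrix.of fun i j => coord hg (d * S ^ (j : ℕ)) (i : ℕ)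

lemma lmat_apply (d : Cyc A g n t) (i j : Fin n) :
    lmat hg d i j = coord hg (d * S ^ (j : ℕ)) (i : ℕ) := rfl

lemma lmat_mulVec (d e : Cyc A g n t) :
    (lmat hg d).mulVec (coordEquiv hg e) = coordEquiv hg (d * e) := by
  ext i
  rw [coordEquiv_apply, coord_mul]
  rfl

lemma lmat_mul (d e : Cyc A g n t) : lmat hg (d * e) = lmat hg d * lmat hg e := by
  ext i j
  rw [lmat_apply, mul_assoc, coord_mul]
  rfl

lemma lmat_one : lmat hg (1 : Cyc A g n t) = 1 := by
  ext i j
  rw [lmat_apply, one_mul, ← mul_one (S ^ _), coord_S_pow_mul, Matrix.one_apply]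
  split_ifs with h
  · rw [h, sub_self, coord_one_zero]
  · refine coord_one_eq_zero hg fun ⟨k, hk⟩ => h (Fin.ext ?_)
    have h1 := i.2
    have h2 := j.2
    have hk0 : k = 0 := by
      by_contra hk0
      rcases lt_or_gt_of_ne hk0 with h' | h' <;> nlinarith
    subst hk0
    omega

lemma lmat_pow (d : Cyc A g n t) (k : ℕ) : lmat hg (d ^ k) = lmat hg d ^ k := by
  induction k with
  | zero => simp [lmat_one]
  | succ k ih => rw [pow_succ, pow_succ, lmat_mul, ih]

/-- The matrix of the vectors `c ^ j * v`. -/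
noncomputable def cmat (c v : Cyc A g n t) : Matrix (Fin n) (Fin n) (A ⊗[𝔣] L) :=
  Matrix.of fun i j => coord hg (c ^ (j : ℕ) * v) (i : ℕ)

lemma cmat_apply (c v : Cyc A g n t) (i j : Fin n) :
    cmat hg c v i j = coord hg (c ^ (j : ℕ) * v) (i : ℕ) := rfl

lemma coordEquiv_sum_mul_inc (c v : Cyc A g n t) (z : Fin n → A ⊗[𝔣] L) :
    coordEquiv hg (∑ j : Fin n, c ^ (j : ℕ) * v * inc (z j)) = (cmat hg c v).mulVec z := by
  ext i
  rw [coordEquiv_apply, coord_sum, Finset.sum_apply]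
  simp only [coord_mul_inc]
  rfl

/-- Cramer's rule. In particular, if the determinant is a unit, the vectors `c ^ j v` span
everything over `A ⊗ L`. -/
lemma exists_eq_sum_of_det (c v d : Cyc A g n t) :
    ∃ z : Fin n → A ⊗[𝔣] L, d * inc (cmat hg c v).det =
      ∑ j : Fin n, c ^ (j : ℕ) * v * inc (z j) := by
  refine ⟨(cmat hg c v).adjugate.mulVec (coordEquiv hg d), (coordEquiv hg).injective ?_⟩
  rw [coordEquiv_sum_mul_inc, Matrix.mulVec_mulVec, Matrix.mul_adjugate, coordEquiv_mul_inc,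
    Matrix.smul_mulVec, Matrix.one_mulVec]
  ext i
  simp [mul_comm]

end

variable {K : Type*} [Field K] [Algebra 𝔣 K] {t : Kˣ}

/-- If `s` commuted with `L`, then `g` would be the identity, and the duality relations for the
exponents `0` and `1` would contradict each other. -/
lemma exists_not_commute (G : DualBasis g n) (hn : n.Prime) :
    ∃ x y : Cyc K g n t, x * y ≠ y * x := by
  by_contra! h
  have hg1 : ∀ a : L, g a = a := by
    intro a
    have h1 := h S (ι a)
    rw [S_mul_ι] at h1
    have hS : IsUnit (S : Cyc K g n t) := ⟨Su, rfl⟩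
    have h3 := hS.mul_right_cancel h1
    rw [← inc_one_tmul, ← inc_one_tmul] at h3
    have h4 := inc_injective G.pow_eq_one h3
    exact Algebra.TensorProduct.includeRight_injective (algebraMap 𝔣 K).injective h4
  have h0 := G.dual 0
  have h1 := G.dual 1
  have : ¬ ((n : ℤ) ∣ 1) := by
    intro h
    exact hn.one_lt.ne' (by exact_mod_cast Int.eq_one_of_dvd_one (by positivity) h)
  simp [hg1, this] at h0 h1
  rw [h0] at h1
  exact one_ne_zero h1

lemma isField_tensor (G : DualBasis g n) (hD : IsDomain (Cyc K g n t)) : IsField (K ⊗[𝔣] L) := by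
  have hdom : IsDomain (K ⊗[𝔣] L) :=
    (inc_injective (A := K) (t := t) G.pow_eq_one).isDomain (inc (t := t) : K ⊗[𝔣] L →ₐ[K] Cyc K g n t).toRingHom
  have : Module.Finite K (K ⊗[𝔣] L) := Module.Finite.of_basis (G.bA K)
  exact isField_of_isIntegral_of_isField' (Field.toIsField K)

/-- A noncentral element of a cyclic division algebra has a cyclic vector with respect to the
right structure over `K ⊗ L`. -/
lemma exists_det_cmat_ne_zero (G : DualBasis g n) (hn : n.Prime) (hD : IsDomain (Cyc K g n t))
    {c : Cyc K g n t} (hc : c ∉ (algebraMap K (Cyc K g n t)).range) :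
    ∃ v, (cmat G.pow_eq_one c v).det ≠ 0 := by
  have hg := G.pow_eq_one
  have := finite_of_dual G (A := K) (t := t)
  have hdeg := natDegree_minpoly_eq hn (finrank_eq G) (exists_not_commute G hn) hc
  obtain ⟨v, hv⟩ := Matrix.exists_cyclic_vector (isField_tensor G hD) (lmat hg c) (by
    intro z hz
    have h1 : ∀ (d : Cyc K g n t), ∑ i : Fin n, c ^ (i : ℕ) * d * inc (z i) = 0 := by
      intro d
      apply (coordEquiv hg).injective
      have := congrArg (fun M => M.mulVec (coordEquiv hg d)) hz
      simp only [Matrix.sum_mulVec, ← lmat_pow, Matrix.smul_mulVec, lmat_mulVec,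
        Matrix.zero_mulVec] at this
      rw [map_zero, ← this, map_sum]
      refine Finset.sum_congr rfl fun i _ => ?_
      rw [coordEquiv_mul_inc]
      ext; simp [mul_comm]
    -- The relation holds for every `d`. Taking `d = s ^ k`, multiplying by `w s ^ (-k)` and summing
    -- over `k` replaces the coefficients by traces, which lie in `K`; there the independence of the
    -- powers of `c` applies.
    have h2 : ∀ w : K ⊗[𝔣] L, ∀ i, DualBasis.tr g n (w * z i) = 0 := by
      intro w
      have h3 : ∀ k : ℕ, ∑ i : Fin n, c ^ (i : ℕ) * inc (sg K (g ^ k) (w * z i)) = 0 := by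
        intro k
        have h4 := h1 (sz k)
        have h4 := congrArg (fun x => x * (inc w * sz (-k))) (h1 (sz k))
        simp only [zero_mul, Finset.sum_mul] at h4
        rw [← h4]
        refine Finset.sum_congr rfl fun i _ => ?_
        calc c ^ (i : ℕ) * inc (sg K (g ^ k) (w * z i))
            = c ^ (i : ℕ) * (inc (sg K (g ^ (k : ℤ)) (z i * w)) * (sz k * sz (-k))) := by
              rw [sz_mul_neg, mul_one, mul_comm w, zpow_natCast]
          _ = c ^ (i : ℕ) * sz k * inc (z i) * (inc w * sz (-k)) := by
              rw [← mul_assoc (inc _), ← sz_mul_inc, map_mul]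
              simp only [mul_assoc]
      have h5 : ∑ i : Fin n, c ^ (i : ℕ) * inc (DualBasis.tr g n (w * z i)) = 0 := by
        simp only [DualBasis.tr, map_sum, Finset.mul_sum]
        rw [Finset.sum_comm]
        exact Finset.sum_eq_zero fun k _ => h3 k
      choose a ha using fun i => G.exists_tr_eq (w * z i)
      have h6 := linearIndependent_pow (K := K) c
      rw [hdeg, Fintype.linearIndependent_iff] at h6
      have h7 := h6 a (by
        rw [← h5]
        refine Finset.sum_congr rfl fun i _ => ?_
        rw [ha, AlgHom.commutes, Algebra.smul_def, Algebra.commutes])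
      intro i
      rw [ha, h7, map_zero]
    ext i
    rw [← G.sum_tr_mul (z i)]
    simp [h2])
  refine ⟨(coordEquiv hg).symm v, ?_⟩
  convert hv using 2
  ext i j
  rw [Matrix.of_apply, cmat_apply, ← coordEquiv_apply, ← lmat_mulVec, LinearEquiv.apply_symm_apply, lmat_pow]

end Cyc
end Generic

/-! ### Twisted polynomials in `s` over `L`: leading coefficients and Euclidean division. -/

section Domain

variable {𝔣 L : Type*} [Field 𝔣] [Field L] [Algebra 𝔣 L] {g : L ≃ₐ[𝔣] L} {n : ℕ} [NeZero n]

/-- The element `t` of the rational function field as a unit. -/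
noncomputable abbrev ratX (𝔣 : Type*) [Field 𝔣] : (RatFunc 𝔣)ˣ := Units.mk0 RatFunc.X RatFunc.X_ne_zero

lemma sum_range_mul_eq {M : Type*} [AddCommMonoid M] (f : ℕ → M) (n Q : ℕ) :
    ∑ i ∈ Finset.range (n * Q), f i = ∑ r ∈ Finset.range n, ∑ q ∈ Finset.range Q, f (n * q + r) := by
  rw [Finset.sum_comm]
  induction Q with
  | zero => simp
  | succ Q ih => rw [mul_add, mul_one, Finset.sum_range_add, ih, Finset.sum_range_succ]

namespace Cyc

/-- The additive group of the elements `∑ i < m, a_i s ^ i` with `a_i` in `L`. -/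
noncomputable def skewPoly (𝔣 L : Type*) [Field 𝔣] [Field L] [Algebra 𝔣 L] (g : L ≃ₐ[𝔣] L) (n : ℕ) (m : ℕ) :
    AddSubgroup (Cyc (RatFunc 𝔣) g n (ratX 𝔣)) :=
  AddSubgroup.closure {x | ∃ a : L, ∃ i < m, x = ι a * S ^ i}

local notation "D" => Cyc (RatFunc 𝔣) g n (ratX 𝔣)
local notation "P" => skewPoly 𝔣 L g n

lemma ι_mul_S_pow_mem {m i : ℕ} (a : L) (h : i < m) : (ι a * S ^ i : D) ∈ P m :=
  AddSubgroup.subset_closure ⟨a, i, h, rfl⟩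

lemma skewPoly_mono {m k : ℕ} (h : m ≤ k) : P m ≤ P k :=
  AddSubgroup.closure_mono fun _ ⟨a, i, hi, hx⟩ => ⟨a, i, hi.trans_le h, hx⟩

lemma skewPoly_zero {x : D} (h : x ∈ P 0) : x = 0 := by
  have : {x : D | ∃ a : L, ∃ i < 0, x = ι a * S ^ i} = ∅ := by ext; simp
  rw [skewPoly, this, AddSubgroup.closure_empty] at h
  simpa using h

lemma ι_zero {A : Type*} [CommRing A] [Algebra 𝔣 A] {t : Aˣ} : (ι 0 : Cyc A g n t) = 0 :=
  map_zero (ιHom (A := A) (g := g) (n := n) (t := t))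

lemma ι_neg {A : Type*} [CommRing A] [Algebra 𝔣 A] {t : Aˣ} (a : L) :
    (ι (-a) : Cyc A g n t) = -ι a :=
  map_neg (ιHom (A := A) (g := g) (n := n) (t := t)) a

lemma exists_top_coeff {m : ℕ} {x : D} (h : x ∈ P (m + 1)) : ∃ a, x - ι a * S ^ m ∈ P m := by
  induction h using AddSubgroup.closure_induction with
  | mem x hx =>
    obtain ⟨a, i, hi, rfl⟩ := hx
    rcases (Nat.lt_succ_iff.1 hi).eq_or_lt with rfl | hi
    · exact ⟨a, by simp⟩
    · exact ⟨0, by simpa [ι_zero] using ι_mul_S_pow_mem a hi⟩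
  | zero => exact ⟨0, by simp [ι_zero]⟩
  | add x y _ _ hx hy =>
    obtain ⟨a, ha⟩ := hx
    obtain ⟨b, hb⟩ := hy
    refine ⟨a + b, ?_⟩
    convert add_mem ha hb using 1
    rw [ι_add]; noncomm_ring
  | neg x _ hx =>
    obtain ⟨a, ha⟩ := hx
    refine ⟨-a, ?_⟩
    convert neg_mem ha using 1
    rw [ι_neg]; noncomm_ring

lemma exists_eq_sum_of_mem_skewPoly {m : ℕ} {x : D} (h : x ∈ P m) :
    ∃ a : ℕ → L, (∀ i, m ≤ i → a i = 0) ∧ x = ∑ i ∈ Finset.range m, ι (a i) * S ^ i := by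
  induction m generalizing x with
  | zero => exact ⟨0, by simp, by simpa using skewPoly_zero h⟩
  | succ m ih =>
    obtain ⟨b, hb⟩ := exists_top_coeff h
    obtain ⟨a, ha0, ha⟩ := ih hb
    refine ⟨fun i => if i = m then b else a i, fun i hi => ?_, ?_⟩
    · beta_reduce; rw [if_neg (by omega), ha0 i (by omega)]
    · beta_reduce; rw [Finset.sum_range_succ, if_pos rfl, ← sub_eq_iff_eq_add, ha]
      refine Finset.sum_congr rfl fun i hi => ?_
      rw [if_neg (Finset.mem_range.1 hi).ne]

lemma skewPoly_mul {m k : ℕ} {x y : D} (hx : x ∈ P m) (hy : y ∈ P (k + 1)) : x * y ∈ P (m + k) := by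
  induction hx using AddSubgroup.closure_induction with
  | mem x hx =>
    obtain ⟨a, i, hi, rfl⟩ := hx
    induction hy using AddSubgroup.closure_induction with
    | mem y hy =>
      obtain ⟨b, j, hj, rfl⟩ := hy
      have : (ι a * S ^ i * (ι b * S ^ j) : D) = ι (a * (g ^ i) b) * S ^ (i + j) := by
        have h := sz_mul_ι (A := RatFunc 𝔣) (t := ratX 𝔣) (g := g) (n := n) i b
        rw [sz_natCast, zpow_natCast] at h
        rw [mul_assoc, ← mul_assoc _ (ι b), h, ι_mul, pow_add]
        simp only [mul_assoc]
      rw [this]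
      exact ι_mul_S_pow_mem _ (by omega)
    | zero => simp
    | add y z _ _ h1 h2 => rw [mul_add]; exact add_mem h1 h2
    | neg y _ h => rw [mul_neg]; exact neg_mem h
  | zero => simp
  | add y z _ _ h1 h2 => rw [add_mul]; exact add_mem h1 h2
  | neg y _ h => rw [neg_mul]; exact neg_mem h

lemma ratFunc_sum_eq_zero {Q : ℕ} {a : ℕ → 𝔣}
    (h : ∑ q ∈ Finset.range Q, (RatFunc.X : RatFunc 𝔣) ^ q * algebraMap 𝔣 (RatFunc 𝔣) (a q) = 0) :
    ∀ q < Q, a q = 0 := by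
  have h1 : algebraMap (Polynomial 𝔣) (RatFunc 𝔣) (∑ q ∈ Finset.range Q, Polynomial.monomial q (a q)) = 0 := by
    rw [map_sum, ← h]
    refine Finset.sum_congr rfl fun q _ => ?_
    rw [← Polynomial.C_mul_X_pow_eq_monomial, map_mul, map_pow, RatFunc.algebraMap_X, mul_comm]
    congr 1
  rw [map_eq_zero_iff _ (IsFractionRing.injective _ _)] at h1
  intro q hq
  have := congrArg (fun p => Polynomial.coeff p q) h1
  simpa [Polynomial.finsetSum_coeff, Polynomial.coeff_monomial, hq] using this

/-- The elements `a s ^ i` are linearly independent. -/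
lemma eq_zero_of_sum_eq_zero (G : DualBasis g n) {Q : ℕ} {a : ℕ → L}
    (h : ∑ i ∈ Finset.range (n * Q), (ι (a i) * S ^ i : D) = 0) : ∀ i < n * Q, a i = 0 := by
  have hg := G.pow_eq_one
  -- Write `i = n q + r` and use `a s ^ (n q + r) = t ^ q s ^ r g ^ (-r) (a)`. The vanishing of the
  -- coordinate at `s ^ r` then becomes the vanishing of polynomials in `t`.
  set y : ℕ → RatFunc 𝔣 ⊗[𝔣] L := fun r => ∑ q ∈ Finset.range Q,
    ((RatFunc.X : RatFunc 𝔣) ^ q) ⊗ₜ[𝔣] (g ^ (r : ℕ))⁻¹ (a (n * q + r)) with hy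
  have h1 : ∑ r ∈ Finset.range n, (S ^ r * inc (y r) : D) = 0 := by
    rw [← h, sum_range_mul_eq]
    refine Finset.sum_congr rfl fun r _ => ?_
    simp only [hy, map_sum, Finset.mul_sum]
    refine Finset.sum_congr rfl fun q _ => ?_
    have h2 := sz_mul_ι (A := RatFunc 𝔣) (t := ratX 𝔣) (g := g) (n := n) r ((g ^ (r : ℕ))⁻¹ (a (n * q + r)))
    rw [sz_natCast, zpow_natCast, ← AlgEquiv.mul_apply, mul_inv_cancel, AlgEquiv.one_apply] at h2
    rw [inc_tmul, ← mul_assoc, ← Algebra.commutes, mul_assoc, h2, pow_add, pow_mul,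
      S_pow, Units.val_mk0, ← map_pow, ← mul_assoc, ← mul_assoc, Algebra.commutes]
  have h2 : ∀ r < n, y r = 0 := by
    intro r hr
    have h3 := coord_ofModel hg (t := ratX 𝔣) y hr
    rw [h1] at h3
    rw [← h3]
    have := coord_smul hg (t := ratX 𝔣) (0 : RatFunc 𝔣) 0
    rw [zero_smul, zero_smul] at this
    rw [this]; rfl
  intro i hi
  have hr : i % n < n := Nat.mod_lt _ (NeZero.pos n)
  have h3 := h2 _ hr
  have h4 : ∀ j, G.b.repr ((g ^ (i % n))⁻¹ (a (n * (i / n) + i % n))) j = 0 := by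
    intro j
    have h5 := congrArg (fun z => (G.bA (RatFunc 𝔣)).repr z j) h3
    simp only [hy, map_sum, Finsupp.finsetSum_apply, map_zero, Finsupp.zero_apply, DualBasis.bA,
      Algebra.TensorProduct.basis_repr_tmul, Finsupp.smul_apply, Finsupp.mapRange_apply] at h5
    exact ratFunc_sum_eq_zero h5 (i / n) (Nat.div_lt_of_lt_mul hi)
  have h5 : (g ^ (i % n))⁻¹ (a (n * (i / n) + i % n)) = 0 := G.b.repr.map_eq_zero_iff.1 (by ext j; exact h4 j)
  rw [Nat.div_add_mod] at h5
  simpa using h5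

lemma top_coeff_eq_zero (G : DualBasis g n) {m : ℕ} {a : L} (h : (ι a * S ^ m : D) ∈ P m) : a = 0 := by
  obtain ⟨b, hb0, hb⟩ := exists_eq_sum_of_mem_skewPoly h
  have hm : m < n * (m + 1) := by nlinarith [NeZero.pos n]
  have := eq_zero_of_sum_eq_zero G (Q := m + 1) (a := fun i => if i = m then a else - b i) (by
    rw [← Finset.sum_subset (Finset.range_mono (Nat.succ_le_of_lt hm)), Finset.sum_range_succ, if_pos rfl, hb,
      ← Finset.sum_add_distrib]
    · refine Finset.sum_eq_zero fun i hi => ?_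
      rw [if_neg (Finset.mem_range.1 hi).ne, ι_neg]; simp
    · intro i _ hi
      simp only [Finset.mem_range, not_lt] at hi
      rw [if_neg (by omega), hb0 i (by omega)]; simp [ι_zero]) m hm
  simpa using this

lemma exists_top (G : DualBasis g n) {m : ℕ} {x : D} (h : x ∈ P m) (hx : x ≠ 0) :
    ∃ k a, a ≠ 0 ∧ x - ι a * S ^ k ∈ P k := by
  induction m with
  | zero => exact absurd (skewPoly_zero h) hx
  | succ m ih =>
    obtain ⟨a, ha⟩ := exists_top_coeff h
    by_cases h0 : a = 0
    · exact ih (by simpa [h0, ι_zero] using ha)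
    · exact ⟨m, a, h0, ha⟩

lemma mul_sub_mem_skewPoly {m k : ℕ} {a b : L} {x y : D} (hx : x - ι a * S ^ m ∈ P m)
    (hy : y - ι b * S ^ k ∈ P k) : x * y - ι (a * (g ^ m) b) * S ^ (m + k) ∈ P (m + k) := by
  have h := sz_mul_ι (A := RatFunc 𝔣) (t := ratX 𝔣) (g := g) (n := n) m b
  rw [sz_natCast, zpow_natCast] at h
  have h1 : x * y - ι (a * (g ^ m) b) * S ^ (m + k) =
      (x - ι a * S ^ m) * y + (ι a * S ^ m) * (y - ι b * S ^ k) := by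
    rw [ι_mul, pow_add, mul_assoc, ← mul_assoc (ι ((g ^ m) b)), ← h]; noncomm_ring
  have hy' : y ∈ P (k + 1) := by
    rw [← sub_add_cancel y (ι b * S ^ k)]
    exact add_mem (skewPoly_mono (Nat.le_succ k) hy) (ι_mul_S_pow_mem b (Nat.lt_succ_self k))
  rw [h1]
  refine add_mem (skewPoly_mul hx hy') ?_
  rcases k with _ | k
  · rw [skewPoly_zero hy, mul_zero]; exact zero_mem _
  · exact skewPoly_mono (by omega) (skewPoly_mul (ι_mul_S_pow_mem a (Nat.lt_succ_self m)) hy)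

lemma mul_ne_zero_of_skewPoly (G : DualBasis g n) {m k : ℕ} {x y : D} (hx : x ∈ P m) (hy : y ∈ P k)
    (hx0 : x ≠ 0) (hy0 : y ≠ 0) : x * y ≠ 0 := by
  obtain ⟨m, a, ha, hx⟩ := exists_top G hx hx0
  obtain ⟨k, b, hb, hy⟩ := exists_top G hy hy0
  intro h
  have h1 := mul_sub_mem_skewPoly hx hy
  rw [h, zero_sub, neg_mem_iff] at h1
  have h2 := top_coeff_eq_zero G h1
  rw [mul_eq_zero, EmbeddingLike.map_eq_zero_iff] at h2
  exact h2.elim ha hb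

lemma inc_algebraMap_tmul_mem (p : Polynomial 𝔣) (a : L) (r : ℕ) :
    ∃ m, (S ^ r * inc (algebraMap _ (RatFunc 𝔣) p ⊗ₜ a) : D) ∈ P m := by
  refine ⟨n * (p.natDegree + 1) + r, ?_⟩
  have h2 := sz_mul_ι (A := RatFunc 𝔣) (t := ratX 𝔣) (g := g) (n := n) r a
  rw [sz_natCast, zpow_natCast] at h2
  have h1 : (S ^ r * inc (algebraMap _ (RatFunc 𝔣) p ⊗ₜ a) : D) =
      ∑ q ∈ Finset.range (p.natDegree + 1), ι (algebraMap 𝔣 L (p.coeff q) * (g ^ r) a) * S ^ (n * q + r) := by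
    conv_lhs => rw [p.as_sum_range_C_mul_X_pow]
    rw [map_sum, TensorProduct.sum_tmul, map_sum, Finset.mul_sum]
    refine Finset.sum_congr rfl fun q _ => ?_
    rw [inc_tmul, ← mul_assoc, ← Algebra.commutes, mul_assoc, h2, pow_add, pow_mul,
      S_pow, Units.val_mk0, ι_mul, map_mul, map_pow, RatFunc.algebraMap_X, map_mul, ι_algebraMap]
    have h3 : algebraMap (Polynomial 𝔣) (RatFunc 𝔣) (Polynomial.C (p.coeff q)) =
      algebraMap 𝔣 (RatFunc 𝔣) (p.coeff q) := rfl
    rw [h3, mul_assoc, mul_assoc, ← map_pow]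
    congr 1
    rw [← mul_assoc, ← mul_assoc, Algebra.commutes]
  rw [h1]
  refine sum_mem fun q hq => ι_mul_S_pow_mem _ ?_
  have := Finset.mem_range.1 hq
  have : n * q < n * (p.natDegree + 1) := Nat.mul_lt_mul_of_pos_left this (NeZero.pos n)
  omega

lemma exists_skewPoly_of_repr (G : DualBasis g n) {x : D}
    (h : ∀ p, (basis G (RatFunc 𝔣) (ratX 𝔣)).repr x p ∈ (algebraMap (Polynomial 𝔣) (RatFunc 𝔣)).range) :
    ∃ m, x ∈ P m := by
  rw [← (basis G (RatFunc 𝔣) (ratX 𝔣)).sum_repr x]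
  choose q hq using h
  simp only [basis_apply]
  choose m hm using fun p : (Σ _ : Fin n, Fin n) =>
    inc_algebraMap_tmul_mem (g := g) (n := n) (q p) (G.b p.2) (p.1 : ℕ)
  refine ⟨∑ p, m p, sum_mem fun p _ => ?_⟩
  have h1 := skewPoly_mono (Finset.single_le_sum (f := m) (fun _ _ => Nat.zero_le _) (Finset.mem_univ p)) (hm p)
  convert h1 using 1
  rw [inc_tmul, hq, ← Algebra.smul_def, mul_smul_comm]

lemma exists_smul_mem_skewPoly (G : DualBasis g n) (x : D) :
    ∃ h : RatFunc 𝔣, h ≠ 0 ∧ ∃ m, h • x ∈ P m := by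
  classical
  obtain ⟨b, hb⟩ := IsLocalization.exist_integer_multiples_of_finset (nonZeroDivisors (Polynomial 𝔣))
    (Finset.univ.image ((basis G (RatFunc 𝔣) (ratX 𝔣)).repr x))
  refine ⟨algebraMap _ _ (b : Polynomial 𝔣), ?_, exists_skewPoly_of_repr G fun p => ?_⟩
  · rw [Ne, map_eq_zero_iff _ (IsFractionRing.injective _ _)]
    exact nonZeroDivisors.ne_zero b.2
  · obtain ⟨y, hy⟩ := hb _ (Finset.mem_image_of_mem _ (Finset.mem_univ p))
    refine ⟨y, ?_⟩
    rw [hy, map_smul, Finsupp.smul_apply, Algebra.smul_def, smul_eq_mul]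

/-- A product of twisted polynomials with leading coefficients `a` and `b` has leading coefficient
`a g ^ m (b) ≠ 0`, and a nonzero scalar brings every element into the ring of twisted polynomials.
-/
lemma isDomain_ratFunc (G : DualBasis g n) : IsDomain D := by
  have : Nontrivial D := by
    have := free_of_dual (A := RatFunc 𝔣) (t := ratX 𝔣) G
    have h := finrank_eq (A := RatFunc 𝔣) (t := ratX 𝔣) G
    exact Module.nontrivial_of_finrank_pos (R := RatFunc 𝔣) (by
      rw [h]; exact Nat.mul_pos (NeZero.pos n) (NeZero.pos n))
  have : NoZeroDivisors D := ⟨by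
    intro x y hxy
    by_contra! h
    obtain ⟨u, hu, m, hm⟩ := exists_smul_mem_skewPoly G x
    obtain ⟨v, hv, k, hk⟩ := exists_smul_mem_skewPoly G y
    refine mul_ne_zero_of_skewPoly G hm hk ?_ ?_ ?_
    · exact fun h' => h.1 (by simpa [hu] using congrArg (u⁻¹ • ·) h')
    · exact fun h' => h.2 (by simpa [hv] using congrArg (v⁻¹ • ·) h')
    · rw [smul_mul_smul_comm, hxy, smul_zero]⟩
  exact NoZeroDivisors.to_isDomain _

/-- The elements `∑ a_i s ^ i`, `i ∈ ℤ`. -/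
def IsLaurent (r : Cyc (RatFunc 𝔣) g n (ratX 𝔣)) : Prop := ∃ k m, r * S ^ k ∈ skewPoly 𝔣 L g n m

lemma IsLaurent.add {r r' : D} (h : IsLaurent r) (h' : IsLaurent r') : IsLaurent (r + r') := by
  obtain ⟨k, m, h⟩ := h
  obtain ⟨k', m', h'⟩ := h'
  have hS : ∀ k : ℕ, (S ^ k : D) ∈ P (k + 1) := fun k => by
    simpa [ι_one] using ι_mul_S_pow_mem (g := g) (n := n) (1 : L) (Nat.lt_succ_self k)
  refine ⟨k + k', (m + k') + (m' + k), ?_⟩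
  rw [add_mul, pow_add, ← mul_assoc]
  refine add_mem (skewPoly_mono (by omega) (skewPoly_mul h (hS k'))) ?_
  rw [← pow_add, add_comm k, pow_add, ← mul_assoc]
  exact skewPoly_mono (by omega) (skewPoly_mul h' (hS k))

/-- Right ideals of the ring of the `∑ a_i s ^ i` are principal. -/
lemma exists_generator (G : DualBasis g n) (J : AddSubgroup D) (hι : ∀ x ∈ J, ∀ a : L, x * ι a ∈ J)
    (hS : ∀ x ∈ J, x * S ∈ J) {h : RatFunc 𝔣} (h0 : h ≠ 0)
    (hb : ∀ x ∈ J, ∃ k m, (h • x) * S ^ k ∈ P m) :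
    ∃ y ∈ J, ∀ x ∈ J, ∃ r, IsLaurent r ∧ x = y * r := by
  classical
  by_cases hJ : ∀ x ∈ J, x = 0
  · exact ⟨0, zero_mem _, fun x hx => ⟨0, ⟨0, 0, by simp⟩, by simp [hJ x hx]⟩⟩
  have hdom := isDomain_ratFunc G
  have hSu : IsUnit (S : D) := ⟨Su, rfl⟩
  have hSp : ∀ (k : ℕ), ∀ x ∈ J, x * S ^ k ∈ J := by
    intro k
    induction k with
    | zero => simp
    | succ k ih => exact fun x hx => by rw [pow_succ, ← mul_assoc]; exact hS _ (ih x hx)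
  have hsm : ∀ x : D, h • x = 0 → x = 0 := fun x hx => by simpa [h0] using congrArg (h⁻¹ • ·) hx
  push Not at hJ
  -- The degree of `h • y` serves as Euclidean size; elements whose multiple is only a Laurent
  -- polynomial are first multiplied by a power of `s`, under which `J` is stable.
  have hex : ∃ m, ∃ y ∈ J, y ≠ 0 ∧ h • y ∈ P m := by
    obtain ⟨x, hx, hx0⟩ := hJ
    obtain ⟨k, m, hm⟩ := hb x hx
    refine ⟨m, x * S ^ k, hSp k x hx, mul_ne_zero hx0 (hSu.pow k).ne_zero, ?_⟩
    rwa [← smul_mul_assoc]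
  obtain ⟨y, hyJ, hy0, hy⟩ := Nat.find_spec hex
  have hmin := fun m => Nat.find_min hex (m := m)
  set M := Nat.find hex
  obtain ⟨m, hm⟩ : ∃ m, M = m + 1 := by
    refine Nat.exists_eq_succ_of_ne_zero fun h' => hy0 (hsm _ (skewPoly_zero (by rwa [h'] at hy)))
  rw [hm] at hy hmin
  obtain ⟨a, ha⟩ := exists_top_coeff hy
  have ha0 : a ≠ 0 := by
    rintro rfl
    exact hmin m (Nat.lt_succ_self m) ⟨y, hyJ, hy0, by simpa [ι_zero] using ha⟩
  have key : ∀ k, ∀ x ∈ J, h • x ∈ P k → ∃ r, IsLaurent r ∧ x = y * r := by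
    intro k
    induction k with
    | zero => exact fun x _ hx => ⟨0, ⟨0, 0, by simp⟩, by rw [hsm x (skewPoly_zero hx), mul_zero]⟩
    | succ k ih =>
      intro x hxJ hx
      by_cases hkm : k < m
      · have : x = 0 := by
          by_contra hx0
          exact hmin (k + 1) (by omega) ⟨x, hxJ, hx0, hx⟩
        exact ⟨0, ⟨0, 0, by simp⟩, by rw [this, mul_zero]⟩
      obtain ⟨b, hb'⟩ := exists_top_coeff hx
      -- Chosen so that `y e s ^ (k - m)` has the same leading coefficient as `x` after scaling by
      -- `h`.
      set e : L := (g ^ m)⁻¹ (a⁻¹ * b)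
      have hge : (g ^ m) e = a⁻¹ * b := by
        rw [← AlgEquiv.mul_apply, mul_inv_cancel, AlgEquiv.one_apply]
      have h1 := mul_sub_mem_skewPoly ha (y := ι e * S ^ (k - m)) (b := e) (k := k - m) (by simp)
      rw [hge, mul_inv_cancel_left₀ ha0, Nat.add_sub_cancel' (not_lt.1 hkm)] at h1
      have h2 := sub_mem hb' h1
      rw [sub_sub_sub_cancel_right, smul_mul_assoc, ← smul_sub] at h2
      obtain ⟨r, hr, hxr⟩ := ih _ (sub_mem hxJ (by rw [← mul_assoc]; exact hSp _ _ (hι y hyJ e))) h2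
      refine ⟨r + ι e * S ^ (k - m), hr.add ⟨0, k - m + 1, ?_⟩, ?_⟩
      · simpa using ι_mul_S_pow_mem e (Nat.lt_succ_self _)
      · rw [mul_add, ← hxr, sub_add_cancel]
  refine ⟨y, hyJ, fun x hx => ?_⟩
  obtain ⟨k, m', hkm⟩ := hb x hx
  obtain ⟨r, ⟨k', m'', hr⟩, hxr⟩ := key m' _ (hSp k x hx) (by rwa [← smul_mul_assoc])
  refine ⟨r * sz (-k), ⟨k + k', m'', ?_⟩, ?_⟩
  · rwa [pow_add, ← mul_assoc, mul_assoc r, ← sz_natCast k, sz_neg_mul, mul_one]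
  · rw [← mul_assoc, ← hxr, ← sz_natCast, mul_assoc, sz_mul_neg, mul_one]

end Cyc
end Domain

/-! ### A cyclic algebra that is not a division algebra makes `t⁻¹` a norm. -/

section Norm

variable {𝔣 L : Type*} [Field 𝔣] [Field L] [Algebra 𝔣 L] {g : L ≃ₐ[𝔣] L} {n : ℕ} [NeZero n]

lemma Nat.exists_mul_eq_mul_add_one {n d : ℕ} (hn : n.Prime) (h0 : 0 < d) (hd : d < n) :
    ∃ x y, d * x = n * y + 1 := by
  have hc : Nat.Coprime d n := (Nat.coprime_of_lt_prime h0.ne' hd hn).symm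
  obtain ⟨x, hx⟩ := Nat.exists_mul_mod_eq_one_of_coprime hc hn.one_lt
  exact ⟨x, d * x / n, by rw [← hx.2, Nat.div_add_mod]⟩

namespace DualBasis

section Field
variable {K : Type*} [Field K] [Algebra 𝔣 K]

/-- Such a `z` divides all its conjugates, hence every trace of a multiple of `z`. Those traces are
scalars of a field: one nonzero trace makes `z` a unit, and if all vanish then `z = 0`. -/
lemma isUnit_of_dvd_sg (G : DualBasis g n) {z : K ⊗[𝔣] L} (hz : z ≠ 0) (h : z ∣ sg K g z) : IsUnit z := by
  have h1 : ∀ k, z ∣ sg K (g ^ k) z := by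
    intro k
    induction k with
    | zero => simp
    | succ k ih =>
      rw [pow_succ', map_mul, AlgEquiv.mul_apply]
      exact h.trans (map_dvd (sg K g) ih)
  have h2 : ∀ y, z ∣ tr g n (y * z) := fun y =>
    Finset.dvd_sum fun k _ => by rw [map_mul]; exact (h1 k).mul_left _
  by_contra hu
  apply hz
  rw [← G.sum_tr_mul z]
  refine Finset.sum_eq_zero fun j _ => ?_
  obtain ⟨a, ha⟩ := G.exists_tr_eq ((1 ⊗ₜ G.b j) * z)
  by_cases ha0 : a = 0
  · rw [ha, ha0, map_zero, zero_mul]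
  · exact absurd (isUnit_of_dvd_unit (ha ▸ h2 _) ((isUnit_iff_ne_zero.2 ha0).map _)) hu

/-- A maximal ideal `m` cannot be stable under `g`, since a stable one would contain nonzero traces,
which are units. As `n` is prime its `n` translates are distinct, so the Chinese remainder theorem
gives `u` congruent to `t⁻¹` at one of them and to `1` at the others. The norm of `u` is a scalar
congruent to `t⁻¹` modulo `m`, hence equal to it. -/
lemma exists_nm_mul_of_not_isField (G : DualBasis g n) (hn : n.Prime) (hK : ¬ IsField (K ⊗[𝔣] L)) (t : Kˣ) :
    ∃ u : K ⊗[𝔣] L, nm g n u * algebraMap K _ (t : K) = 1 := by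
  have : Nontrivial (K ⊗[𝔣] L) := (G.algebraMap_injective (A := K)).nontrivial
  obtain ⟨m, hm⟩ := Ideal.exists_maximal (K ⊗[𝔣] L)
  have hmb : m ≠ ⊥ := Ring.ne_bot_of_isMaximal_of_not_isField hm hK
  have hmK : ∀ a : K, algebraMap K (K ⊗[𝔣] L) a ∈ m → a = 0 := fun a ha => by
    by_contra h0
    exact hm.ne_top (Ideal.eq_top_of_isUnit_mem _ ha ((isUnit_iff_ne_zero.2 h0).map _))
  have hg : ¬ ∀ z, z ∈ m ↔ sg K g z ∈ m := by
    intro h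
    have h1 : ∀ k, ∀ z ∈ m, sg K (g ^ k) z ∈ m := by
      intro k
      induction k with
      | zero => simp
      | succ k ih =>
        intro z hz
        rw [pow_succ, map_mul, AlgEquiv.mul_apply]
        exact ih _ ((h z).1 hz)
    obtain ⟨x, hx, hx0⟩ := Submodule.exists_mem_ne_zero_of_ne_bot hmb
    apply hx0
    rw [← G.sum_tr_mul x]
    refine Finset.sum_eq_zero fun j _ => ?_
    have h2 : tr g n ((1 ⊗ₜ G.b j) * x) ∈ m := sum_mem fun k _ => h1 k _ (m.mul_mem_left _ hx)
    obtain ⟨a, ha⟩ := G.exists_tr_eq ((1 ⊗ₜ G.b j) * x)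
    rw [ha] at h2 ⊢
    rw [hmK a h2, map_zero, zero_mul]
  set I : ℕ → Ideal (K ⊗[𝔣] L) := fun i => m.comap (sg K (g ^ i)) with hI
  have hImax : ∀ i, (I i).IsMaximal := fun i => Ideal.comap_isMaximal_of_equiv (sg K (g ^ i))
  have hIne : ∀ i j, i < j → j < n → I i ≠ I j := by
    intro i j hij hj h
    have h1 : ∀ z, z ∈ m ↔ sg K (g ^ (j - i)) z ∈ m := by
      intro z
      have := Ideal.ext_iff.1 h (sg K (g ^ i)⁻¹ z)
      simp only [hI, Ideal.mem_comap, ← AlgEquiv.mul_apply, ← map_mul] at this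
      rwa [mul_inv_cancel, map_one, AlgEquiv.one_apply, ← pow_sub _ hij.le] at this
    have h2 : ∀ k z, z ∈ m ↔ sg K (g ^ ((j - i) * k)) z ∈ m := by
      intro k
      induction k with
      | zero => simp
      | succ k ih =>
        intro z
        rw [mul_add, mul_one, pow_add, map_mul, AlgEquiv.mul_apply, ← ih, ← h1]
    obtain ⟨x, y, hxy⟩ := Nat.exists_mul_eq_mul_add_one hn (d := j - i) (by omega) (by omega)
    apply hg
    intro z
    rw [h2 x z, hxy, pow_succ, pow_mul, G.pow_eq_one, one_pow, one_mul]
  have hIco : Pairwise (Function.onFun IsCoprime fun i : Fin n => I i) := by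
    intro i j hij
    rw [Function.onFun, Ideal.isCoprime_iff_sup_eq]
    refine Ideal.IsMaximal.coprime_of_ne (hImax i) (hImax j) ?_
    rcases lt_or_gt_of_ne hij with h | h
    · exact hIne i j h j.2
    · exact (hIne j i h i.2).symm
  obtain ⟨u, hu'⟩ := Ideal.exists_forall_sub_mem_ideal hIco
    (fun i => if (i : ℕ) = 0 then algebraMap K _ ((t⁻¹ : Kˣ) : K) else 1)
  have hu : ∀ i ∈ Finset.range n, u - (if i = 0 then algebraMap K _ ((t⁻¹ : Kˣ) : K) else 1) ∈ I i :=
    fun i hi => hu' ⟨i, Finset.mem_range.1 hi⟩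
  refine ⟨u, ?_⟩
  obtain ⟨a, ha⟩ := G.exists_nm_eq u
  have h1 : Ideal.Quotient.mk m (nm g n u) = Ideal.Quotient.mk m (algebraMap K _ ((t⁻¹ : Kˣ) : K)) := by
    rw [nm, map_prod, Finset.prod_eq_single_of_mem 0 (Finset.mem_range.2 (NeZero.pos n))]
    · have := hu 0 (Finset.mem_range.2 (NeZero.pos n))
      simp only [if_true, hI, Ideal.mem_comap, map_sub, AlgEquiv.commutes] at this
      exact Ideal.Quotient.eq.2 this
    · intro i hi hi0
      have := hu i hi
      simp only [if_neg hi0, hI, Ideal.mem_comap, map_sub, map_one] at this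
      rw [← map_one (Ideal.Quotient.mk m)]
      exact Ideal.Quotient.eq.2 this
  rw [ha, Ideal.Quotient.eq, ← map_sub] at h1
  rw [ha, sub_eq_zero.1 (hmK _ h1), ← map_mul, Units.inv_mul, map_one]

end Field

end DualBasis

/-- If `B` is the matrix of the semilinear `T`, the iterates of `T` have the matrices `B σ(B) σ²(B)
⋯`. Taking determinants of the `n`-th iterate, which is the scalar `t`, gives `δ = det B`. -/
lemma exists_prod_eq_pow_finrank {E : Type*} [CommRing E] (hE : IsField E) (σ : E ≃+* E)
    {W : Type*} [AddCommGroup W] [Module E W] [Module.Finite E W] (T : W → W)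
    (hadd : ∀ x y, T (x + y) = T x + T y) (hsmul : ∀ (z : E) x, T (z • x) = σ z • T x) {n : ℕ} {t : E}
    (hT : ∀ x, T^[n] x = t • x) :
    ∃ δ : E, ∏ k ∈ Finset.range n, (σ ^ k) δ = t ^ Module.finrank E W := by
  letI := hE.toField
  let e := Module.finBasis E W
  let B : Matrix (Fin (Module.finrank E W)) (Fin (Module.finrank E W)) E :=
    Matrix.of fun i j => e.repr (T (e j)) i
  have hB : ∀ j, T (e j) = ∑ i, B i j • e i := fun j => (e.sum_repr _).symm
  have hsum : ∀ (z : Fin (Module.finrank E W) → E), T (∑ i, z i • e i) = ∑ i, σ (z i) • T (e i) := by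
    intro z
    let T' : W →+ W := AddMonoidHom.mk' T hadd
    change T' _ = _
    rw [map_sum]
    exact Finset.sum_congr rfl fun i _ => hsmul _ _
  have key : ∀ k, ∃ M : Matrix (Fin (Module.finrank E W)) (Fin (Module.finrank E W)) E,
      (∀ j, T^[k] (e j) = ∑ i, M i j • e i) ∧ M.det = ∏ k ∈ Finset.range k, (σ ^ k) B.det := by
    intro k
    induction k with
    | zero => exact ⟨1, fun j => by simp [Matrix.one_apply], by simp⟩
    | succ k ih =>
      obtain ⟨M, hM, hdet⟩ := ih
      refine ⟨B * M.map σ, fun j => ?_, ?_⟩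
      · rw [Function.iterate_succ_apply', hM, hsum]
        simp only [hB, Finset.smul_sum, Matrix.mul_apply, Finset.sum_smul, Matrix.map_apply]
        rw [Finset.sum_comm]
        refine Finset.sum_congr rfl fun i _ => Finset.sum_congr rfl fun l _ => ?_
        rw [← mul_smul, mul_comm]
      · have h1 : (M.map σ).det = σ M.det := (RingHom.map_det σ.toRingHom M).symm
        rw [Matrix.det_mul, h1, hdet, Finset.prod_range_succ', map_prod, mul_comm]
        simp [pow_succ', RingAut.mul_apply]
  obtain ⟨M, hM, hdet⟩ := key n
  refine ⟨B.det, ?_⟩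
  rw [← hdet]
  have : M = t • (1 : Matrix _ _ E) := by
    ext i j
    have h1 := hM j
    rw [hT] at h1
    have h2 := congrArg (fun w => e.repr w i) h1
    simpa [Finsupp.single_apply, Matrix.one_apply, eq_comm] using h2.symm
  rw [this, Matrix.det_smul]
  simp

namespace Cyc

variable {K : Type*} [Field K] [Algebra 𝔣 K] {t : Kˣ}

/-- The right annihilator of `r` is a `K ⊗ L`-space of dimension `d` with `0 < d < n`. Right
multiplication by `s⁻¹` acts on it semilinearly with `n`-th power `t⁻¹`, so `t ^ (-d)` is a norm. So
is `t ^ n`, and `d` is prime to `n`. -/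
lemma exists_nm_mul_of_zero_divisor (G : DualBasis g n) (hn : n.Prime) (hE : IsField (K ⊗[𝔣] L))
    {r x : Cyc K g n t} (hr : r ≠ 0) (hx : x ≠ 0) (hrx : r * x = 0) :
    ∃ u : K ⊗[𝔣] L, DualBasis.nm g n u * algebraMap K _ (t : K) = 1 := by
  have hg := G.pow_eq_one
  letI := hE.toField
  let W : Submodule (K ⊗[𝔣] L) (Fin n → K ⊗[𝔣] L) := LinearMap.ker (lmat hg r).mulVecLin
  have hW : ∀ d, coordEquiv hg d ∈ W ↔ r * d = 0 := fun d => by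
    rw [LinearMap.mem_ker, Matrix.mulVecLin_apply, lmat_mulVec, LinearEquiv.map_eq_zero_iff]
  let e := coordEquiv (A := K) (t := t) hg
  have hW' : ∀ w : W, r * (e.symm w) = 0 := fun w => by
    rw [← hW, LinearEquiv.apply_symm_apply]; exact w.2
  let T : W → W := fun w => ⟨e (e.symm w * sz (-1)), by
    rw [hW, ← mul_assoc, hW', zero_mul]⟩
  have hd0 : 0 < Module.finrank (K ⊗[𝔣] L) W := by
    rw [Module.finrank_pos_iff]
    refine ⟨⟨⟨e x, (hW x).2 hrx⟩, 0, fun h => hx ?_⟩⟩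
    exact e.map_eq_zero_iff.1 (congrArg Subtype.val h)
  have hdn : Module.finrank (K ⊗[𝔣] L) W < n := by
    have h := Submodule.finrank_lt (s := W) (by
      intro h
      have h1 := (hW 1).1 (h ▸ Submodule.mem_top)
      exact hr (by simpa using h1))
    simpa using h
  obtain ⟨δ, hδ⟩ := exists_prod_eq_pow_finrank (n := n) (t := algebraMap K _ ((t⁻¹ : Kˣ) : K)) hE
    (sg K g).toRingEquiv T (by
      intro x y
      apply Subtype.ext
      simp [T, add_mul]) (by
      intro z w
      apply Subtype.ext
      obtain ⟨d, hd⟩ := e.surjective w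
      have h1 : e.symm (z • (w : Fin n → K ⊗[𝔣] L)) = d * inc z := by
        rw [LinearEquiv.symm_apply_eq, ← hd, coordEquiv_mul_inc]
        ext i; exact mul_comm _ _
      have h2 := sz_mul_inc (g := g) (n := n) (t := t) (-1) (sg K g z)
      rw [← AlgEquiv.mul_apply, ← map_mul, zpow_neg_one, inv_mul_cancel, map_one, AlgEquiv.one_apply] at h2
      change e (e.symm (z • (w : Fin n → K ⊗[𝔣] L)) * sz (-1)) = sg K g z • e (e.symm w * sz (-1))
      rw [h1, ← hd, LinearEquiv.symm_apply_apply, mul_assoc, ← h2, ← mul_assoc, coordEquiv_mul_inc]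
      ext i; exact mul_comm _ _) (by
      have h1 : ∀ k w, ((T^[k] w : W) : Fin n → K ⊗[𝔣] L) = e (e.symm w * sz (-k)) := by
        intro k
        induction k with
        | zero => simp
        | succ k ih =>
          intro w
          rw [Function.iterate_succ_apply']
          change e (e.symm (T^[k] w : W) * sz (-1)) = _
          rw [ih, LinearEquiv.symm_apply_apply, mul_assoc, ← sz_add]
          congr 3; push_cast; ring
      intro w
      apply Subtype.ext
      have h2 : (sz (-n) : Cyc K g n t) = algebraMap K _ ((t⁻¹ : Kˣ) : K) := by
        have h3 := sz_neg_mul (A := K) (g := g) (n := n) (t := t) n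
        rw [sz_natCast, S_pow] at h3
        have h4 := congrArg (fun y => y * algebraMap K (Cyc K g n t) ((t⁻¹ : Kˣ) : K)) h3
        simpa [mul_assoc, ← map_mul] using h4
      rw [h1, h2, ← Algebra.commutes, ← Algebra.smul_def, map_smul, LinearEquiv.apply_symm_apply]
      ext i; simp [Algebra.smul_def])
  have hδ' : DualBasis.nm g n δ = algebraMap K _ (((t⁻¹ : Kˣ) : K) ^ Module.finrank (K ⊗[𝔣] L) W) := by
    rw [map_pow, ← hδ, DualBasis.nm]
    refine Finset.prod_congr rfl fun k hk => ?_
    clear hk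
    induction k with
    | zero => simp
    | succ k ih => rw [pow_succ', pow_succ', map_mul, AlgEquiv.mul_apply, ih]; rfl
  obtain ⟨a, b, hab⟩ := Nat.exists_mul_eq_mul_add_one hn hd0 hdn
  -- Here `d a = n b + 1`, so the norm is `t ^ (-d a) t ^ (n b) = t⁻¹`.
  refine ⟨δ ^ a * algebraMap K _ ((t : K) ^ b), ?_⟩
  have h1 : ∀ k, DualBasis.nm g n (δ ^ k) = DualBasis.nm g n δ ^ k := fun k => by
    simp [DualBasis.nm, Finset.prod_pow]
  have h2 : ∀ s : K, DualBasis.nm g n (algebraMap K (K ⊗[𝔣] L) s) = algebraMap K _ (s ^ n) := fun s => by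
    simp only [DualBasis.nm, AlgEquiv.commutes, Finset.prod_const, Finset.card_range, map_pow]
  rw [DualBasis.nm_mul, h1, hδ', h2, ← map_pow, ← map_mul, ← map_mul, ← map_one (algebraMap K (K ⊗[𝔣] L))]
  congr 1
  rw [← pow_mul, hab, ← pow_mul, mul_comm b n, pow_succ, mul_right_comm _ _ ((t : K) ^ _), ← mul_pow,
    Units.inv_mul, one_pow, one_mul, Units.inv_mul]

/-- If a cyclic algebra over a field is not a domain, `t⁻¹` is a norm. -/
lemma exists_nm_mul_eq_one (G : DualBasis g n) (hn : n.Prime) (h : ¬ IsDomain (Cyc K g n t)) :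
    ∃ u : K ⊗[𝔣] L, DualBasis.nm g n u * algebraMap K _ (t : K) = 1 := by
  by_cases hE : IsField (K ⊗[𝔣] L)
  · have : Nontrivial (Cyc K g n t) := by
      have := free_of_dual (A := K) (t := t) G
      have h := finrank_eq (A := K) (t := t) G
      exact Module.nontrivial_of_finrank_pos (R := K) (by
        rw [h]; exact Nat.mul_pos (NeZero.pos n) (NeZero.pos n))
    by_contra hu
    apply h
    have : NoZeroDivisors (Cyc K g n t) := ⟨by
      intro r x hrx
      by_contra! h0
      exact hu (exists_nm_mul_of_zero_divisor G hn hE h0.1 h0.2 hrx)⟩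
    exact NoZeroDivisors.to_isDomain _
  · exact G.exists_nm_mul_of_not_isField hn hE t

end Cyc

end Norm

/-! ### Specializing coefficients in a determinant with controlled loss of divisibility. -/

section Approximation

/-- If a polynomial of degree at most `n` takes values divisible by `p ^ (b + q)` at points with
Vandermonde determinant `ε p ^ q`, all its values are divisible by `p ^ b`. -/
lemma Polynomial.pow_dvd_eval_of_vandermonde {R : Type*} [CommRing R] {n : ℕ} (P : Polynomial R)
    (hP : P.natDegree ≤ n) (y : Fin (n + 1) → R) {p ε : R} (hε : IsUnit ε) {q b : ℕ}
    (hp : ∀ x, p ^ q * x = 0 → x = 0)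
    (hdet : (Matrix.vandermonde y).det = ε * p ^ q) (h : ∀ i, p ^ (b + q) ∣ P.eval (y i)) (μ : R) :
    p ^ b ∣ P.eval μ := by
  have h1 : (Matrix.vandermonde y).mulVec (fun j => P.coeff j) = fun i => P.eval (y i) := by
    ext i
    rw [Polynomial.eval_eq_sum_range' (Nat.lt_succ_of_le hP), Finset.sum_range]
    simp [Matrix.mulVec, dotProduct, Matrix.vandermonde_apply, mul_comm]
  have h2 : ∀ j : Fin (n + 1), p ^ (b + q) ∣ (Matrix.vandermonde y).det * P.coeff j := by
    intro j
    have h3 := congrArg (fun v => (Matrix.vandermonde y).adjugate.mulVec v j) h1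
    simp only [Matrix.mulVec_mulVec, Matrix.adjugate_mul, Matrix.smul_mulVec, Matrix.one_mulVec,
      Pi.smul_apply, smul_eq_mul] at h3
    rw [h3]
    rw [Matrix.mulVec, dotProduct]
    exact Finset.dvd_sum fun i _ => (h i).mul_left _
  have h4 : p ^ (b + q) ∣ (Matrix.vandermonde y).det * P.eval μ := by
    rw [Polynomial.eval_eq_sum_range' (Nat.lt_succ_of_le hP), Finset.sum_range, Finset.mul_sum]
    refine Finset.dvd_sum fun i _ => ?_
    rw [← mul_assoc]
    exact (h2 i).mul_right _
  rw [hdet, mul_assoc, hε.dvd_mul_left] at h4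
  obtain ⟨z, hz⟩ := h4
  refine ⟨z, sub_eq_zero.1 (hp _ ?_)⟩
  rw [mul_sub, hz]; ring

/-- The determinant of `x A + B` is a polynomial of degree at most `n` in `x`, so it is controlled
by its values at `n + 1` points. -/
lemma Matrix.exists_not_dvd_det {R : Type*} [CommRing R] {n : ℕ} (A B : Matrix (Fin n) (Fin n) R)
    (y : Fin (n + 1) → R) {p ε : R} (hε : IsUnit ε) {q b : ℕ} (hp : ∀ x, p ^ q * x = 0 → x = 0)
    (hdet : (Matrix.vandermonde y).det = ε * p ^ q) {μ : R} (h : ¬ p ^ b ∣ (μ • A + B).det) :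
    ∃ i, ¬ p ^ (b + q) ∣ (y i • A + B).det := by
  by_contra! h1
  apply h
  have h2 : ∀ x : R, ((Polynomial.X : Polynomial R) • A.map Polynomial.C + B.map Polynomial.C).det.eval x = (x • A + B).det := by
    intro x
    rw [← Polynomial.coe_evalRingHom, RingHom.map_det]
    congr 1
    ext i j
    simp
    ring
  rw [← h2]
  refine Polynomial.pow_dvd_eval_of_vandermonde _ ?_ y hε hp hdet (fun i => by rw [h2]; exact h1 i) μ
  simpa using Polynomial.natDegree_det_X_add_C_le A B

/-- The coefficients `μ j` are replaced by the prescribed points one at a time, each replacement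
costing a factor `p ^ q`. -/
lemma Matrix.exists_not_dvd_det_sum {R : Type*} [CommRing R] {n m : ℕ} (A : Fin m → Matrix (Fin n) (Fin n) R)
    (y : Fin (n + 1) → R) {p ε : R} (hε : IsUnit ε) {q b : ℕ} (hp : ∀ x, p ^ q * x = 0 → x = 0)
    (hdet : (Matrix.vandermonde y).det = ε * p ^ q) (μ : Fin m → R)
    (h : ¬ p ^ b ∣ (∑ j, μ j • A j).det) :
    ∃ x : Fin m → Fin (n + 1), ¬ p ^ (b + m * q) ∣ (∑ j, y (x j) • A j).det := by
  classical
  have key : ∀ s : Finset (Fin m), ∃ x : Fin m → Fin (n + 1),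
      ¬ p ^ (b + s.card * q) ∣ (∑ j, (if j ∈ s then y (x j) else μ j) • A j).det := by
    intro s
    induction s using Finset.induction_on with
    | empty => exact ⟨0, by simpa using h⟩
    | insert j s hj ih =>
      obtain ⟨x, hx⟩ := ih
      have hsplit : ∀ z : Fin m → R, ∑ i, z i • A i = z j • A j + ∑ i ∈ Finset.univ.erase j, z i • A i :=
        fun z => (Finset.add_sum_erase _ _ (Finset.mem_univ j)).symm
      rw [hsplit, if_neg hj] at hx
      obtain ⟨i, hi⟩ := Matrix.exists_not_dvd_det _ _ y hε hp hdet hx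
      refine ⟨Function.update x j i, ?_⟩
      rw [Finset.card_insert_of_notMem hj, add_mul, one_mul, ← add_assoc, hsplit]
      convert hi using 4
      · simp
      · refine Finset.sum_congr rfl fun l hl => ?_
        have hlj := Finset.ne_of_mem_erase hl
        rw [Function.update_of_ne hlj]
        simp [Finset.mem_insert, hlj]
  obtain ⟨x, hx⟩ := key Finset.univ
  exact ⟨x, by simpa using hx⟩

end Approximation

/-! ### Norms over a discrete valuation ring. -/

section Local

variable {𝔣 L : Type*} [Field 𝔣] [Field L] [Algebra 𝔣 L] {g : L ≃ₐ[𝔣] L} {n : ℕ} [NeZero n]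

section
variable {O : Type*} [CommRing O] [Algebra 𝔣 O]

/-- The derivative of the norm at `1` is the trace. -/
lemma exists_nm_one_sub (G : DualBasis g n) (p : O) (y : O ⊗[𝔣] L) :
    ∃ q, DualBasis.nm g n (1 - algebraMap O _ p * y) =
      1 - algebraMap O _ p * DualBasis.tr g n y + algebraMap O _ (p ^ 2) * q := by
  have key : ∀ m, ∃ q, ∏ k ∈ Finset.range m, sg O (g ^ k) (1 - algebraMap O _ p * y) =
      1 - algebraMap O _ p * ∑ k ∈ Finset.range m, sg O (g ^ k) y + algebraMap O _ (p ^ 2) * q := by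
    intro m
    induction m with
    | zero => exact ⟨0, by simp⟩
    | succ m ih =>
      obtain ⟨q, hq⟩ := ih
      refine ⟨q * (1 - algebraMap O _ p * sg O (g ^ m) y) + (∑ k ∈ Finset.range m, sg O (g ^ k) y) * sg O (g ^ m) y, ?_⟩
      rw [Finset.prod_range_succ, hq, Finset.sum_range_succ, map_sub, map_mul, map_one, AlgEquiv.commutes, map_pow]
      ring
  exact key n

lemma tr_algebraMap_mul (c : O) (w : O ⊗[𝔣] L) :
    DualBasis.tr g n (algebraMap O _ c * w) = algebraMap O _ c * DualBasis.tr g n w := by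
  simp only [DualBasis.tr, map_mul, AlgEquiv.commutes, Finset.mul_sum]

/-- Descent of divisibility: multiply the quotient by an element of trace one and take traces. -/
lemma dvd_of_algebraMap_dvd (G : DualBasis g n) {p b : O}
    (h : algebraMap O (O ⊗[𝔣] L) p ∣ algebraMap O _ b) : p ∣ b := by
  obtain ⟨z, hz⟩ := h
  obtain ⟨x, hx⟩ := G.exists_tr_one (A := O)
  obtain ⟨a, ha⟩ := G.exists_tr_eq (z * (1 ⊗ₜ x))
  refine ⟨a, G.algebraMap_injective ?_⟩
  have h1 := congrArg (fun w => DualBasis.tr g n (w * (1 ⊗ₜ x))) hz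
  simp only [tr_algebraMap_mul, hx, mul_one, mul_assoc, ha] at h1
  rw [map_mul]
  exact h1

lemma eq_zero_of_algebraMap_mul [IsDomain O] (G : DualBasis g n) {a : O} (ha : a ≠ 0) {z : O ⊗[𝔣] L}
    (h : algebraMap O _ a * z = 0) : z = 0 := by
  rw [← Algebra.smul_def] at h
  apply (G.bA O).repr.map_eq_zero_iff.1
  ext j
  have := congrArg (fun w => (G.bA O).repr w j) h
  simpa [ha] using this

end

variable {O : Type*} [CommRing O] [IsDomain O] [IsDiscreteValuationRing O] [Algebra 𝔣 O]

/-- The reduction map. -/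
noncomputable def redHom (𝔣 O : Type*) [Field 𝔣] [CommRing O] [IsLocalRing O] [Algebra 𝔣 O] :
    O →ₐ[𝔣] IsLocalRing.ResidueField O := IsScalarTower.toAlgHom 𝔣 O _

lemma redHom_surjective : Function.Surjective (redHom 𝔣 O) := IsLocalRing.residue_surjective

lemma redHom_eq_zero {π : O} (hπ : Irreducible π) {a : O} (h : redHom 𝔣 O a = 0) : π ∣ a := by
  have : a ∈ IsLocalRing.maximalIdeal O := (IsLocalRing.residue_eq_zero_iff a).1 h
  rwa [hπ.maximalIdeal_eq, Ideal.mem_span_singleton] at this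

lemma redHom_irreducible {π : O} (hπ : Irreducible π) : redHom 𝔣 O π = 0 :=
  (IsLocalRing.residue_eq_zero_iff π).2 (by rw [hπ.maximalIdeal_eq]; exact Ideal.mem_span_singleton_self _)

/-- The ring `O ⊗ L` need not be local, but its elements divide their norms, which lie in the local
ring `O`, where units are detected on the residue field. -/
lemma isUnit_of_mapL (G : DualBasis g n) {z : O ⊗[𝔣] L} (h : IsUnit (mapL L (redHom 𝔣 O) z)) : IsUnit z := by
  have h1 : ∃ a, DualBasis.nm g n z = algebraMap O _ a := G.exists_nm_eq z
  obtain ⟨a, ha⟩ := h1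
  have h2 : IsUnit (redHom 𝔣 O a) := by
    have h3 := congrArg (mapL L (redHom 𝔣 O)) ha
    rw [mapL_nm, mapL_algebraMap] at h3
    have h4 : IsUnit (DualBasis.nm g n (mapL L (redHom 𝔣 O) z)) :=
      Finset.prod_induction _ IsUnit (fun _ _ => IsUnit.mul) isUnit_one fun k _ => h.map _
    rw [isUnit_iff_ne_zero]
    intro h0
    rw [h3, h0, map_zero] at h4
    have : Nontrivial (IsLocalRing.ResidueField O ⊗[𝔣] L) :=
      (G.algebraMap_injective (A := IsLocalRing.ResidueField O)).nontrivial
    exact not_isUnit_zero h4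
  have h3 : IsUnit a := (isUnit_map_iff (IsLocalRing.residue O) a).1 h2
  exact isUnit_of_dvd_unit (DualBasis.dvd_nm z) (ha ▸ h3.map _)

/-- Newton approximation for the norm. -/
lemma exists_nm_approx (G : DualBasis g n) {π : O} (hπ : Irreducible π) (t : Oˣ)
    (h : ∃ u : IsLocalRing.ResidueField O ⊗[𝔣] L, DualBasis.nm g n u * algebraMap _ _ (redHom 𝔣 O t) = 1) (N : ℕ) :
    ∃ (u : O ⊗[𝔣] L) (a : O), DualBasis.nm g n u = algebraMap O _ a ∧ π ^ (N + 1) ∣ a * t - 1 := by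
  induction N with
  | zero =>
    obtain ⟨u, hu⟩ := h
    obtain ⟨u, rfl⟩ := mapL_surjective (L := L) (redHom 𝔣 O) redHom_surjective u
    obtain ⟨a, ha⟩ := G.exists_nm_eq u
    refine ⟨u, a, ha, ?_⟩
    rw [← mapL_nm, ha, mapL_algebraMap, ← map_mul, ← map_mul, ← map_one (algebraMap (IsLocalRing.ResidueField O) _)] at hu
    have h1 := G.algebraMap_injective hu
    rw [zero_add, pow_one]
    exact redHom_eq_zero (𝔣 := 𝔣) hπ (by rw [map_sub, h1, map_one, sub_self])
  | succ N ih =>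
    obtain ⟨u, a, ha, x, hx⟩ := ih
    obtain ⟨l, hl⟩ := G.exists_tr_one (A := O)
    -- The correction factor `1 - π ^ (N + 1) y` must have trace term equal to the error `x`; an
    -- element of trace one provides this. The error becomes divisible by `π ^ (2 (N + 1))`.
    set y : O ⊗[𝔣] L := algebraMap O _ x * (1 ⊗ₜ l) with hy
    have hty : DualBasis.tr g n y = algebraMap O _ x := by
      rw [hy, tr_algebraMap_mul, hl, mul_one]
    obtain ⟨q, hq⟩ := exists_nm_one_sub G (π ^ (N + 1)) y
    obtain ⟨a', ha'⟩ := G.exists_nm_eq (u * (1 - algebraMap O _ (π ^ (N + 1)) * y))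
    refine ⟨_, a', ha', ?_⟩
    have h1 : algebraMap O (O ⊗[𝔣] L) (π ^ (2 * (N + 1))) ∣
        algebraMap O _ (a' - a * (1 - π ^ (N + 1) * x)) := by
      refine ⟨algebraMap O _ a * q, ?_⟩
      rw [map_sub, ← ha', DualBasis.nm_mul, hq, hty, ha]
      simp only [map_mul, map_sub, map_pow, map_one]
      ring
    obtain ⟨b, hb⟩ := dvd_of_algebraMap_dvd G h1
    have h2 : a' * t - 1 = π ^ (2 * (N + 1)) * (b * t - x ^ 2) := by
      have h3 : (a : O) * t = 1 + π ^ (N + 1) * x := by rw [← hx]; ring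
      have h4 : a' = a * (1 - π ^ (N + 1) * x) + π ^ (2 * (N + 1)) * b := by rw [← hb]; ring
      rw [h4]
      linear_combination (1 - π ^ (N + 1) * x) * h3
    rw [h2]
    exact (pow_dvd_pow π (by omega)).mul_right _

end Local

/-! ### Vectors `v` over a discrete valuation ring such that `v s` lies in the `O ⊗ L`-span of the
`c ^ j v`. -/

section LocalGenerator

variable {𝔣 L : Type*} [Field 𝔣] [Field L] [Algebra 𝔣 L] {g : L ≃ₐ[𝔣] L} {n : ℕ} [NeZero n]

lemma Matrix.dvd_det_add_smul_sub {R : Type*} [CommRing R] (A B : Matrix (Fin n) (Fin n) R) (p : R) :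
    p ∣ (A + p • B).det - A.det := by
  rw [← Ideal.mem_span_singleton, ← Ideal.Quotient.eq, RingHom.map_det, RingHom.map_det]
  congr 1
  ext i j
  have : Ideal.Quotient.mk (Ideal.span {p}) p = 0 :=
    Ideal.Quotient.eq_zero_iff_mem.2 (Ideal.mem_span_singleton_self p)
  simp [this]

namespace Cyc

section
variable {A : Type*} [CommRing A] [Algebra 𝔣 A] {t : Aˣ} (hg : g ^ n = 1)

/-- Membership in the span of the `c ^ i * v`, `i < n`, over `A ⊗ L`. -/
def InSpan (c v d : Cyc A g n t) : Prop :=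
  ∃ z : Fin n → A ⊗[𝔣] L, d = ∑ j : Fin n, c ^ (j : ℕ) * v * inc (z j)

lemma InSpan.add {c v d e : Cyc A g n t} (hd : InSpan c v d) (he : InSpan c v e) : InSpan c v (d + e) := by
  obtain ⟨z, rfl⟩ := hd
  obtain ⟨w, rfl⟩ := he
  exact ⟨z + w, by simp [mul_add, Finset.sum_add_distrib]⟩

lemma InSpan.mul_inc {c v d : Cyc A g n t} (hd : InSpan c v d) (x : A ⊗[𝔣] L) : InSpan c v (d * inc x) := by
  obtain ⟨z, rfl⟩ := hd
  exact ⟨fun j => z j * x, by simp [Finset.sum_mul, mul_assoc]⟩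

lemma InSpan.self (c v : Cyc A g n t) : InSpan c v v :=
  ⟨Pi.single 0 1, by
    rw [Finset.sum_eq_single_of_mem 0 (Finset.mem_univ _)]
    · simp
    · intro j _ hj; simp [Pi.single_eq_of_ne hj]⟩

lemma InSpan.mul_inc_iff {c v d : Cyc A g n t} {x : A ⊗[𝔣] L} (hx : IsUnit x) :
    InSpan c v (d * inc x) ↔ InSpan c v d := by
  refine ⟨fun h => ?_, fun h => h.mul_inc x⟩
  obtain ⟨y, hy⟩ := hx.exists_right_inv
  have := h.mul_inc y
  rwa [mul_assoc, ← map_mul, hy, map_one, mul_one] at this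

lemma cmat_add (c v w : Cyc A g n t) : cmat hg c (v + w) = cmat hg c v + cmat hg c w := by
  ext i j
  simp [cmat_apply, mul_add, coord_add]

lemma cmat_mul_inc (c v : Cyc A g n t) (x : A ⊗[𝔣] L) : cmat hg c (v * inc x) = x • cmat hg c v := by
  ext i j
  simp [cmat_apply, ← mul_assoc, coord_mul_inc, mul_comm]

lemma cmat_sum {α : Type*} (s : Finset α) (c : Cyc A g n t) (v : α → Cyc A g n t) :
    cmat hg c (∑ i ∈ s, v i) = ∑ i ∈ s, cmat hg c (v i) := by
  ext i j
  rw [cmat_apply, Finset.mul_sum, coord_sum, Finset.sum_apply, Matrix.sum_apply]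
  rfl

lemma cmat_bc {B : Type*} [CommRing B] [Algebra 𝔣 B] (f : A →ₐ[𝔣] B) (c v : Cyc A g n t) :
    cmat hg (bc f c) (bc f v) = (cmat hg c v).map (mapL L f) := by
  ext i j
  rw [cmat_apply, ← map_pow, ← map_mul, coord_bc f hg _ i.2]
  rfl

/-- Right multiplication by `s` shifts the coordinates cyclically, with a factor `t` in the
wrap-around, and twists them by `g⁻¹`; `ε` is the determinant of the shift matrix. -/
lemma exists_det_cmat_mul_S (c v : Cyc A g n t) :
    ∃ ε, (cmat hg c (v * S)).det = ε * sg A g⁻¹ (cmat hg c v).det := by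
  let l : Fin n := ⟨n - 1, Nat.sub_lt (NeZero.pos n) one_pos⟩
  let P : Matrix (Fin n) (Fin n) (A ⊗[𝔣] L) := Matrix.of fun i =>
    if h : (i : ℕ) = 0 then Pi.single l (algebraMap A _ (t : A)) else Pi.single ⟨i - 1, by omega⟩ 1
  have h1 : cmat hg c (v * S) = P * (cmat hg c v).map (sg A g⁻¹) := by
    ext i j
    rw [cmat_apply, ← mul_assoc, coord_mul_S, Matrix.mul_apply]
    by_cases h : (i : ℕ) = 0
    · have hP : ∀ k, P i k = (Pi.single l (algebraMap A _ (t : A)) : Fin n → A ⊗[𝔣] L) k := fun k => by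
        simp only [P, Matrix.of_apply]; rw [dif_pos h]
      simp only [hP, Pi.single_apply, ite_mul, zero_mul, Finset.sum_ite_eq', Finset.mem_univ, if_true]
      have h2 := coord_sub_n hg (c ^ (j : ℕ) * v) ((n - 1 : ℕ) : ℤ)
      have h3 : (((n - 1 : ℕ) : ℤ) - n) = (i : ℤ) - 1 := by
        rw [h, Nat.cast_sub (NeZero.pos n)]; push_cast; ring
      rw [h3] at h2
      rw [h2, map_smul, Algebra.smul_def]
      rfl
    · have hP : ∀ k, P i k = (Pi.single (⟨i - 1, by omega⟩ : Fin n) 1 : Fin n → A ⊗[𝔣] L) k := fun k => by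
        simp only [P, Matrix.of_apply]; rw [dif_neg h]
      simp only [hP, Pi.single_apply, ite_mul, zero_mul, one_mul, Finset.sum_ite_eq', Finset.mem_univ, if_true]
      have h3 : ((i : ℤ) - 1) = ((i - 1 : ℕ) : ℤ) := by omega
      rw [h3]
      rfl
  refine ⟨P.det, ?_⟩
  rw [h1, Matrix.det_mul]
  congr 1
  exact (RingHom.map_det (sg A g⁻¹).toRingEquiv.toRingHom _).symm

lemma inc_mul_S_pow (u : A ⊗[𝔣] L) (k : ℕ) :
    (inc u * S : Cyc A g n t) ^ k = inc (∏ j ∈ Finset.range k, sg A (g ^ j) u) * S ^ k := by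
  induction k with
  | zero => simp
  | succ k ih =>
    rw [pow_succ, ih, mul_assoc, ← mul_assoc (S ^ k), S_pow_mul_inc, Finset.prod_range_succ, map_mul, pow_succ]
    simp only [mul_assoc]

lemma inc_mul_S_pow_n (u : A ⊗[𝔣] L) :
    (inc u * S : Cyc A g n t) ^ n = inc (DualBasis.nm g n u) * algebraMap A _ (t : A) := by
  rw [inc_mul_S_pow, S_pow]; rfl

lemma inc_mul_S_pow_mul_inc (u z : A ⊗[𝔣] L) (k : ℕ) :
    ((inc u * S) ^ k * inc z : Cyc A g n t) = inc (sg A (g ^ k) z) * (inc u * S) ^ k := by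
  rw [inc_mul_S_pow, mul_assoc, S_pow_mul_inc, ← mul_assoc, ← map_mul, mul_comm, map_mul, mul_assoc]

end

variable {O : Type*} [CommRing O] [IsDomain O] [IsDiscreteValuationRing O] [Algebra 𝔣 O] {t : Oˣ}

/-- A cyclic vector of the residue algebra lifts to a vector whose determinant is nonzero in the
field `κ ⊗ L`, hence a unit; its span is then everything. -/
lemma exists_generator_of_isDomain (G : DualBasis g n) (hn : n.Prime)
    (hD : IsDomain (Cyc (IsLocalRing.ResidueField O) g n (Units.map (redHom 𝔣 O : O →* _) t)))
    {c : Cyc O g n t} (hc : bc (redHom 𝔣 O) c ∉ (algebraMap (IsLocalRing.ResidueField O) _).range) :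
    ∃ v, (cmat G.pow_eq_one c v).det ≠ 0 ∧ InSpan c v (v * S) := by
  have hg := G.pow_eq_one
  obtain ⟨v, hv⟩ := exists_det_cmat_ne_zero G hn hD hc
  obtain ⟨v, rfl⟩ := bc_surjective (t := t) (redHom 𝔣 O) hg redHom_surjective v
  have h1 : (cmat hg (bc (redHom 𝔣 O) c) (bc (redHom 𝔣 O) v)).det = mapL L (redHom 𝔣 O) (cmat hg c v).det := by
    rw [cmat_bc]
    exact (RingHom.map_det (mapL L (redHom 𝔣 O)).toRingHom _).symm
  rw [h1] at hv
  have h2 : IsUnit (cmat hg c v).det := by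
    apply isUnit_of_mapL G
    obtain ⟨w, hw⟩ := (isField_tensor G hD).mul_inv_cancel hv
    exact .of_mul_eq_one _ hw
  refine ⟨v, fun h => hv (by rw [h, map_zero]), ?_⟩
  exact (InSpan.mul_inc_iff h2).1 (exists_eq_sum_of_det hg c v (v * S))

/-- A vector which is approximately fixed and a generator up to a small power of `p`. -/
lemma exists_approx_fixed (G : DualBasis g n) (c v₀ : Cyc O g n t) (y : Fin (n + 1) → O) (u : O ⊗[𝔣] L)
    {p ε a : O} (hε : IsUnit ε) (hp0 : p ≠ 0)
    {q b N : ℕ} (hdet : (Matrix.vandermonde y).det = ε * p ^ q)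
    (hu : DualBasis.nm g n u = algebraMap O _ a) (ha : p ^ N ∣ a * t - 1)
    (hv : ¬ algebraMap O _ p ^ b ∣ (cmat G.pow_eq_one c v₀).det) :
    ∃ v d, ¬ algebraMap O _ p ^ (b + n * q) ∣ (cmat G.pow_eq_one c v).det ∧
      v * (inc u * S) = v + p ^ N • d := by
  have hg := G.pow_eq_one
  set s : Cyc O g n t := inc u * S with hs
  -- Averages over the powers of `u s`. Since `(u s) ^ n` is close to `1`, they are almost fixed by
  -- right multiplication by `u s`, and so are their combinations with coefficients in `O`.
  set V : Fin n → Cyc O g n t := fun j => ∑ i ∈ Finset.range n, v₀ * ι (G.b j) * s ^ i with hV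
  obtain ⟨x, hx⟩ := ha
  have hsn : s ^ n = 1 + algebraMap O _ (p ^ N * x) := by
    rw [hs, inc_mul_S_pow_n, hu, AlgHom.commutes, ← map_mul, ← hx, map_sub, map_one]; abel
  have hVs : ∀ j, V j * s = V j + p ^ N • (x • (v₀ * ι (G.b j))) := by
    intro j
    have h1 := Finset.sum_range_succ (fun i => v₀ * ι (G.b j) * s ^ i) n
    rw [Finset.sum_range_succ'] at h1
    simp only [pow_succ, ← mul_assoc, pow_zero, mul_one, hsn] at h1
    rw [← Finset.sum_mul, mul_add, mul_one, ← add_assoc, ← Algebra.commutes, ← Algebra.smul_def, mul_smul,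
      add_right_comm] at h1
    exact add_right_cancel h1
  have hterm : ∀ i : ℕ, ∑ j, v₀ * ι (G.b j) * s ^ i * inc (1 ⊗ₜ G.μ j) =
      v₀ * ι ((g ^ i) (∑ j, (g ^ (-i : ℤ)) (G.b j) * G.μ j)) * s ^ i := by
    intro i
    rw [← inc_one_tmul, map_sum, TensorProduct.tmul_sum, map_sum, Finset.mul_sum, Finset.sum_mul]
    refine Finset.sum_congr rfl fun j _ => ?_
    rw [mul_assoc, hs, inc_mul_S_pow_mul_inc, sg_tmul, inc_one_tmul, inc_one_tmul, map_mul, ι_mul, zpow_neg,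
      zpow_natCast, ← AlgEquiv.mul_apply, mul_inv_cancel, AlgEquiv.one_apply]
    simp only [mul_assoc]
  -- Duality: the term for `s ^ i` carries the factor `∑ g ^ (-i) (b_j) μ_j`, which vanishes for `0
  -- < i < n`.
  have hv0 : v₀ = ∑ j, V j * inc (1 ⊗ₜ G.μ j) := by
    simp only [hV, Finset.sum_mul]
    rw [Finset.sum_comm, Finset.sum_eq_single_of_mem 0 (Finset.mem_range.2 (NeZero.pos n))]
    · rw [hterm, G.dual, if_pos (by simp)]
      simp [ι_one]
    · intro i hi hi0
      rw [hterm, G.dual, if_neg, map_zero, ι_zero, mul_zero, zero_mul]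
      rw [dvd_neg]
      exact_mod_cast Nat.not_dvd_of_pos_of_lt (Nat.pos_of_ne_zero hi0) (Finset.mem_range.1 hi)
  have hcm : ∀ w : Fin n → O ⊗[𝔣] L, cmat hg c (∑ j, V j * inc (w j)) = ∑ j, w j • cmat hg c (V j) := by
    intro w
    rw [cmat_sum]
    exact Finset.sum_congr rfl fun j _ => cmat_mul_inc hg _ _ _
  rw [hv0, hcm] at hv
  -- The coefficients `μ_j` lie in `L` and would destroy approximate invariance. They are traded for
  -- the scalars `y i` from `O`, with the determinant losing at most `p ^ (n q)`.
  obtain ⟨k, hk⟩ := Matrix.exists_not_dvd_det_sum (fun j => cmat hg c (V j))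
    (fun i => algebraMap O (O ⊗[𝔣] L) (y i)) (p := algebraMap O _ p) (hε.map (algebraMap O (O ⊗[𝔣] L)))
    (q := q) (fun z hz => eq_zero_of_algebraMap_mul G (pow_ne_zero q hp0) (by rwa [map_pow])) (by
      rw [← map_pow, ← map_mul, ← hdet, RingHom.map_det]
      congr 1
      ext i j
      simp [Matrix.vandermonde_apply]) _ hv
  rw [← hcm] at hk
  refine ⟨_, ∑ j, y (k j) • (x • (v₀ * ι (G.b j))), hk, ?_⟩
  rw [Finset.sum_mul, Finset.smul_sum, ← Finset.sum_add_distrib]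
  refine Finset.sum_congr rfl fun j _ => ?_
  rw [AlgHom.commutes, ← Algebra.commutes, mul_assoc, hVs, mul_add, ← Algebra.smul_def, ← Algebra.smul_def,
    smul_comm]

/-- If `v` satisfies `v u s ≡ v` modulo a power of `π` exceeding the one in its determinant, then
the determinant, stripped of its power of `π`, is semi-invariant under `g` in the residue ring. That
forces it to be a unit, so the error term already lies in the span of the `c ^ j v`. -/
lemma exists_generator_of_nm (G : DualBasis g n) {π : O} (hπ : Irreducible π)
    (h : ∃ u : IsLocalRing.ResidueField O ⊗[𝔣] L, DualBasis.nm g n u * algebraMap _ _ (redHom 𝔣 O t) = 1)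
    {c v₀ : Cyc O g n t} (hv : (cmat G.pow_eq_one c v₀).det ≠ 0) :
    ∃ v, (cmat G.pow_eq_one c v).det ≠ 0 ∧ InSpan c v (v * S) := by
  have hg := G.pow_eq_one
  have hπ0 := hπ.ne_zero
  set p := algebraMap O (O ⊗[𝔣] L) π with hp
  obtain ⟨b, hb⟩ : ∃ b, ¬ p ^ b ∣ (cmat hg c v₀).det := by
    by_contra! hall
    apply hv
    apply (G.bA O).repr.map_eq_zero_iff.1
    ext j
    by_contra h0
    obtain ⟨m, hm⟩ := FiniteMultiplicity.of_not_isUnit hπ.not_isUnit h0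
    apply hm
    obtain ⟨z, hz⟩ := hall (m + 1)
    rw [hz, hp, ← map_pow, ← Algebra.smul_def, map_smul, Finsupp.smul_apply, smul_eq_mul]
    exact dvd_mul_right _ _
  -- Powers of `π` serve as interpolation points because the residue field may be too small to
  -- supply `n + 1` points with distinct residues.
  have hinj : Function.Injective (fun i : Fin (n + 1) => π ^ (i : ℕ)) := fun i j hij =>
    Fin.ext (pow_injective_of_not_isUnit hπ.not_isUnit hπ0 hij)
  obtain ⟨q, ε, hdet⟩ := IsDiscreteValuationRing.eq_unit_mul_pow_irreducible
    (Matrix.det_vandermonde_ne_zero_iff.2 hinj) hπ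
  -- The congruence holds modulo `π ^ (b + n q + 1)`, strictly beyond the power that can divide the
  -- determinant of `v`.
  obtain ⟨u, a, hu, ha⟩ := exists_nm_approx G hπ t h (b + n * q)
  obtain ⟨v, d, hvb, hvd⟩ := exists_approx_fixed G c v₀ _ u ε.isUnit hπ0 hdet hu ha hb
  have huu : IsUnit u := by
    refine isUnit_of_dvd_unit (DualBasis.dvd_nm (g := g) (n := n) u) ?_
    rw [hu]
    refine IsUnit.map _ ?_
    have h1 : redHom 𝔣 O (a * t) = 1 := by
      obtain ⟨x, hx⟩ := ha
      rw [← sub_eq_zero, ← map_one (redHom 𝔣 O), ← map_sub, hx, map_mul, map_pow, redHom_irreducible hπ,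
        zero_pow (by omega), zero_mul]
    have h2 : IsUnit (a * t) := (isUnit_map_iff (IsLocalRing.residue O) _).1 (by
      change IsUnit (redHom 𝔣 O (a * t)); rw [h1]; exact isUnit_one)
    exact isUnit_of_mul_isUnit_left h2
  have hcancel : ∀ k z, p ^ k * z = 0 → z = 0 := fun k z hz =>
    eq_zero_of_algebraMap_mul G (pow_ne_zero k hπ0) (by rwa [map_pow])
  have hex : ∃ k, ¬ p ^ k ∣ (cmat hg c v).det := ⟨_, hvb⟩
  classical
  obtain ⟨k, hk⟩ : ∃ k, Nat.find hex = k + 1 := Nat.exists_eq_succ_of_ne_zero fun h0 => by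
    have := Nat.find_spec hex
    rw [h0, pow_zero] at this
    exact this (one_dvd _)
  -- So `p ^ k` is the exact power of `p` dividing the determinant, and `k < b + n q`.
  obtain ⟨γ, hγ⟩ : p ^ k ∣ (cmat hg c v).det := not_not.1 (Nat.find_min hex (m := k) (by omega))
  have hγp : ¬ p ∣ γ := fun hdvd => by
    apply Nat.find_spec hex
    rw [hk, hγ, pow_succ]
    exact mul_dvd_mul_left _ hdvd
  have hkN : k < b + n * q := by
    have := Nat.find_min' hex hvb
    omega
  have hS : (inc u * S : Cyc O g n t) = S * inc (sg O g⁻¹ u) := inc_mul_S _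
  obtain ⟨ε', hε'⟩ := exists_det_cmat_mul_S hg c v
  -- The determinants attached to `v` and to `v u s` agree modulo `p ^ (b + n q + 1)`. The second is
  -- computed by twisting the first, and `p ^ k` cancels.
  have hγ1 : p ∣ ε' * sg O g⁻¹ u ^ n * sg O g⁻¹ γ - γ := by
    have h1 := Matrix.dvd_det_add_smul_sub (cmat hg c v) (cmat hg c d) (p ^ (b + n * q + 1))
    have h2 : cmat hg c v + p ^ (b + n * q + 1) • cmat hg c d = sg O g⁻¹ u • cmat hg c (v * S) := by
      rw [← cmat_mul_inc, ← cmat_add, ← cmat_mul_inc, mul_assoc, ← hS, hvd, hp, ← map_pow, AlgHom.commutes,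
        ← Algebra.commutes, ← Algebra.smul_def]
    rw [h2, Matrix.det_smul, hε', hγ, map_mul, map_pow, hp, AlgEquiv.commutes, ← hp, Fintype.card_fin] at h1
    obtain ⟨z, hz⟩ := h1
    obtain ⟨m, hm⟩ := Nat.exists_eq_add_of_lt hkN
    refine ⟨p ^ (m + 1) * z, sub_eq_zero.1 (hcancel k _ ?_)⟩
    have : p ^ (b + n * q + 1) = p ^ k * (p * p ^ (m + 1)) := by rw [hm]; ring
    rw [this] at hz
    linear_combination hz
  have hγu : IsUnit γ := by
    apply isUnit_of_mapL G
    apply G.isUnit_of_dvd_sg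
    · intro h0
      obtain ⟨w, hw⟩ := mapL_eq_zero (redHom 𝔣 O) G (fun a ha => redHom_eq_zero hπ ha) h0
      exact hγp ⟨w, by rw [hw, Algebra.smul_def]⟩
    · obtain ⟨z, hz⟩ := hγ1
      have h1 := congrArg (mapL L (redHom 𝔣 O)) hz
      rw [map_mul, hp, mapL_algebraMap, redHom_irreducible hπ, map_zero, zero_mul, map_sub, sub_eq_zero,
        map_mul, mapL_sg] at h1
      have h2 := congrArg (sg (IsLocalRing.ResidueField O) g) h1
      rw [map_mul, ← AlgEquiv.mul_apply, ← map_mul, mul_inv_cancel, map_one, AlgEquiv.one_apply] at h2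
      exact ⟨_, by rw [← h2, mul_comm]⟩
  refine ⟨v, fun h0 => hvb (by rw [h0]; exact dvd_zero _), ?_⟩
  -- Cramer's rule puts `d γ p ^ k` in the span and the unit `γ` can be removed. As the error is `p
  -- ^ (b + n q + 1) d` with a larger exponent than `k`, it lies in the span as well.
  have h1 : InSpan c v (d * inc (p ^ k)) := by
    have := exists_eq_sum_of_det hg c v d
    rw [hγ, map_mul, ← mul_assoc] at this
    exact (InSpan.mul_inc_iff hγu).1 this
  have h2 : InSpan c v (v * (inc u * S)) := by
    rw [hvd]
    refine (InSpan.self c v).add ?_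
    have h3 := h1.mul_inc (p ^ (b + n * q + 1 - k))
    rwa [mul_assoc, ← map_mul, ← pow_add, Nat.add_sub_cancel' (by omega), hp, ← map_pow, AlgHom.commutes,
        ← Algebra.commutes, ← Algebra.smul_def] at h3
  rw [hS, ← mul_assoc] at h2
  exact (InSpan.mul_inc_iff (huu.map _)).1 h2

end Cyc

end LocalGenerator

/-! ### Frobenius operators that preserve the lattice at a discrete valuation ring. -/

section LocalOperator

variable {𝔣 L : Type*} [Field 𝔣] [Field L] [Algebra 𝔣 L] {g : L ≃ₐ[𝔣] L} {n : ℕ} [NeZero n]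

namespace Cyc

lemma bc_sz {A B : Type*} [CommRing A] [Algebra 𝔣 A] [CommRing B] [Algebra 𝔣 B] {t : Aˣ} (f : A →ₐ[𝔣] B) (k : ℤ) :
    bc f (sz k : Cyc A g n t) = sz k := by
  have h : Units.map (RingHom.toMonoidHom (bc f : Cyc A g n t →+* _)) Su = Su := by ext; simp
  have h2 := congrArg (fun u : (Cyc B g n (Units.map (f : A →* B) t))ˣ => Units.val (u ^ k)) h
  rw [← map_zpow] at h2
  exact h2

section
variable {O F : Type*} [CommRing O] [Algebra 𝔣 O] [CommRing F] [Algebra 𝔣 F]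
  {t : Oˣ} (f : O →ₐ[𝔣] F)

lemma bc_basis (G : DualBasis g n) (p : Σ _ : Fin n, Fin n) :
    bc f (basis G O t p) = basis G F (Units.map (f : O →* F) t) p := by
  simp [basis_apply]

lemma mem_range_bc_iff (G : DualBasis g n) (x : Cyc F g n (Units.map (f : O →* F) t)) :
    x ∈ (bc (t := t) (g := g) (n := n) f).range ↔ ∀ p, (basis G F _).repr x p ∈ f.range := by
  constructor
  · rintro ⟨y, rfl⟩ p
    refine ⟨(basis G O t).repr y p, ?_⟩
    conv_rhs => rw [← (basis G O t).sum_repr y]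
    simp only [map_sum, bc_smul, bc_basis f G, map_smul, Module.Basis.repr_self, Finsupp.finsetSum_apply,
      Finsupp.smul_apply, Finsupp.single_apply]
    simp
  · intro h
    choose y hy using h
    refine ⟨∑ p, y p • basis G O t p, ?_⟩
    rw [← (basis G F _).sum_repr x, map_sum]
    refine Finset.sum_congr rfl fun p _ => ?_
    rw [bc_smul, bc_basis f G, ← hy]
    rfl
end

section
variable {F : Type*} [Field F] [Algebra 𝔣 F] {t : Fˣ}

/-- `v` generates the algebra as a bimodule over the subalgebra of `c` and `L`. -/
def IsCyclicVector (c v : Cyc F g n t) : Prop :=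
  ∀ P : Submodule F (Cyc F g n t), v ∈ P → (∀ d ∈ P, c * d ∈ P) → (∀ d ∈ P, ∀ a : L, d * ι a ∈ P) → P = ⊤

/-- A `g`-semilinear operator commuting with left multiplication by `c` and fixing a cyclic vector. -/
def IsFrobenius (c : Cyc F g n t) (w : Module.End F (Cyc F g n t)) : Prop :=
  (∃ v, IsCyclicVector c v ∧ w v = v) ∧ (∀ d, w (c * d) = c * w d) ∧ ∀ d (a : L), w (d * ι a) = w d * ι (g a)

lemma mul_inc_mem {P : Submodule F (Cyc F g n t)} (h : ∀ d ∈ P, ∀ a : L, d * ι a ∈ P) {d : Cyc F g n t}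
    (hd : d ∈ P) (z : F ⊗[𝔣] L) : d * inc z ∈ P := by
  induction z using TensorProduct.induction_on with
  | zero => simp
  | tmul r a =>
    rw [inc_tmul, ← Algebra.smul_def, mul_smul_comm]
    exact P.smul_mem _ (h d hd a)
  | add x y hx hy => rw [map_add, mul_add]; exact add_mem hx hy

lemma isCyclicVector_of_det (G : DualBasis g n) (hD : IsDomain (Cyc F g n t)) {c c₁ v : Cyc F g n t} {α β : F}
    (hα : α ≠ 0) (hc : c = algebraMap F _ β + α • c₁) (hv : (cmat G.pow_eq_one c₁ v).det ≠ 0) :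
    IsCyclicVector c v := by
  intro P hvP hcP hLP
  have hc₁ : ∀ d ∈ P, c₁ * d ∈ P := by
    intro d hd
    have h1 : c₁ = α⁻¹ • (c - algebraMap F _ β) := by
      rw [hc, add_sub_cancel_left, smul_smul, inv_mul_cancel₀ hα, one_smul]
    rw [h1, smul_mul_assoc, sub_mul, ← Algebra.smul_def]
    exact P.smul_mem _ (sub_mem (hcP d hd) (P.smul_mem _ hd))
  have hpow : ∀ k : ℕ, c₁ ^ k * v ∈ P := by
    intro k
    induction k with
    | zero => simpa using hvP
    | succ k ih => rw [pow_succ', mul_assoc]; exact hc₁ _ ih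
  rw [eq_top_iff]
  intro d _
  have hu : IsUnit (cmat G.pow_eq_one c₁ v).det := by
    obtain ⟨w, hw⟩ := (isField_tensor G hD).mul_inv_cancel hv
    exact .of_mul_eq_one _ hw
  obtain ⟨z, hz⟩ := (InSpan.mul_inc_iff hu).1 (exists_eq_sum_of_det G.pow_eq_one c₁ v d)
  rw [hz]
  exact sum_mem fun j _ => mul_inc_mem hLP (hpow j) _

/-- The operator `d ↦ (∑ c ^ i d z_i) s⁻¹`. -/
noncomputable def frob (c : Cyc F g n t) (z : Fin n → F ⊗[𝔣] L) : Module.End F (Cyc F g n t) :=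
  ∑ j : Fin n, (LinearMap.mulRight F (inc (z j) * sz (-1))).comp (LinearMap.mulLeft F (c ^ (j : ℕ)))

lemma frob_apply (c : Cyc F g n t) (z : Fin n → F ⊗[𝔣] L) (d : Cyc F g n t) :
    frob c z d = (∑ j : Fin n, c ^ (j : ℕ) * d * inc (z j)) * sz (-1) := by
  simp [frob, Finset.sum_mul, mul_assoc]

lemma frob_mul_left {c c₁ : Cyc F g n t} (h : Commute c c₁) (z : Fin n → F ⊗[𝔣] L) (d : Cyc F g n t) :
    frob c₁ z (c * d) = c * frob c₁ z d := by
  rw [frob_apply, frob_apply, ← mul_assoc, Finset.mul_sum]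
  congr 1
  refine Finset.sum_congr rfl fun j _ => ?_
  rw [← mul_assoc, ← (h.pow_right j).eq]
  simp only [mul_assoc]

lemma frob_mul_ι (c : Cyc F g n t) (z : Fin n → F ⊗[𝔣] L) (d : Cyc F g n t) (a : L) :
    frob c z (d * ι a) = frob c z d * ι (g a) := by
  have h := sz_mul_ι (A := F) (t := t) (g := g) (n := n) (-1) (g a)
  rw [zpow_neg_one, ← AlgEquiv.mul_apply, inv_mul_cancel, AlgEquiv.one_apply] at h
  have h1 : ∑ j : Fin n, c ^ (j : ℕ) * (d * ι a) * inc (z j) = (∑ j : Fin n, c ^ (j : ℕ) * d * inc (z j)) * ι a := by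
    rw [Finset.sum_mul]
    refine Finset.sum_congr rfl fun j _ => ?_
    rw [← inc_one_tmul, mul_assoc, mul_assoc, mul_assoc, mul_assoc, ← map_mul, ← map_mul, mul_comm (z j)]
  rw [frob_apply, frob_apply, h1, mul_assoc, ← h, mul_assoc]

lemma frob_eq_self {c v : Cyc F g n t} {z : Fin n → F ⊗[𝔣] L}
    (h : v * S = ∑ j : Fin n, c ^ (j : ℕ) * v * inc (z j)) : frob c z v = v := by
  rw [frob_apply, ← h, ← sz_one, mul_assoc, sz_mul_neg, mul_one]

end

section
variable {O F : Type*} [CommRing O] [IsDomain O] [IsDiscreteValuationRing O] [Algebra 𝔣 O] [Field F] [Algebra 𝔣 F]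
  [Algebra O F] [IsScalarTower 𝔣 O F] [IsFractionRing O F] {t : Oˣ}

local notation "fr" => IsScalarTower.toAlgHom 𝔣 O F

lemma exists_bc_eq_smul (G : DualBasis g n) (x : Cyc F g n (Units.map (fr : O →* F) t)) :
    ∃ h : O, h ≠ 0 ∧ ∃ y : Cyc O g n t, bc fr y = algebraMap O F h • x := by
  classical
  obtain ⟨b, hb⟩ := IsLocalization.exist_integer_multiples_of_finset (nonZeroDivisors O)
    (Finset.univ.image ((basis G F (Units.map (fr : O →* F) t)).repr x))
  refine ⟨b, nonZeroDivisors.ne_zero b.2, (mem_range_bc_iff fr G _).2 fun p => ?_⟩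
  obtain ⟨y, hy⟩ := hb _ (Finset.mem_image_of_mem _ (Finset.mem_univ p))
  refine ⟨y, ?_⟩
  rw [map_smul, Finsupp.smul_apply, smul_eq_mul, ← Algebra.smul_def, ← hy]
  rfl

/-- Scale `c` to be integral and write it as a scalar plus `π ^ k c₁` with `k` maximal. Such a `k`
exists because a commutator of `c` with some integral element is nonzero and so not infinitely
divisible by `π`. Maximality says that `c₁` is not scalar modulo `π`. -/
lemma exists_reduced (G : DualBasis g n) (hn : n.Prime) (hD : IsDomain (Cyc F g n (Units.map (fr : O →* F) t)))
    {c : Cyc F g n (Units.map (fr : O →* F) t)} (hc : c ∉ (algebraMap F _).range) :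
    ∃ (c₁ : Cyc O g n t) (α β : F), α ≠ 0 ∧ c = algebraMap F _ β + α • bc fr c₁ ∧
      bc (redHom 𝔣 O) c₁ ∉ (algebraMap (IsLocalRing.ResidueField O) _).range := by
  have hinjF : Function.Injective (algebraMap O F) := IsFractionRing.injective O F
  have hinj : Function.Injective (bc (t := t) (g := g) (n := n) fr) := bc_injective fr G hinjF
  have hfin := finite_of_dual G (A := F) (t := Units.map (fr : O →* F) t)
  have hnc := exists_not_commute G hn (K := F) (t := Units.map (fr : O →* F) t)
  obtain ⟨y, hy⟩ : ∃ y, c * y ≠ y * c := by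
    by_contra! h
    obtain ⟨x, y, hxy⟩ := hnc
    have h1 := centralizer_singleton_eq_adjoin hn (finrank_eq G) ⟨x, y, hxy⟩ hc
    have h2 : ∀ x, x ∈ Algebra.adjoin F {c} := fun x => by
      rw [← h1, Subalgebra.mem_centralizer_iff]
      rintro _ rfl
      exact h x
    exact hxy (adjoin_commute (s := {c}) (by simp) x (h2 x) y (h2 y))
  obtain ⟨h, h0, c₀, hc₀⟩ := exists_bc_eq_smul G c
  obtain ⟨h', h0', y₀, hy₀⟩ := exists_bc_eq_smul G y
  have hF0 : ∀ {x : O}, x ≠ 0 → algebraMap O F x ≠ 0 := fun hx h => hx (hinjF (by rw [h, map_zero]))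
  have hcy : c₀ * y₀ - y₀ * c₀ ≠ 0 := by
    intro h1
    have h2 := congrArg (bc fr) h1
    rw [map_sub, map_mul, map_mul, hc₀, hy₀, map_zero, smul_mul_smul_comm, smul_mul_smul_comm, mul_comm, ← smul_sub,
      smul_eq_zero] at h2
    exact h2.elim (mul_ne_zero (hF0 h0') (hF0 h0)) (fun h3 => hy (sub_eq_zero.1 h3))
  obtain ⟨π, hπ⟩ := IsDiscreteValuationRing.exists_irreducible O
  obtain ⟨a, ha⟩ : ∃ a, ¬ ∃ d, c₀ * y₀ - y₀ * c₀ = π ^ a • d := by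
    by_contra! hall
    apply hcy
    apply (basis G O t).repr.map_eq_zero_iff.1
    ext j
    by_contra h0
    obtain ⟨m, hm⟩ := FiniteMultiplicity.of_not_isUnit hπ.not_isUnit h0
    apply hm
    obtain ⟨z, hz⟩ := hall (m + 1)
    rw [hz, map_smul, Finsupp.smul_apply, smul_eq_mul]
    exact dvd_mul_right _ _
  have hex : ∃ a, ¬ ∃ b c₁, c₀ = algebraMap O _ b + π ^ a • c₁ := by
    refine ⟨a, ?_⟩
    rintro ⟨b, c₁, hb⟩
    refine ha ⟨c₁ * y₀ - y₀ * c₁, ?_⟩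
    rw [hb, add_mul, mul_add, Algebra.commutes, smul_mul_assoc, mul_smul_comm, smul_sub]
    abel
  classical
  obtain ⟨k, hk⟩ : ∃ k, Nat.find hex = k + 1 := Nat.exists_eq_succ_of_ne_zero fun h0 => by
    have := Nat.find_spec hex
    rw [h0] at this
    exact this ⟨0, c₀, by simp⟩
  obtain ⟨b, c₁, hb⟩ := not_not.1 (Nat.find_min hex (m := k) (by omega))
  refine ⟨c₁, (algebraMap O F h)⁻¹ * algebraMap O F (π ^ k), (algebraMap O F h)⁻¹ * algebraMap O F b, ?_, ?_, ?_⟩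
  · exact mul_ne_zero (inv_ne_zero (hF0 h0)) (hF0 (pow_ne_zero k hπ.ne_zero))
  · have h1 : bc fr c₀ = algebraMap F _ (algebraMap O F b) + algebraMap O F (π ^ k) • bc fr c₁ := by
      rw [hb, map_add, bc_algebraMap, bc_smul]; rfl
    rw [hc₀] at h1
    rw [mul_smul, map_mul, ← Algebra.smul_def, ← smul_add, ← h1, smul_smul, inv_mul_cancel₀ (hF0 h0), one_smul]
  · rintro ⟨r, hr⟩
    obtain ⟨r, rfl⟩ := redHom_surjective (𝔣 := 𝔣) r
    have h1 : bc (redHom 𝔣 O) (c₁ - algebraMap O _ r) = 0 := by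
      rw [map_sub, bc_algebraMap, hr, sub_self]
    obtain ⟨d, hd⟩ := bc_eq_zero (redHom 𝔣 O) G (fun a ha => redHom_eq_zero hπ ha) h1
    apply Nat.find_spec hex
    rw [hk]
    refine ⟨b + π ^ k * r, d, ?_⟩
    rw [hb, sub_eq_iff_eq_add.1 hd, map_add, map_mul, ← Algebra.smul_def, smul_add, pow_succ, mul_smul]
    abel

/-- Locally there is a Frobenius operator preserving the lattice. -/
theorem exists_isFrobenius (G : DualBasis g n) (hn : n.Prime)
    (hD : IsDomain (Cyc F g n (Units.map (fr : O →* F) t)))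
    {c : Cyc F g n (Units.map (fr : O →* F) t)} (hc : c ∉ (algebraMap F _).range) :
    ∃ w, IsFrobenius c w ∧ ∀ d ∈ (bc (t := t) (g := g) (n := n) fr).range, w d ∈ (bc (t := t) (g := g) (n := n) fr).range := by
  have hg := G.pow_eq_one
  have hinjF : Function.Injective (algebraMap O F) := IsFractionRing.injective O F
  have hmapinj := mapL_injective (L := L) fr G hinjF
  obtain ⟨c₁, α, β, hα, hcc, hc₁⟩ := exists_reduced G hn hD hc
  have hdetbc : ∀ v, (cmat hg (bc fr c₁) (bc fr v)).det = mapL L fr (cmat hg c₁ v).det := fun v => by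
    rw [cmat_bc]
    exact (RingHom.map_det (mapL L fr).toRingHom _).symm
  -- Once `v s = ∑ c₁ ^ j v z_j` with integral `z_j`, the operator `d ↦ (∑ c₁ ^ j d z_j) s⁻¹` fixes
  -- `v` and preserves the lattice. Two cases, according to whether the residue algebra is a domain.
  obtain ⟨v, hv, z, hz⟩ : ∃ v, (cmat hg c₁ v).det ≠ 0 ∧ InSpan c₁ v (v * S) := by
    by_cases hκ : IsDomain (Cyc (IsLocalRing.ResidueField O) g n (Units.map (redHom 𝔣 O : O →* _) t))
    · exact exists_generator_of_isDomain G hn hκ hc₁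
    · obtain ⟨π, hπ⟩ := IsDiscreteValuationRing.exists_irreducible O
      have hc₁F : bc fr c₁ ∉ (algebraMap F _).range := by
        rintro ⟨r, hr⟩
        refine hc ⟨β + α * r, ?_⟩
        rw [hcc, ← hr, map_add, map_mul, Algebra.smul_def]
      obtain ⟨v', hv'⟩ := exists_det_cmat_ne_zero G hn hD hc₁F
      obtain ⟨h, h0, v₀, hv₀⟩ := exists_bc_eq_smul G v'
      refine exists_generator_of_nm G hπ (exists_nm_mul_eq_one G hn hκ) (v₀ := v₀) fun h1 => hv' ?_
      have h2 := hdetbc v₀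
      rw [h1, map_zero, hv₀, Algebra.smul_def, Algebra.commutes, ← AlgHom.commutes inc, cmat_mul_inc, Matrix.det_smul] at h2
      have hu : IsUnit (algebraMap F (F ⊗[𝔣] L) (algebraMap O F h) ^ Fintype.card (Fin n)) :=
        ((isUnit_iff_ne_zero.2 fun h3 => h0 (hinjF (by rw [h3, map_zero]))).map _).pow _
      exact hu.mul_right_eq_zero.1 h2
  have hzF : bc fr v * S = ∑ j : Fin n, bc fr c₁ ^ (j : ℕ) * bc fr v * inc (mapL L fr (z j)) := by
    have := congrArg (bc fr) hz
    simpa only [map_mul, bc_S, map_sum, map_pow, bc_inc] using this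
  refine ⟨frob (bc fr c₁) (fun j => mapL L fr (z j)), ⟨⟨bc fr v, ?_, frob_eq_self hzF⟩, frob_mul_left ?_ _, frob_mul_ι _ _⟩, ?_⟩
  · refine isCyclicVector_of_det G hD hα hcc ?_
    rw [hdetbc]
    exact fun h => hv (hmapinj (by rw [h, map_zero]))
  · rw [hcc]
    exact Commute.add_left (Algebra.commutes _ _) ((Commute.refl _).smul_left α)
  · rintro _ ⟨d, rfl⟩
    rw [frob_apply]
    refine ⟨(∑ j : Fin n, c₁ ^ (j : ℕ) * d * inc (z j)) * sz (-1), ?_⟩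
    simp only [map_mul, map_sum, map_pow, bc_inc, bc_sz]

end

end Cyc

end LocalOperator

/-! ### Conjugation and norm identities for a commutative subgroup normalized by an element of
finite order. -/

section GroupTheory

variable {Γ : Type*} [Group Γ] {E : Subgroup Γ}

/-- The witness is the product of the `u ^ j e u ^ (-j)` for `j < k`: the quotient of it by its
`u`-conjugate telescopes. -/
lemma exists_conj_quotient (hE : ∀ x ∈ E, ∀ y ∈ E, x * y = y * x) {u : Γ} (hu : ∀ x ∈ E, u * x * u⁻¹ ∈ E)
    {e : Γ} (he : e ∈ E) (k : ℕ) : ∃ x ∈ E, x * (u * x⁻¹ * u⁻¹) = e * (u ^ k * e⁻¹ * (u ^ k)⁻¹) := by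
  have huk : ∀ k : ℕ, ∀ x ∈ E, u ^ k * x * (u ^ k)⁻¹ ∈ E := by
    intro k
    induction k with
    | zero => simp
    | succ k ih =>
      intro x hx
      have := hu _ (ih x hx)
      convert this using 1
      rw [pow_succ']; group
  induction k with
  | zero => exact ⟨1, E.one_mem, by simp⟩
  | succ k ih =>
    obtain ⟨x, hx, h⟩ := ih
    refine ⟨e * (u * x * u⁻¹), E.mul_mem he (hu x hx), ?_⟩
    have h1 : u * (e * (u * x * u⁻¹))⁻¹ * u⁻¹ = u * (u * x⁻¹ * u⁻¹) * u⁻¹ * (u * e⁻¹ * u⁻¹) := by group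
    have h2 : e * (u * x * u⁻¹) * (u * (u * x⁻¹ * u⁻¹) * u⁻¹ * (u * e⁻¹ * u⁻¹)) =
        e * ((u * (x * (u * x⁻¹ * u⁻¹)) * u⁻¹) * (u * e⁻¹ * u⁻¹)) := by group
    have h3 : u * (e * (u ^ k * e⁻¹ * (u ^ k)⁻¹)) * u⁻¹ =
        (u * e * u⁻¹) * (u ^ (k + 1) * e⁻¹ * (u ^ (k + 1))⁻¹) := by rw [pow_succ']; group
    rw [h1, h2, h, h3, hE _ (hu e he) _ (huk (k + 1) _ (E.inv_mem he)), mul_assoc (u ^ (k + 1) * e⁻¹ * _)]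
    congr 1
    have : u * e * u⁻¹ * (u * e⁻¹ * u⁻¹) = 1 := by group
    rw [this, mul_one]

/-- With `u ^ (m + 1) = u w`, the telescoping identity gives `x ∈ E` with `x u x⁻¹ = e (u w) e⁻¹
w⁻¹`. Since `R w` commutes with `E`, moving `f = w⁻¹ x w` past `R` turns it into `x`. -/
lemma exists_conj_eq (hE : ∀ x ∈ E, ∀ y ∈ E, x * y = y * x) {w u R e : Γ}
    (hw : ∀ x ∈ E, w * x * w⁻¹ ∈ E) (hw' : ∀ x ∈ E, w⁻¹ * x * w ∈ E) (hR : R * w ∈ E) {a m : ℕ}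
    (hu : u = w ^ a) (hum : u ^ m = w) (he : e ∈ E) :
    ∃ f ∈ E, f * (R * w * u) * f⁻¹ = R * (e * w * e⁻¹) * (e * u * e⁻¹) := by
  have hwk : ∀ k : ℕ, ∀ x ∈ E, w ^ k * x * (w ^ k)⁻¹ ∈ E := by
    intro k
    induction k with
    | zero => simp
    | succ k ih =>
      intro x hx
      have := hw _ (ih x hx)
      convert this using 1
      rw [pow_succ']; group
  have hwu : w * u = u * w := by rw [hu]; exact (Commute.refl w).pow_right a
  obtain ⟨x, hx, h⟩ := exists_conj_quotient hE (u := u) (by rw [hu]; exact hwk a) he (m + 1)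
  rw [pow_succ', hum] at h
  refine ⟨w⁻¹ * x * w, hw' x hx, ?_⟩
  have h1 : R⁻¹ * (w⁻¹ * x * w) * R = x := by
    have h2 := hE _ (hw' x hx) _ hR
    have h3 : (w⁻¹ * x * w) * R = R * w * (w⁻¹ * x * w) * w⁻¹ := by rw [← h2]; group
    rw [mul_assoc, h3]; group
  have h2 : w⁻¹ * x * w * R = R * x := by
    have h3 : w⁻¹ * x * w * R = R * (R⁻¹ * (w⁻¹ * x * w) * R) := by group
    rw [h3, h1]
  have h3 : x * u * x⁻¹ = e * (u * w) * e⁻¹ * w⁻¹ := by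
    have h4 : x * u * x⁻¹ = x * (u * x⁻¹ * u⁻¹) * u := by group
    rw [h4, h]; group
  calc w⁻¹ * x * w * (R * w * u) * (w⁻¹ * x * w)⁻¹
      = (w⁻¹ * x * w * R) * (w * u) * w⁻¹ * x⁻¹ * w := by group
    _ = R * (x * u * x⁻¹) * w := by rw [h2, hwu]; group
    _ = R * (e * w * e⁻¹) * (e * u * e⁻¹) := by rw [h3, ← hwu]; group

lemma prod_range_mul_mod {M : Type*} [CommMonoid M] {n b : ℕ} (hn : 1 < n) (hb : b.Coprime n) (f : ℕ → M)
    (hf : ∀ j, f (j % n) = f j) : ∏ j ∈ Finset.range n, f (b * j) = ∏ j ∈ Finset.range n, f j := by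
  obtain ⟨x, -, hx⟩ := Nat.exists_mul_mod_eq_one_of_coprime hb hn
  have key : ∀ j < n, x * (b * j % n) % n = j ∧ b * (x * j % n) % n = j := by
    intro j hj
    have h1 : b * x * j % n = j := by
      rw [Nat.mul_mod, hx, one_mul, Nat.mod_mod, Nat.mod_eq_of_lt hj]
    constructor
    · rw [Nat.mul_mod, Nat.mod_mod, ← Nat.mul_mod, ← mul_assoc, mul_comm x b, h1]
    · rw [Nat.mul_mod, Nat.mod_mod, ← Nat.mul_mod, ← mul_assoc, h1]
  have hpos : 0 < n := by omega
  refine Finset.prod_nbij' (fun j => b * j % n) (fun j => x * j % n) ?_ ?_ ?_ ?_ ?_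
  · intro j _; exact Finset.mem_range.2 (Nat.mod_lt _ hpos)
  · intro j _; exact Finset.mem_range.2 (Nat.mod_lt _ hpos)
  · intro j hj; exact (key j (Finset.mem_range.1 hj)).1
  · intro j hj; exact (key j (Finset.mem_range.1 hj)).2
  · intro j _; exact (hf _).symm

/-- Expanding, `(Z w ^ b) ^ n` is the product of the conjugates of `Z` by `w ^ (b j)`, `j < n`. For
`b` prime to `n` these exponents run through all residues modulo `n`, so the product does not depend
on `b`. -/
lemma mul_pow_pow_eq (hE : ∀ x ∈ E, ∀ y ∈ E, x * y = y * x) {w Z : Γ} (hw : ∀ x ∈ E, w * x * w⁻¹ ∈ E)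
    {n : ℕ} (hn : 1 < n) (hwn : w ^ n = 1) (hZ : Z ∈ E) {a b : ℕ} (ha : a.Coprime n) (hb : b.Coprime n) :
    (Z * w ^ a) ^ n = (Z * w ^ b) ^ n := by
  letI : CommGroup E := { (inferInstance : Group E) with mul_comm := fun x y => Subtype.ext (hE x x.2 y y.2) }
  have hwk : ∀ k : ℕ, w ^ k * Z * (w ^ k)⁻¹ ∈ E := by
    intro k
    induction k with
    | zero => simpa using hZ
    | succ k ih =>
      convert hw _ ih using 1
      rw [pow_succ']; group
  let f : ℕ → E := fun j => ⟨w ^ j * Z * (w ^ j)⁻¹, hwk j⟩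
  have hf : ∀ j, f (j % n) = f j := by
    intro j
    have : w ^ j = w ^ (j % n) := by
      conv_lhs => rw [← Nat.div_add_mod j n, pow_add, pow_mul, hwn, one_pow, one_mul]
    exact Subtype.ext (by simp only [f]; rw [this])
  have key : ∀ b k : ℕ, (Z * w ^ b) ^ k = ((∏ j ∈ Finset.range k, f (b * j) : E) : Γ) * w ^ (b * k) := by
    intro b k
    induction k with
    | zero => simp
    | succ k ih =>
      rw [pow_succ, ih, Finset.prod_range_succ, Subgroup.coe_mul, mul_add, mul_one, pow_add]
      simp only [f]
      group
  rw [key, key, prod_range_mul_mod hn ha f hf, prod_range_mul_mod hn hb f hf, mul_comm a, mul_comm b, pow_mul,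
    pow_mul, hwn, one_pow, one_pow]

end GroupTheory

/-! ### The commutative group of bimodule automorphisms and the transported action of `s`. -/

section Operators

variable {𝔣 L : Type*} [Field 𝔣] [Field L] [Algebra 𝔣 L] {g : L ≃ₐ[𝔣] L} {n : ℕ} [NeZero n]

namespace Cyc

variable {F : Type*} [Field F] [Algebra 𝔣 F] {t : Fˣ}

/-- `h`-semilinear operators commuting with left multiplication by `c`. -/
def IsSemi (c : Cyc F g n t) (h : L ≃ₐ[𝔣] L) (φ : Module.End F (Cyc F g n t)) : Prop :=
  (∀ d, φ (c * d) = c * φ d) ∧ ∀ d (a : L), φ (d * ι a) = φ d * ι (h a)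

lemma IsSemi.mul {c : Cyc F g n t} {h h' : L ≃ₐ[𝔣] L} {φ ψ : Module.End F (Cyc F g n t)}
    (hφ : IsSemi c h φ) (hψ : IsSemi c h' ψ) : IsSemi c (h * h') (φ * ψ) :=
  ⟨fun d => by simp [hψ.1, hφ.1], fun d a => by simp [hψ.2, hφ.2]⟩

lemma isSemi_one (c : Cyc F g n t) : IsSemi c 1 1 := ⟨fun _ => rfl, fun _ _ => rfl⟩

lemma IsSemi.pow {c : Cyc F g n t} {h : L ≃ₐ[𝔣] L} {φ : Module.End F (Cyc F g n t)}
    (hφ : IsSemi c h φ) (k : ℕ) : IsSemi c (h ^ k) (φ ^ k) := by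
  induction k with
  | zero => exact isSemi_one c
  | succ k ih => rw [pow_succ, pow_succ]; exact ih.mul hφ

lemma IsSemi.inv {c : Cyc F g n t} {h : L ≃ₐ[𝔣] L} {φ : (Module.End F (Cyc F g n t))ˣ}
    (hφ : IsSemi c h (φ : Module.End F (Cyc F g n t))) :
    IsSemi c h⁻¹ ((φ⁻¹ : (Module.End F (Cyc F g n t))ˣ) : Module.End F (Cyc F g n t)) := by
  have h1 : ∀ d, (φ : Module.End F (Cyc F g n t)) ((φ⁻¹ : (Module.End F (Cyc F g n t))ˣ).1 d) = d := fun d => by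
    rw [← Module.End.mul_apply, Units.mul_inv, Module.End.one_apply]
  have h2 : ∀ d, (φ⁻¹ : (Module.End F (Cyc F g n t))ˣ).1 ((φ : Module.End F (Cyc F g n t)) d) = d := fun d => by
    rw [← Module.End.mul_apply, Units.inv_mul, Module.End.one_apply]
  refine ⟨fun d => ?_, fun d a => ?_⟩
  · conv_lhs => rw [← h1 d, ← hφ.1, h2]
  · conv_lhs => rw [← h1 d, ← AlgEquiv.apply_symm_apply h a]
    change (φ⁻¹ : (Module.End F (Cyc F g n t))ˣ).1 (_ * ι (h (h⁻¹ a))) = _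
    rw [← hφ.2, h2]

/-- The group of bimodule automorphisms. -/
def bimod (c : Cyc F g n t) : Subgroup (Module.End F (Cyc F g n t))ˣ where
  carrier := {φ | IsSemi c 1 (φ : Module.End F (Cyc F g n t))}
  mul_mem' ha hb := by simpa using IsSemi.mul ha hb
  one_mem' := isSemi_one c
  inv_mem' h := by simpa using IsSemi.inv h

lemma eq_of_cyclic {c v : Cyc F g n t} (hv : IsCyclicVector c v) {h : L ≃ₐ[𝔣] L} {φ ψ : Module.End F (Cyc F g n t)}
    (hφ : IsSemi c h φ) (hψ : IsSemi c h ψ) (hvv : φ v = ψ v) : φ = ψ := by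
  have := hv (LinearMap.eqLocus φ ψ) hvv (fun d hd => ?_) (fun d hd a => ?_)
  · exact LinearMap.eqLocus_eq_top.1 this
  · rw [LinearMap.mem_eqLocus] at hd ⊢
    rw [hφ.1, hψ.1, hd]
  · rw [LinearMap.mem_eqLocus] at hd ⊢
    rw [hφ.2, hψ.2, hd]

/-- The vectors reached from `v` by central bimodule endomorphisms form a subspace stable under `c`
and `L`, since multiplication by `c` or by an element of `L` is itself a central bimodule
endomorphism. Cyclicity of `v` makes this subspace everything. -/
lemma exists_bimod_central {c v : Cyc F g n t} (hv : IsCyclicVector c v) (d : Cyc F g n t) :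
    ∃ φ : Module.End F (Cyc F g n t), IsSemi c 1 φ ∧ φ v = d ∧
      ∀ ψ : Module.End F (Cyc F g n t), IsSemi c 1 ψ → φ * ψ = ψ * φ := by
  let P : Submodule F (Cyc F g n t) :=
    { carrier := {d | ∃ φ : Module.End F (Cyc F g n t), IsSemi c 1 φ ∧ φ v = d ∧
        ∀ ψ : Module.End F (Cyc F g n t), IsSemi c 1 ψ → φ * ψ = ψ * φ}
      add_mem' := by
        rintro _ _ ⟨φ, hφ, rfl, h⟩ ⟨φ', hφ', rfl, h'⟩
        refine ⟨φ + φ', ⟨fun d => ?_, fun d a => ?_⟩, rfl, fun ψ hψ => by rw [add_mul, mul_add, h ψ hψ, h' ψ hψ]⟩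
        · simp [hφ.1, hφ'.1, mul_add]
        · simp [hφ.2, hφ'.2, add_mul]
      zero_mem' := ⟨0, ⟨fun d => by simp, fun d a => by simp⟩, rfl, fun ψ _ => by simp⟩
      smul_mem' := by
        rintro r _ ⟨φ, hφ, rfl, h⟩
        refine ⟨r • φ, ⟨fun d => ?_, fun d a => ?_⟩, rfl, fun ψ hψ => by
          rw [smul_mul_assoc, mul_smul_comm, h ψ hψ]⟩
        · simp [hφ.1]
        · simp [hφ.2] }
  have : P = ⊤ := by
    refine hv P ⟨1, isSemi_one c, rfl, fun ψ _ => by simp⟩ ?_ ?_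
    · rintro _ ⟨φ, hφ, rfl, h⟩
      refine ⟨LinearMap.mulLeft F c * φ, ⟨fun d => by simp [hφ.1], fun d a => by simp [hφ.2, mul_assoc]⟩, rfl,
        fun ψ hψ => ?_⟩
      have h1 : LinearMap.mulLeft F c * ψ = ψ * LinearMap.mulLeft F c := by ext d; simp [hψ.1]
      rw [mul_assoc, h ψ hψ, ← mul_assoc, h1, mul_assoc]
    · rintro _ ⟨φ, hφ, rfl, h⟩ a
      refine ⟨LinearMap.mulRight F (ι a) * φ, ⟨fun d => by simp [hφ.1, mul_assoc], fun d b => ?_⟩, rfl,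
        fun ψ hψ => ?_⟩
      · simp [hφ.2, mul_assoc, ← ι_mul, mul_comm]
      have h1 : LinearMap.mulRight F (ι a) * ψ = ψ * LinearMap.mulRight F (ι a) := by ext d; simp [hψ.2]
      rw [mul_assoc, h ψ hψ, ← mul_assoc, h1, mul_assoc]
  have h : d ∈ P := this ▸ Submodule.mem_top
  exact h

lemma bimod_comm {c v : Cyc F g n t} (hv : IsCyclicVector c v) {φ ψ : Module.End F (Cyc F g n t)}
    (hφ : IsSemi c 1 φ) (hψ : IsSemi c 1 ψ) : φ * ψ = ψ * φ := by
  obtain ⟨φ', hφ', h, hc⟩ := exists_bimod_central hv (φ v)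
  rw [← eq_of_cyclic hv hφ' hφ h]
  exact hc ψ hψ

/-- The bimodule endomorphism with `v ↦ v'` has an image containing the cyclic vector `v'`, so it is
surjective, hence bijective. -/
lemma exists_bimod {c v v' : Cyc F g n t} [FiniteDimensional F (Cyc F g n t)]
    (hv : IsCyclicVector c v) (hv' : IsCyclicVector c v') :
    ∃ e ∈ bimod c, (e : Module.End F (Cyc F g n t)) v = v' := by
  obtain ⟨φ, hφ, h, -⟩ := exists_bimod_central hv v'
  have hr : LinearMap.range φ = ⊤ := by
    refine hv' _ ⟨v, h⟩ ?_ ?_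
    · rintro _ ⟨d, rfl⟩; exact ⟨c * d, hφ.1 d⟩
    · rintro _ ⟨d, rfl⟩ a; exact ⟨d * ι a, hφ.2 d a⟩
  have hb : Function.Bijective φ := ⟨LinearMap.injective_iff_surjective.2 (LinearMap.range_eq_top.1 hr),
    LinearMap.range_eq_top.1 hr⟩
  obtain ⟨e, he⟩ := (Module.End.isUnit_iff φ).2 hb
  exact ⟨e, by rw [← he] at hφ; exact hφ, by rw [he, h]⟩

lemma IsFrobenius.isSemi {c : Cyc F g n t} {w : Module.End F (Cyc F g n t)} (h : IsFrobenius c w) : IsSemi c g w := h.2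

lemma IsFrobenius.pow_eq_one {c : Cyc F g n t} {w : Module.End F (Cyc F g n t)} (hg : g ^ n = 1) (h : IsFrobenius c w) :
    w ^ n = 1 := by
  obtain ⟨v, hv, hwv⟩ := h.1
  refine eq_of_cyclic hv (hg ▸ h.isSemi.pow n) (isSemi_one c) ?_
  have : ∀ k : ℕ, (w ^ k) v = v := by
    intro k
    induction k with
    | zero => rfl
    | succ k ih => rw [pow_succ, Module.End.mul_apply, hwv, ih]
  exact this n

/-- A Frobenius operator as a unit. -/
noncomputable def IsFrobenius.unit {c : Cyc F g n t} {w : Module.End F (Cyc F g n t)} (hg : g ^ n = 1)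
    (h : IsFrobenius c w) : (Module.End F (Cyc F g n t))ˣ :=
  Units.ofPowEqOne w n (h.pow_eq_one hg) (NeZero.ne n)

/-- Right multiplication by `s`. -/
noncomputable def mulS : (Module.End F (Cyc F g n t))ˣ where
  val := LinearMap.mulRight F S
  inv := LinearMap.mulRight F (sz (-1))
  val_inv := by ext d; simp [mul_assoc, ← sz_one, ← sz_add]
  inv_val := by ext d; simp [mul_assoc, ← sz_one, ← sz_add]

lemma isSemi_mulS (c : Cyc F g n t) : IsSemi c g⁻¹ ((mulS : (Module.End F (Cyc F g n t))ˣ) : Module.End F (Cyc F g n t)) := by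
  refine ⟨fun d => mul_assoc _ _ _, fun d a => ?_⟩
  change d * ι a * S = d * S * ι (g⁻¹ a)
  rw [mul_assoc, mul_assoc, S_mul_ι]
  congr 2
  exact (AlgEquiv.apply_symm_apply g a).symm ▸ rfl

lemma mulS_pow : ((mulS : (Module.End F (Cyc F g n t))ˣ) : Module.End F (Cyc F g n t)) ^ n = algebraMap F _ (t : F) := by
  have : ∀ (k : ℕ) d, (((mulS : (Module.End F (Cyc F g n t))ˣ) : Module.End F (Cyc F g n t)) ^ k) d = d * S ^ k := by
    intro k
    induction k with
    | zero => simp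
    | succ k ih =>
      intro d
      rw [pow_succ', Module.End.mul_apply, ih, pow_succ, ← mul_assoc]; rfl
  ext d
  rw [this, S_pow, Module.algebraMap_end_apply, Algebra.smul_def, Algebra.commutes]

/-- The operator defining the right module structure over another cyclic algebra, together with its
comparison to the operators obtained from arbitrary Frobenius operators. -/
theorem exists_action (G : DualBasis g n) (hn : n.Prime) {c : Cyc F g n t} {w₀ : Module.End F (Cyc F g n t)}
    (h₀ : IsFrobenius c w₀) {a m : ℕ} (ham : a * m % n = 1) :
    ∃ ρ : Module.End F (Cyc F g n t), IsSemi c (g ^ a) ρ ∧ ρ ^ n = algebraMap F _ (t : F) ∧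
      ∀ w, IsFrobenius c w → ∃ f ∈ bimod c, ∀ d, (f : Module.End F (Cyc F g n t)) (ρ d) =
        w ((w ^ a) ((f : Module.End F (Cyc F g n t)) d)) * S := by
  have hg := G.pow_eq_one
  have hfin := finite_of_dual G (A := F) (t := t)
  obtain ⟨v₀, hv₀, hwv₀⟩ := h₀.1
  set W := h₀.unit hg with hW
  have hWval : (W : Module.End F (Cyc F g n t)) = w₀ := rfl
  have hWn : W ^ n = 1 := Units.ext (by simpa [hWval] using h₀.pow_eq_one hg)
  have hE : ∀ x ∈ bimod c, ∀ y ∈ bimod c, x * y = y * x := fun x hx y hy => Units.ext (bimod_comm hv₀ hx hy)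
  have hw : ∀ x ∈ bimod c, W * x * W⁻¹ ∈ bimod c := fun x hx => by
    have h1 : IsSemi c g (W : Module.End F (Cyc F g n t)) := h₀.isSemi
    have := (h1.mul hx).mul h1.inv
    rwa [mul_one, mul_inv_cancel] at this
  have hw' : ∀ x ∈ bimod c, W⁻¹ * x * W ∈ bimod c := fun x hx => by
    have h1 : IsSemi c g (W : Module.End F (Cyc F g n t)) := h₀.isSemi
    have := (h1.inv.mul hx).mul h1
    rwa [mul_one, inv_mul_cancel] at this
  have hR : mulS * W ∈ bimod c := by
    have h1 : IsSemi c g (W : Module.End F (Cyc F g n t)) := h₀.isSemi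
    have := (isSemi_mulS c).mul h1
    rwa [inv_mul_cancel] at this
  have han : a.Coprime n := by
    rw [Nat.coprime_comm, Nat.Prime.coprime_iff_not_dvd hn]
    rintro ⟨x, rfl⟩
    rw [mul_assoc, Nat.mul_mod_right] at ham
    omega
  have hum : (W ^ a) ^ m = W := by
    rw [← pow_mul, ← Nat.div_add_mod (a * m) n, ham, pow_add, pow_mul, hWn, one_pow, one_mul, pow_one]
  -- Here `mulS * W` is the bimodule automorphism `Z`, and `Z * W ^ (n - 1)` is right multiplication
  -- by `s` itself; comparing the exponents `a` and `n - 1` gives the `n`-th power.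
  refine ⟨((mulS * W * W ^ a : (Module.End F (Cyc F g n t))ˣ) : Module.End F (Cyc F g n t)), ?_, ?_, ?_⟩
  · have h1 : IsSemi c g (W : Module.End F (Cyc F g n t)) := h₀.isSemi
    have h2 : IsSemi c 1 ((mulS * W : (Module.End F (Cyc F g n t))ˣ) : Module.End F (Cyc F g n t)) := hR
    have := h2.mul (h1.pow a)
    rwa [one_mul] at this
  · have h1 : (mulS * W * W ^ a) ^ n = (mulS * W * W ^ (n - 1)) ^ n := by
      refine mul_pow_pow_eq hE hw hn.one_lt hWn hR han ?_
      exact (Nat.coprime_self_sub_left hn.one_le).2 (Nat.coprime_one_left n)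
    have h2 : mulS * W * W ^ (n - 1) = mulS := by
      rw [mul_assoc, ← pow_succ', Nat.sub_add_cancel hn.one_le, hWn, mul_one]
    rw [← Units.val_pow_eq_pow_val, h1, h2, Units.val_pow_eq_pow_val, mulS_pow]
  · intro w hfw
    obtain ⟨v, hv, hwv⟩ := hfw.1
    obtain ⟨e, he, hev⟩ := exists_bimod hv₀ hv
    -- Both operators are `g`-semilinear and fix the cyclic vector `v`, so they agree.
    have hwe : ((e * W * e⁻¹ : (Module.End F (Cyc F g n t))ˣ) : Module.End F (Cyc F g n t)) = w := by
      have h1 : IsSemi c g (W : Module.End F (Cyc F g n t)) := h₀.isSemi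
      have h2 := ((show IsSemi c 1 (e : Module.End F (Cyc F g n t)) from he).mul h1).mul (IsSemi.inv he)
      rw [one_mul, inv_one, mul_one] at h2
      refine eq_of_cyclic hv h2 hfw.isSemi ?_
      rw [hwv, ← hev]
      have h3 : (e⁻¹ : (Module.End F (Cyc F g n t))ˣ).1 (e.1 v₀) = v₀ := by
        rw [← Module.End.mul_apply, Units.inv_mul, Module.End.one_apply]
      change e.1 (w₀ ((e⁻¹ : (Module.End F (Cyc F g n t))ˣ).1 (e.1 v₀))) = e.1 v₀
      rw [h3, hwv₀]
    obtain ⟨f, hf, hfe⟩ := exists_conj_eq hE hw hw' hR rfl hum he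
    refine ⟨f, hf, fun d => ?_⟩
    have h1 : f * (mulS * W * W ^ a) = mulS * (e * W * e⁻¹) * (e * W * e⁻¹) ^ a * f := by
      rw [conj_pow, ← hfe]; group
    have h2 := congrArg (fun φ : (Module.End F (Cyc F g n t))ˣ => (φ : Module.End F (Cyc F g n t)) d) h1
    simp only [Units.val_mul, Units.val_pow_eq_pow_val, Module.End.mul_apply] at h2
    have h3 : (e : Module.End F (Cyc F g n t)) * W * (e⁻¹ : (Module.End F (Cyc F g n t))ˣ) = w := hwe
    rw [h3] at h2
    simp only [Units.val_mul, Units.val_pow_eq_pow_val, Module.End.mul_apply]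
    have h4 := LinearMap.congr_fun h3 ((w ^ a) (f.1 d))
    rw [h2, ← h4]
    rfl

end Cyc

end Operators

/-! ### Lattices at the primes of `𝔣[t]` and their comparison with twisted Laurent polynomials. -/

section Lattice

variable {𝔣 L : Type*} [Field 𝔣] [Field L] [Algebra 𝔣 L] {g : L ≃ₐ[𝔣] L} {n : ℕ} [NeZero n]

namespace Cyc

section
variable {F : Type*} [Field F] [Algebra 𝔣 F]

/-- The elements with coordinates in a subring. -/
noncomputable def lat (G : DualBasis g n) (t : Fˣ) (R : Subalgebra 𝔣 F) : AddSubgroup (Cyc F g n t) where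
  carrier := {x | ∀ p, (basis G F t).repr x p ∈ R}
  add_mem' hx hy p := by rw [map_add]; exact add_mem (hx p) (hy p)
  zero_mem' p := by rw [map_zero]; exact zero_mem R
  neg_mem' hx p := by rw [map_neg]; exact neg_mem (hx p)

variable (G : DualBasis g n) {t : Fˣ} {R : Subalgebra 𝔣 F}

lemma lat_smul {r : F} (hr : r ∈ R) {x : Cyc F g n t} (hx : x ∈ lat G t R) : r • x ∈ lat G t R := fun p => by
  rw [map_smul]; exact mul_mem hr (hx p)

lemma lat_of_smul {r : F} (h0 : r ≠ 0) (hr : r⁻¹ ∈ R) {x : Cyc F g n t} (hx : r • x ∈ lat G t R) : x ∈ lat G t R := by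
  have := lat_smul G hr hx
  rwa [smul_smul, inv_mul_cancel₀ h0, one_smul] at this

lemma mem_lat_iff_range {t : Rˣ} {x : Cyc F g n (Units.map (R.val : R →* F) t)} :
    x ∈ lat G _ R ↔ x ∈ (bc (t := t) (g := g) (n := n) R.val).range := by
  rw [mem_range_bc_iff R.val G, Subalgebra.range_val]; rfl

lemma exists_units_map (ht : (t : F) ∈ R) (ht' : ((t⁻¹ : Fˣ) : F) ∈ R) : ∃ u : Rˣ, t = Units.map (R.val : R →* F) u :=
  ⟨⟨⟨t, ht⟩, ⟨_, ht'⟩, Subtype.ext (by simp), Subtype.ext (by simp)⟩, Units.ext rfl⟩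

lemma lat_mul (ht : (t : F) ∈ R) (ht' : ((t⁻¹ : Fˣ) : F) ∈ R) {x y : Cyc F g n t} (hx : x ∈ lat G t R)
    (hy : y ∈ lat G t R) : x * y ∈ lat G t R := by
  obtain ⟨t, rfl⟩ := exists_units_map ht ht'
  rw [mem_lat_iff_range] at *
  exact mul_mem hx hy

lemma lat_ι (ht : (t : F) ∈ R) (ht' : ((t⁻¹ : Fˣ) : F) ∈ R) (a : L) : (ι a : Cyc F g n t) ∈ lat G t R := by
  obtain ⟨t, rfl⟩ := exists_units_map ht ht'
  rw [mem_lat_iff_range]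
  exact ⟨ι a, bc_ι _ _⟩

lemma lat_sz (ht : (t : F) ∈ R) (ht' : ((t⁻¹ : Fˣ) : F) ∈ R) (k : ℤ) : (sz k : Cyc F g n t) ∈ lat G t R := by
  obtain ⟨t, rfl⟩ := exists_units_map ht ht'
  rw [mem_lat_iff_range]
  exact ⟨sz k, bc_sz _ _⟩

lemma lat_S (ht : (t : F) ∈ R) (ht' : ((t⁻¹ : Fˣ) : F) ∈ R) : (S : Cyc F g n t) ∈ lat G t R := by
  rw [← sz_one]; exact lat_sz G ht ht' 1

lemma lat_S_pow (ht : (t : F) ∈ R) (ht' : ((t⁻¹ : Fˣ) : F) ∈ R) (k : ℕ) : (S ^ k : Cyc F g n t) ∈ lat G t R := by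
  rw [← sz_natCast]; exact lat_sz G ht ht' k

lemma exists_isFrobenius_lat (hn : n.Prime) (ht : (t : F) ∈ R) (ht' : ((t⁻¹ : Fˣ) : F) ∈ R)
    (hdvr : IsDiscreteValuationRing R) (hfrac : IsFractionRing R F)
    (hD : IsDomain (Cyc F g n t)) {c : Cyc F g n t} (hc : c ∉ (algebraMap F _).range) :
    ∃ w, IsFrobenius c w ∧ ∀ d ∈ lat G t R, w d ∈ lat G t R := by
  obtain ⟨t, rfl⟩ := exists_units_map ht ht'
  obtain ⟨w, hw, h⟩ := exists_isFrobenius (O := R) (t := t) G hn hD hc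
  refine ⟨w, hw, fun d hd => ?_⟩
  rw [mem_lat_iff_range] at *
  exact h d hd

end

section Place

open IsDedekindDomain

/-- The local ring of a prime of `𝔣[X]`. -/
noncomputable def placeRing (v : HeightOneSpectrum (Polynomial 𝔣)) : Subalgebra 𝔣 (RatFunc 𝔣) :=
  (Localization.subalgebra.ofField (RatFunc 𝔣) v.asIdeal.primeCompl
    v.asIdeal.primeCompl_le_nonZeroDivisors).restrictScalars 𝔣

lemma mem_placeRing {v : HeightOneSpectrum (Polynomial 𝔣)} {x : RatFunc 𝔣} :
    x ∈ placeRing v ↔ ∃ a s : Polynomial 𝔣, s ∉ v.asIdeal ∧ x = algebraMap _ _ a * (algebraMap _ _ s)⁻¹ := by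
  constructor
  · rintro ⟨a, s, hs, h⟩; exact ⟨a, s, hs, h⟩
  · rintro ⟨a, s, hs, h⟩; exact ⟨a, s, hs, h⟩

instance (v : HeightOneSpectrum (Polynomial 𝔣)) : IsFractionRing (placeRing v) (RatFunc 𝔣) :=
  inferInstanceAs (IsFractionRing (Localization.subalgebra.ofField (RatFunc 𝔣) v.asIdeal.primeCompl
    v.asIdeal.primeCompl_le_nonZeroDivisors) (RatFunc 𝔣))

instance (v : HeightOneSpectrum (Polynomial 𝔣)) : IsDiscreteValuationRing (placeRing v) :=
  IsLocalization.AtPrime.isDiscreteValuationRing_of_dedekind_domain (Polynomial 𝔣) v.ne_bot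
    (Localization.subalgebra.ofField (RatFunc 𝔣) v.asIdeal.primeCompl v.asIdeal.primeCompl_le_nonZeroDivisors)

lemma algebraMap_mem_placeRing (v : HeightOneSpectrum (Polynomial 𝔣)) (p : Polynomial 𝔣) :
    algebraMap _ (RatFunc 𝔣) p ∈ placeRing v :=
  mem_placeRing.2 ⟨p, 1, fun h => v.isPrime.ne_top ((Ideal.eq_top_iff_one _).2 h), by simp⟩

lemma inv_mem_placeRing {v : HeightOneSpectrum (Polynomial 𝔣)} {p : Polynomial 𝔣} (hp : p ∉ v.asIdeal) :
    (algebraMap _ (RatFunc 𝔣) p)⁻¹ ∈ placeRing v :=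
  mem_placeRing.2 ⟨1, p, hp, by simp⟩

lemma ratX_mem (v : HeightOneSpectrum (Polynomial 𝔣)) : (ratX 𝔣 : RatFunc 𝔣) ∈ placeRing v := by
  rw [Units.val_mk0, ← RatFunc.algebraMap_X]; exact algebraMap_mem_placeRing v _

lemma ratX_inv_mem {v : HeightOneSpectrum (Polynomial 𝔣)} (hv : Polynomial.X ∉ v.asIdeal) :
    (((ratX 𝔣)⁻¹ : (RatFunc 𝔣)ˣ) : RatFunc 𝔣) ∈ placeRing v := by
  rw [Units.val_inv_eq_inv_val, Units.val_mk0, ← RatFunc.algebraMap_X]; exact inv_mem_placeRing hv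

/-- A rational function integral outside of `X` is a Laurent polynomial. -/
lemma exists_X_pow_mul {r : RatFunc 𝔣} (h : ∀ v : HeightOneSpectrum (Polynomial 𝔣), Polynomial.X ∉ v.asIdeal → r ∈ placeRing v) :
    ∃ k : ℕ, RatFunc.X ^ k * r ∈ (algebraMap (Polynomial 𝔣) (RatFunc 𝔣)).range := by
  let I : Ideal (Polynomial 𝔣) :=
    { carrier := {p | algebraMap _ (RatFunc 𝔣) p * r ∈ (algebraMap (Polynomial 𝔣) (RatFunc 𝔣)).range}
      add_mem' := fun {a b} ha hb => by
        change algebraMap _ _ (a + b) * r ∈ (algebraMap (Polynomial 𝔣) (RatFunc 𝔣)).range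
        rw [map_add, add_mul]; exact add_mem ha hb
      zero_mem' := by change algebraMap (Polynomial 𝔣) _ 0 * r ∈ (algebraMap (Polynomial 𝔣) (RatFunc 𝔣)).range; simp
      smul_mem' := fun a b hb => by
        change algebraMap _ _ (a * b) * r ∈ (algebraMap (Polynomial 𝔣) (RatFunc 𝔣)).range
        rw [map_mul, mul_assoc]; exact mul_mem ⟨a, rfl⟩ hb }
  -- A prime containing the denominator ideal `I` but not `X` would be a place where `r` is
  -- integral, and a denominator prime to it would lie in `I`.
  have hX : (Polynomial.X : Polynomial 𝔣) ∈ I.radical := by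
    rw [Ideal.radical_eq_sInf, Ideal.mem_sInf]
    rintro P ⟨hIP, hP⟩
    by_contra hXP
    have hI : I ≠ ⊥ := by
      obtain ⟨a, s, hs, e⟩ := IsFractionRing.div_surjective (A := Polynomial 𝔣) r
      refine Submodule.ne_bot_iff _ |>.2 ⟨s, ⟨a, ?_⟩, nonZeroDivisors.ne_zero hs⟩
      have h0 : algebraMap (Polynomial 𝔣) (RatFunc 𝔣) s ≠ 0 := IsFractionRing.to_map_ne_zero_of_mem_nonZeroDivisors hs
      rw [← e, mul_div_cancel₀ _ h0]
    have hPb : P ≠ ⊥ := fun h => hI (le_bot_iff.1 (h ▸ hIP))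
    obtain ⟨a, s, hs, hr⟩ := mem_placeRing.1 (h ⟨P, hP, hPb⟩ hXP)
    refine hs (hIP ⟨a, ?_⟩)
    have hs0 : algebraMap (Polynomial 𝔣) (RatFunc 𝔣) s ≠ 0 := by
      rw [Ne, map_eq_zero_iff _ (IsFractionRing.injective _ _)]
      rintro rfl
      exact hs P.zero_mem
    rw [hr]
    field_simp
  obtain ⟨k, hk⟩ := hX
  refine ⟨k, ?_⟩
  have : algebraMap _ (RatFunc 𝔣) (Polynomial.X ^ k) * r ∈ (algebraMap (Polynomial 𝔣) (RatFunc 𝔣)).range := hk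
  rwa [map_pow, RatFunc.algebraMap_X] at this

lemma S_pow_mul_n {A : Type*} [CommRing A] [Algebra 𝔣 A] {t : Aˣ} (k : ℕ) (x : Cyc A g n t) :
    x * S ^ (n * k) = (t : A) ^ k • x := by
  rw [pow_mul, S_pow, ← map_pow, ← Algebra.commutes, Algebra.smul_def]

lemma exists_mem_skewPoly (G : DualBasis g n) {x : Cyc (RatFunc 𝔣) g n (ratX 𝔣)}
    (h : ∀ v : HeightOneSpectrum (Polynomial 𝔣), Polynomial.X ∉ v.asIdeal → x ∈ lat G _ (placeRing v)) :
    IsLaurent x := by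
  choose k hk using fun p => exists_X_pow_mul (r := (basis G _ _).repr x p) fun v hv => h v hv p
  obtain ⟨m, hm⟩ := exists_skewPoly_of_repr G (x := x * S ^ (n * ∑ p, k p)) (fun p => by
    have h1 : ∑ q, k q = (∑ q ∈ Finset.univ.erase p, k q) + k p := (Finset.sum_erase_add _ _ (Finset.mem_univ p)).symm
    rw [S_pow_mul_n, map_smul, Finsupp.smul_apply, smul_eq_mul, Units.val_mk0, h1, pow_add, mul_assoc,
      ← RatFunc.algebraMap_X, ← map_pow]
    refine mul_mem ⟨_, rfl⟩ ?_
    rw [RatFunc.algebraMap_X]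
    exact hk p)
  exact ⟨_, m, hm⟩

lemma IsLaurent.mem_lat (G : DualBasis g n) {x : Cyc (RatFunc 𝔣) g n (ratX 𝔣)} (hx : IsLaurent x)
    {v : HeightOneSpectrum (Polynomial 𝔣)} (hv : Polynomial.X ∉ v.asIdeal) : x ∈ lat G _ (placeRing v) := by
  have h1 := ratX_mem v
  have h2 := ratX_inv_mem hv
  obtain ⟨k, m, hm⟩ := hx
  have h3 : x * S ^ k ∈ lat G _ (placeRing v) := by
    refine (AddSubgroup.closure_le (K := lat G _ (placeRing v))).2 ?_ hm
    rintro _ ⟨a, i, -, rfl⟩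
    exact lat_mul G h1 h2 (lat_ι G h1 h2 a) (lat_S_pow G h1 h2 i)
  have h4 := lat_mul G h1 h2 h3 (lat_sz G h1 h2 (-k))
  rwa [← sz_natCast, mul_assoc, sz_mul_neg, mul_one] at h4

/-- Linear maps have bounded denominators. -/
lemma exists_smul_map_mem {g' : L ≃ₐ[𝔣] L} (G : DualBasis g n) (G' : DualBasis g' n)
    (T : Cyc (RatFunc 𝔣) g n (ratX 𝔣) →ₗ[RatFunc 𝔣] Cyc (RatFunc 𝔣) g' n (ratX 𝔣)) :
    ∃ h : Polynomial 𝔣, h ≠ 0 ∧ ∀ v, ∀ x ∈ lat G _ (placeRing v), algebraMap _ (RatFunc 𝔣) h • T x ∈ lat G' _ (placeRing v) := by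
  classical
  let B := basis G (RatFunc 𝔣) (ratX 𝔣)
  let B' := basis G' (RatFunc 𝔣) (ratX 𝔣)
  obtain ⟨b, hb⟩ := IsLocalization.exist_integer_multiples_of_finset (nonZeroDivisors (Polynomial 𝔣))
    ((Finset.univ ×ˢ Finset.univ).image fun p : (Σ _ : Fin n, Fin n) × (Σ _ : Fin n, Fin n) => B'.repr (T (B p.1)) p.2)
  refine ⟨b, nonZeroDivisors.ne_zero b.2, fun v x hx q => ?_⟩
  rw [← B.sum_repr x]
  simp only [map_sum, map_smul, Finset.smul_sum, Finsupp.finsetSum_apply, Finsupp.smul_apply, smul_eq_mul]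
  refine sum_mem fun p _ => ?_
  obtain ⟨y, hy⟩ := hb _ (Finset.mem_image.2 ⟨(p, q), by simp, rfl⟩)
  rw [mul_left_comm, ← Algebra.smul_def, ← hy]
  exact mul_mem (hx p) (algebraMap_mem_placeRing v y)

lemma exists_smul_mem (G : DualBasis g n) (x : Cyc (RatFunc 𝔣) g n (ratX 𝔣)) :
    ∃ h : Polynomial 𝔣, h ≠ 0 ∧ ∀ v, algebraMap _ (RatFunc 𝔣) h • x ∈ lat G _ (placeRing v) := by
  classical
  let B := basis G (RatFunc 𝔣) (ratX 𝔣)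
  obtain ⟨b, hb⟩ := IsLocalization.exist_integer_multiples_of_finset (nonZeroDivisors (Polynomial 𝔣))
    (Finset.univ.image fun p => B.repr x p)
  refine ⟨b, nonZeroDivisors.ne_zero b.2, fun v p => ?_⟩
  obtain ⟨y, hy⟩ := hb _ (Finset.mem_image_of_mem _ (Finset.mem_univ p))
  rw [map_smul, Finsupp.smul_apply, smul_eq_mul, ← Algebra.smul_def, ← hy]
  exact algebraMap_mem_placeRing v y

end Place

end Cyc

end Lattice

/-! ### The right action of the second cyclic algebra and the gluing of local lattices. -/

section Global

variable {𝔣 L : Type*} [Field 𝔣] [Field L] [Algebra 𝔣 L] {g g' : L ≃ₐ[𝔣] L} {n : ℕ} [NeZero n]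

namespace Cyc

section Action
variable {F : Type*} [Field F] [Algebra 𝔣 F] {t : Fˣ}

/-- The right action of another cyclic algebra defined by a semilinear operator. -/
noncomputable def act {c : Cyc F g n t} {h : L ≃ₐ[𝔣] L} {ρ : Module.End F (Cyc F g n t)} (hρ : IsSemi c h ρ)
    (hh : h * g' = 1) (hn : ρ ^ n = algebraMap F _ (t : F)) : Cyc F g' n t →ₐ[F] (Module.End F (Cyc F g n t))ᵐᵒᵖ :=
  lift (B := (Module.End F (Cyc F g n t))ᵐᵒᵖ)
    { toFun a := MulOpposite.op (LinearMap.mulRight F (ι a))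
      map_one' := by rw [ι_one]; congr 1; ext; simp
      map_mul' a b := by
        rw [← MulOpposite.op_mul]; congr 1; ext; simp [mul_assoc, ← ι_mul, mul_comm]
      map_zero' := by rw [ι_zero]; congr 1; ext; simp
      map_add' a b := by rw [ι_add, ← MulOpposite.op_add]; congr 1; ext; simp [mul_add] }
    (MulOpposite.op ρ)
    (by
      intro r
      change MulOpposite.op (LinearMap.mulRight F (ι _)) = MulOpposite.op (algebraMap F (Module.End F (Cyc F g n t)) (algebraMap 𝔣 F r))
      congr 1
      ext d
      rw [ι_algebraMap, LinearMap.mulRight_apply, ← Algebra.commutes, ← Algebra.smul_def]; rfl)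
    (by
      intro a
      change MulOpposite.op (LinearMap.mulRight F (ι a) * ρ) = MulOpposite.op (ρ * LinearMap.mulRight F (ι (g' a)))
      congr 1
      ext d
      simp only [Module.End.mul_apply, LinearMap.mulRight_apply]
      rw [hρ.2, ← AlgEquiv.mul_apply, hh, AlgEquiv.one_apply])
    (by
      change MulOpposite.op (ρ ^ n) = MulOpposite.op (algebraMap F (Module.End F (Cyc F g n t)) (t : F))
      rw [hn])

variable {c : Cyc F g n t} {h : L ≃ₐ[𝔣] L} {ρ : Module.End F (Cyc F g n t)} (hρ : IsSemi c h ρ)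
    (hh : h * g' = 1) (hn : ρ ^ n = algebraMap F _ (t : F))

/-- The action as a linear map in the acting element. -/
noncomputable def actOn (x : Cyc F g n t) : Cyc F g' n t →ₗ[F] Cyc F g n t where
  toFun d := (act hρ hh hn d).unop x
  map_add' a b := by rw [map_add]; rfl
  map_smul' r a := by rw [map_smul]; rfl

lemma actOn_one (x : Cyc F g n t) : actOn hρ hh hn x 1 = x := by
  change (act hρ hh hn 1).unop x = x
  rw [map_one]; rfl

lemma actOn_mul (x : Cyc F g n t) (a b : Cyc F g' n t) :
    actOn hρ hh hn x (a * b) = actOn hρ hh hn (actOn hρ hh hn x a) b := by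
  change (act hρ hh hn (a * b)).unop x = _
  rw [map_mul]; rfl

lemma actOn_ι (x : Cyc F g n t) (a : L) : actOn hρ hh hn x (ι a) = x * ι a := by
  change (act hρ hh hn (ι a)).unop x = _
  rw [act, lift_ι]; rfl

lemma actOn_S (x : Cyc F g n t) : actOn hρ hh hn x S = ρ x := by
  change (act hρ hh hn S).unop x = _
  rw [act, lift_S]; rfl

lemma actOn_mul_left (x : Cyc F g n t) (d : Cyc F g' n t) : actOn hρ hh hn (c * x) d = c * actOn hρ hh hn x d := by
  let T : Subalgebra F (Cyc F g' n t) :=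
    { carrier := {d | ∀ x, actOn hρ hh hn (c * x) d = c * actOn hρ hh hn x d}
      mul_mem' := fun {a b} ha hb x => by rw [actOn_mul, actOn_mul, ha, hb]
      add_mem' := fun {a b} ha hb x => by rw [map_add, map_add, ha, hb, mul_add]
      algebraMap_mem' := fun r x => by
        rw [Algebra.algebraMap_eq_smul_one, map_smul, map_smul, actOn_one, actOn_one, mul_smul_comm] }
  have hT : T = ⊤ := eq_top_of_mem (fun a x => by rw [actOn_ι, actOn_ι, mul_assoc])
    (fun x => by rw [actOn_S, actOn_S, hρ.1])
  have : d ∈ T := hT ▸ Algebra.mem_top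
  exact this x

/-- Orbit maps of a right module over a division algebra are injective at nonzero vectors, and here
the dimensions are equal. -/
lemma actOn_bijective (G : DualBasis g n) (G' : DualBasis g' n) (hD : IsDomain (Cyc F g' n t)) {x : Cyc F g n t} (hx : x ≠ 0) :
    Function.Bijective (actOn hρ hh hn x) := by
  have hfin := finite_of_dual G (A := F) (t := t)
  have hfin' := finite_of_dual G' (A := F) (t := t)
  have hinj : Function.Injective (actOn hρ hh hn x) := by
    rw [injective_iff_map_eq_zero]
    intro d hd
    by_contra h0
    obtain ⟨e, he⟩ := (FiniteDimensional.isUnit F h0).exists_right_inv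
    apply hx
    rw [← actOn_one hρ hh hn x, ← he, actOn_mul, hd]
    exact map_zero (act hρ hh hn e).unop
  exact ⟨hinj, (LinearMap.injective_iff_surjective_of_finrank_eq_finrank
    (by rw [finrank_eq G, finrank_eq G'])).1 hinj⟩

lemma act_induction (P : AddSubgroup (Cyc F g n t)) {x : Cyc F g n t} (hx : x ∈ P) (hι : ∀ y ∈ P, ∀ a : L, y * ι a ∈ P)
    (hS : ∀ y ∈ P, ρ y ∈ P) (G' : DualBasis g' n) {R : Subalgebra 𝔣 F} (hR : ∀ r ∈ R, ∀ y ∈ P, r • y ∈ P)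
    {d : Cyc F g' n t} (hd : d ∈ lat G' t R) : actOn hρ hh hn x d ∈ P := by
  rw [← (basis G' F t).sum_repr d, map_sum]
  refine sum_mem fun p _ => ?_
  rw [map_smul]
  refine hR _ (hd p) _ ?_
  rw [basis_apply, actOn_mul, actOn_ι]
  refine hι _ ?_ _
  have : ∀ k : ℕ, actOn hρ hh hn x (S ^ k) ∈ P := by
    intro k
    induction k with
    | zero => rwa [pow_zero, actOn_one]
    | succ k ih => rw [pow_succ, actOn_mul, actOn_S]; exact hS _ ih
  exact this _

end Action

open IsDedekindDomain

lemma exists_ne_zero_forall {α : Type*} {s : Set α} (hs : s.Finite) {M : α → Polynomial 𝔣 → Prop}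
    (h : ∀ v ∈ s, ∃ p, p ≠ 0 ∧ M v p) (hM : ∀ v p q, M v p → M v (q * p)) : ∃ p : Polynomial 𝔣, p ≠ 0 ∧ ∀ v ∈ s, M v p := by
  induction s, hs using Set.Finite.induction_on with
  | empty => exact ⟨1, one_ne_zero, by simp⟩
  | @insert a s _ _ ih =>
    obtain ⟨p, hp, hps⟩ := ih fun v hv => h v (Set.mem_insert_of_mem _ hv)
    obtain ⟨q, hq, hqa⟩ := h a (Set.mem_insert _ _)
    refine ⟨p * q, mul_ne_zero hp hq, fun v hv => ?_⟩
    rcases hv with rfl | hv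
    · exact hM _ _ _ hqa
    · rw [mul_comm]; exact hM _ _ _ (hps v hv)

lemma finite_setOf_mem {p : Polynomial 𝔣} (hp : p ≠ 0) : {v : HeightOneSpectrum (Polynomial 𝔣) | p ∈ v.asIdeal}.Finite := by
  have h : Ideal.span {p} ≠ 0 := by simpa using hp
  refine (Ideal.finite_factors h).subset fun v hv => ?_
  rw [Set.mem_setOf_eq, Ideal.dvd_iff_le, Ideal.span_singleton_le_iff_mem]
  exact hv

open Polynomial in
lemma exists_heightOneSpectrum (𝔣 : Type*) [Field 𝔣] : ∃ v : HeightOneSpectrum 𝔣[X], X ∉ v.asIdeal := by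
  have hirr : Irreducible (X - C (1 : 𝔣)) := irreducible_X_sub_C 1
  refine ⟨⟨Ideal.span {X - C (1 : 𝔣)}, (Ideal.span_singleton_prime hirr.ne_zero).2 hirr.prime,
    by simpa using hirr.ne_zero⟩, fun h => ?_⟩
  rw [Ideal.mem_span_singleton, dvd_iff_isRoot] at h
  simp at h

/-- A nonzero polynomial is, up to factors which are units at the other primes, prime to `v`. -/
lemma exists_eq_mul_of_prime (v : HeightOneSpectrum (Polynomial 𝔣)) {H : Polynomial 𝔣} (hH : H ≠ 0) :
    ∃ h q, H = q * h ∧ h ∉ v.asIdeal ∧ ∀ v' : HeightOneSpectrum (Polynomial 𝔣), v' ≠ v → q ∉ v'.asIdeal := by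
  obtain ⟨π, hπ⟩ := IsPrincipalIdealRing.principal v.asIdeal
  have hπ' : v.asIdeal = Ideal.span {π} := hπ
  have hπu : ¬ IsUnit π := fun h => v.isPrime.ne_top (by rw [hπ', Ideal.span_singleton_eq_top]; exact h)
  obtain ⟨h, hh⟩ := (FiniteMultiplicity.of_not_isUnit hπu hH).exists_eq_pow_mul_and_not_dvd
  refine ⟨h, _, hh.1, fun hv => hh.2 (by rwa [hπ', Ideal.mem_span_singleton] at hv), fun v' hv' hq => hv' ?_⟩
  have h1 : π ∈ v'.asIdeal := v'.isPrime.mem_of_pow_mem _ hq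
  have h2 : v.asIdeal ≤ v'.asIdeal := by rwa [hπ', Ideal.span_singleton_le_iff_mem]
  exact HeightOneSpectrum.ext (v.isMaximal.eq_of_le v'.isPrime.ne_top h2).symm

/-- The main existence theorem: there is an element `c'` of the second algebra such that at every prime other
than `X` there is an isomorphism of bimodules respecting the lattices. -/
theorem exists_global (G : DualBasis g n) (G' : DualBasis g' n) (hn : n.Prime) {a m : ℕ} (ham : a * m % n = 1)
    (hgg' : g ^ a * g' = 1) {c : Cyc (RatFunc 𝔣) g n (ratX 𝔣)} (hc : c ∉ (algebraMap (RatFunc 𝔣) _).range) :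
    ∃ c' : Cyc (RatFunc 𝔣) g' n (ratX 𝔣), ∀ v : HeightOneSpectrum (Polynomial 𝔣), Polynomial.X ∉ v.asIdeal →
      ∃ ψ : Cyc (RatFunc 𝔣) g' n (ratX 𝔣) ≃ₗ[RatFunc 𝔣] Cyc (RatFunc 𝔣) g n (ratX 𝔣),
        (∀ d, ψ (c' * d) = c * ψ d) ∧ (∀ d (x : L), ψ (d * ι x) = ψ d * ι x) ∧
        ∀ d, d ∈ lat G' _ (placeRing v) ↔ ψ d ∈ lat G _ (placeRing v) := by
  classical
  have hD := isDomain_ratFunc G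
  have hD' := isDomain_ratFunc G'
  have hloc : ∀ v : HeightOneSpectrum (Polynomial 𝔣), Polynomial.X ∉ v.asIdeal →
      ∃ w, IsFrobenius c w ∧ ∀ d ∈ lat G _ (placeRing v), w d ∈ lat G _ (placeRing v) := fun v hv =>
    exists_isFrobenius_lat G hn (ratX_mem v) (ratX_inv_mem hv) inferInstance inferInstance hD hc
  obtain ⟨v₁, hv₁⟩ := exists_heightOneSpectrum 𝔣
  obtain ⟨w₀, hw₀, -⟩ := hloc v₁ hv₁
  obtain ⟨ρ, hρ, hρn, hconj⟩ := exists_action G hn hw₀ ham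
  -- Away from the finitely many primes dividing `hden` the operator `ρ` already preserves the
  -- lattice and no correction is needed; this finiteness bounds the denominators below.
  obtain ⟨hden, hden0, hdenρ⟩ := exists_smul_map_mem G G ρ
  -- the local comparison operators
  have hf : ∀ v : HeightOneSpectrum (Polynomial 𝔣), ∃ f ∈ bimod c, (hden ∉ v.asIdeal → f = 1) ∧
      (Polynomial.X ∉ v.asIdeal → ∀ x, (f : Module.End (RatFunc 𝔣) (Cyc (RatFunc 𝔣) g n (ratX 𝔣))) x ∈ lat G _ (placeRing v) →
        (f : Module.End (RatFunc 𝔣) (Cyc (RatFunc 𝔣) g n (ratX 𝔣))) (ρ x) ∈ lat G _ (placeRing v)) := by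
    intro v
    by_cases hXv : Polynomial.X ∈ v.asIdeal
    · exact ⟨1, one_mem _, fun _ => rfl, fun h => absurd hXv h⟩
    by_cases hv : hden ∈ v.asIdeal
    · obtain ⟨w, hw, hwl⟩ := hloc v hXv
      obtain ⟨f, hf, hfρ⟩ := hconj w hw
      refine ⟨f, hf, fun h => absurd hv h, fun _ x hx => ?_⟩
      rw [hfρ]
      refine lat_mul G (ratX_mem v) (ratX_inv_mem hXv) (hwl _ ?_) (lat_S G (ratX_mem v) (ratX_inv_mem hXv))
      generalize (f : Module.End (RatFunc 𝔣) (Cyc (RatFunc 𝔣) g n (ratX 𝔣))) x = y at hx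
      clear hfρ ham hgg' hρ hconj
      induction a with
      | zero => exact hx
      | succ a ih => rw [pow_succ', Module.End.mul_apply]; exact hwl _ ih
    · refine ⟨1, one_mem _, fun _ => rfl, fun _ x hx => ?_⟩
      refine lat_of_smul G ?_ (inv_mem_placeRing hv) (hdenρ v x hx)
      rw [Ne, map_eq_zero_iff _ (IsFractionRing.injective _ _)]
      exact hden0
  choose f hfb hf1 hfρ using hf
  have hS := finite_setOf_mem hden0
  have hbound : ∀ φ : HeightOneSpectrum (Polynomial 𝔣) → Module.End (RatFunc 𝔣) (Cyc (RatFunc 𝔣) g n (ratX 𝔣)),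
      (∀ v, hden ∉ v.asIdeal → φ v = 1) → ∃ p : Polynomial 𝔣, p ≠ 0 ∧ ∀ v, ∀ x ∈ lat G _ (placeRing v),
        algebraMap _ (RatFunc 𝔣) p • φ v x ∈ lat G _ (placeRing v) := by
    intro φ hφ
    obtain ⟨p, hp, h⟩ := exists_ne_zero_forall (M := fun v p => ∀ x ∈ lat G _ (placeRing v),
        algebraMap _ (RatFunc 𝔣) p • φ v x ∈ lat G _ (placeRing v)) hS
      (fun v _ => by
        obtain ⟨p, hp, h⟩ := exists_smul_map_mem G G (φ v)
        exact ⟨p, hp, h v⟩)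
      (fun v p q h x hx => by
        rw [map_mul, mul_smul]; exact lat_smul G (algebraMap_mem_placeRing v q) (h x hx))
    refine ⟨p, hp, fun v x hx => ?_⟩
    by_cases hv : hden ∈ v.asIdeal
    · exact h v hv x hx
    · rw [hφ v hv]; exact lat_smul G (algebraMap_mem_placeRing v p) hx
  obtain ⟨p₁, hp₁, hbf⟩ := hbound (fun v => (f v).1) (fun v hv => by rw [hf1 v hv]; rfl)
  obtain ⟨p₂, hp₂, hbf'⟩ := hbound (fun v => (f v)⁻¹.1) (fun v hv => by rw [hf1 v hv]; simp)
  have hinv : ∀ v x, ((f v)⁻¹ : (Module.End (RatFunc 𝔣) (Cyc (RatFunc 𝔣) g n (ratX 𝔣)))ˣ).1 ((f v).1 x) = x := fun v x => by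
    rw [← Module.End.mul_apply, Units.inv_mul, Module.End.one_apply]
  have hC0 : ∀ {p : Polynomial 𝔣}, p ≠ 0 → algebraMap _ (RatFunc 𝔣) p ≠ 0 := fun h h' =>
    h ((map_eq_zero_iff _ (IsFractionRing.injective _ _)).1 h')
  -- the global module
  let J : AddSubgroup (Cyc (RatFunc 𝔣) g n (ratX 𝔣)) :=
    { carrier := {x | ∀ v : HeightOneSpectrum (Polynomial 𝔣), Polynomial.X ∉ v.asIdeal → (f v).1 x ∈ lat G _ (placeRing v)}
      add_mem' := fun hx hy v hv => by rw [map_add]; exact add_mem (hx v hv) (hy v hv)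
      zero_mem' := fun v hv => by rw [map_zero]; exact zero_mem _
      neg_mem' := fun hx v hv => by rw [map_neg]; exact neg_mem (hx v hv) }
  have hJden : ∀ x, ∃ H : Polynomial 𝔣, H ≠ 0 ∧ ∀ v, (f v).1 (algebraMap _ (RatFunc 𝔣) H • x) ∈ lat G _ (placeRing v) := by
    intro x
    obtain ⟨q, hq, hqx⟩ := exists_smul_mem G x
    refine ⟨p₁ * q, mul_ne_zero hp₁ hq, fun v => ?_⟩
    rw [map_mul, mul_smul, map_smul]
    exact hbf v _ (hqx v)
  let Ω := actOn hρ hgg' hρn 1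
  have hΩ : Function.Bijective Ω := actOn_bijective hρ hgg' hρn G G' hD' one_ne_zero
  let Ωe := LinearEquiv.ofBijective Ω hΩ
  obtain ⟨p₃, hp₃, hΩinv⟩ := exists_smul_map_mem G G' Ωe.symm.toLinearMap
  -- Pulled back along `Ω : d ↦ 1 · d`, the module `J` is stable under right multiplication by `L`
  -- and `s` in the second algebra. The factors `p₂` and `p₃` clear the denominators of the inverses
  -- of the `f v` and of `Ω`.
  obtain ⟨y, hyJ, hy⟩ := exists_generator G' (J.comap Ω.toAddMonoidHom) (h := algebraMap _ (RatFunc 𝔣) (p₃ * p₂))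
    (by
      intro x hx b v hv
      change (f v).1 (Ω (x * ι b)) ∈ _
      have : Ω (x * ι b) = Ω x * ι b := by rw [actOn_mul, actOn_ι]
      rw [this, (hfb v).2]
      exact lat_mul G (ratX_mem v) (ratX_inv_mem hv) (hx v hv) (lat_ι G (ratX_mem v) (ratX_inv_mem hv) _))
    (by
      intro x hx v hv
      change (f v).1 (Ω (x * S)) ∈ _
      have : Ω (x * S) = ρ (Ω x) := by rw [actOn_mul, actOn_S]
      rw [this]
      exact hfρ v hv _ (hx v hv))
    (hC0 (mul_ne_zero hp₃ hp₂))
    (by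
      intro x hx
      refine exists_mem_skewPoly G' fun v hv => ?_
      have h1 := hbf' v _ (hx v hv)
      have h2 := hΩinv v _ h1
      have h3 : ((f v)⁻¹ : (Module.End (RatFunc 𝔣) (Cyc (RatFunc 𝔣) g n (ratX 𝔣)))ˣ).1 ((f v).1 (Ω.toAddMonoidHom x)) = Ωe x := hinv v _
      rw [h3] at h2
      rw [map_mul, mul_smul]
      simpa using h2)
  have hy0 : y ≠ 0 := by
    rintro rfl
    obtain ⟨H, hH, hHJ⟩ := hJden 1
    obtain ⟨x, hx⟩ := hΩ.2 (algebraMap _ (RatFunc 𝔣) H • 1)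
    obtain ⟨r, -, hr⟩ := hy x (fun v hv => by
      change (f v).1 (Ω x) ∈ _
      rw [hx]; exact hHJ v)
    rw [hr, zero_mul, map_zero] at hx
    exact smul_ne_zero (hC0 hH) one_ne_zero hx.symm
  have hΩy0 : Ω y ≠ 0 := fun h => hy0 (hΩ.1 (by rw [h, map_zero]))
  let Ψ := LinearEquiv.ofBijective _ (actOn_bijective hρ hgg' hρn G G' hD' hΩy0)
  have hΨ : ∀ d, Ψ d = actOn hρ hgg' hρn (Ω y) d := fun _ => rfl
  have hΨΩ : ∀ d, Ψ d = Ω (y * d) := fun d => by rw [hΨ, actOn_mul]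
  -- The element `c'` records how `c` moves the generator `Ω y`; the local comparison is `Ψ`
  -- followed by `f v`.
  refine ⟨Ψ.symm (c * Ω y), fun v hv => ?_⟩
  have hfc : IsSemi c 1 (f v).1 := hfb v
  refine ⟨Ψ.trans (LinearMap.GeneralLinearGroup.generalLinearEquiv _ _ (f v)), fun d => ?_, fun d x => ?_, fun d => ⟨fun hd => ?_, fun hd => ?_⟩⟩
  · change (f v).1 (Ψ _) = c * (f v).1 (Ψ d)
    have h1 : actOn hρ hgg' hρn (Ω y) (Ψ.symm (c * Ω y)) = c * Ω y := Ψ.apply_symm_apply _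
    rw [← hfc.1, hΨ, hΨ, actOn_mul, h1, actOn_mul_left]
  · change (f v).1 (Ψ _) = (f v).1 (Ψ d) * ι x
    rw [hΨ, hΨ, actOn_mul, actOn_ι, hfc.2]; rfl
  · change (f v).1 (Ψ d) ∈ _
    let P : AddSubgroup (Cyc (RatFunc 𝔣) g n (ratX 𝔣)) := (lat G _ (placeRing v)).comap (f v).1.toAddMonoidHom
    refine act_induction hρ hgg' hρn P (hyJ v hv) ?_ ?_ G' (R := placeRing v) ?_ hd
    · intro z hz b
      change (f v).1 (z * ι b) ∈ lat G _ (placeRing v)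
      rw [hfc.2]
      exact lat_mul G (ratX_mem v) (ratX_inv_mem hv) hz (lat_ι G (ratX_mem v) (ratX_inv_mem hv) _)
    · intro z hz; exact hfρ v hv z hz
    · intro r hr z hz
      change (f v).1 (r • z) ∈ lat G _ (placeRing v)
      rw [map_smul]
      exact lat_smul G hr hz
  · change (f v).1 (Ψ d) ∈ _ at hd
    -- For the converse, `Ψ d` is integral only at `v`. A factor `h` prime to `v` makes it integral
    -- everywhere, so `h d` is a Laurent polynomial because `y` generates, and `h` is invertible at
    -- `v`.
    obtain ⟨H, hH, hHJ⟩ := hJden (Ψ d)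
    obtain ⟨h, q, hHq, hhv, hq⟩ := exists_eq_mul_of_prime v hH
    have hJ : algebraMap _ (RatFunc 𝔣) h • Ψ d ∈ J := by
      intro v' hv'
      rw [map_smul]
      by_cases hvv : v' = v
      · subst hvv
        exact lat_smul G (algebraMap_mem_placeRing _ h) hd
      · have h1 := hHJ v'
        rw [hHq, map_mul, mul_smul, map_smul, map_smul] at h1
        refine lat_of_smul G (hC0 ?_) (inv_mem_placeRing (hq v' hvv)) h1
        rintro rfl
        exact hq v' hvv v'.asIdeal.zero_mem
    obtain ⟨r, hr, hyr⟩ := hy (y * (algebraMap _ (RatFunc 𝔣) h • d)) (by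
      change Ω _ ∈ J
      rwa [← hΨΩ, map_smul])
    rw [mul_right_inj' hy0] at hyr
    have h2 := hr.mem_lat G' hv
    rw [← hyr] at h2
    refine lat_of_smul G' (hC0 ?_) (inv_mem_placeRing hhv) h2
    rintro rfl
    exact hhv v.asIdeal.zero_mem

end Cyc

end Global

/-! ### Splitting by matrices over a field that receives `F ⊗ L`. -/

section Split

variable {𝔣 L : Type*} [Field 𝔣] [Field L] [Algebra 𝔣 L] {g g' : L ≃ₐ[𝔣] L} {n : ℕ} [NeZero n]

namespace Cyc

section Shift
variable {A : Type*} [CommRing A] [Algebra 𝔣 A] {t : Aˣ} (hg : g ^ n = 1)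

lemma coord_sz_mul (p : ℤ) (d : Cyc A g n t) (i : ℤ) : coord hg (sz p * d) i = coord hg d (i - p) := by
  induction p generalizing i with
  | zero => simp
  | succ p ih => rw [add_comm, sz_add, sz_one, mul_assoc, coord_S_mul, ih]; congr 1; ring
  | pred p ih =>
    have h := ih (i + 1)
    rw [show (-(p : ℤ)) = 1 + (-(p : ℤ) - 1) by ring, sz_add, sz_one, mul_assoc, coord_S_mul] at h
    rw [show i = i + 1 - 1 by ring, h]; congr 1; ring

lemma sz_sub_n (p : ℤ) : (sz (p - n) : Cyc A g n t) = ((t⁻¹ : Aˣ) : A) • sz p := by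
  have h : (sz p : Cyc A g n t) = (t : A) • sz (p - n) := by
    conv_lhs => rw [show p = n + (p - n) by ring, sz_add, sz_natCast, S_pow]
    rw [Algebra.smul_def]
  rw [h, smul_smul, Units.inv_mul, one_smul]

lemma lmat_sz_mul_ι (p : ℤ) (x : L) (k l : Fin n) :
    lmat hg (sz p * ι x : Cyc A g n t) k l = coord hg (1 : Cyc A g n t) (k - p - l) * (1 ⊗ₜ (g ^ (-(l : ℤ))) x) := by
  have h : (ι x * S ^ (l : ℕ) : Cyc A g n t) = sz l * inc (1 ⊗ₜ (g ^ (-(l : ℤ))) x) := by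
    rw [inc_one_tmul, sz_mul_ι, ← AlgEquiv.mul_apply, ← zpow_add, add_neg_cancel, zpow_zero, AlgEquiv.one_apply, sz_natCast]
  rw [lmat_apply, mul_assoc, h, coord_sz_mul, coord_sz_mul, coord_inc]

lemma not_dvd_sub {l l' : Fin n} (h : l ≠ l') : ¬ (n : ℤ) ∣ (l : ℤ) - l' := by
  rintro ⟨k, hk⟩
  have h1 := l.2
  have h2 := l'.2
  have hk0 : k = 0 := by
    by_contra hk0
    rcases lt_or_gt_of_ne hk0 with h' | h' <;> nlinarith
  subst hk0
  exact h (Fin.ext (by omega))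

/-- Left multiplication as an algebra homomorphism to matrices. -/
noncomputable def lmatHom : Cyc A g n t →ₐ[A] Matrix (Fin n) (Fin n) (A ⊗[𝔣] L) :=
  AlgHom.ofLinearMap
    { toFun := lmat hg
      map_add' d e := by ext i j; simp [lmat_apply, add_mul, coord_add]
      map_smul' a d := by ext i j; simp [lmat_apply, coord_smul] }
    (lmat_one hg) (lmat_mul hg)

lemma lmatHom_apply (d : Cyc A g n t) : lmatHom hg d = lmat hg d := rfl

end Shift

section Rep
variable {F M : Type*} [Field F] [Algebra 𝔣 F] [Field M] [Algebra F M] {t : Fˣ} (hg : g ^ n = 1)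
  (θ : F ⊗[𝔣] L →ₐ[F] M)

/-- The representation of the algebra over `M` by matrices. -/
noncomputable def rep : M ⊗[F] Cyc F g n t →ₐ[M] Matrix (Fin n) (Fin n) M :=
  Algebra.TensorProduct.lift (Algebra.ofId M _) (θ.mapMatrix.comp (lmatHom hg)) fun m _ => Algebra.commutes m _

lemma rep_tmul (m : M) (d : Cyc F g n t) (i j : Fin n) : rep hg θ (m ⊗ₜ d) i j = m * θ (lmat hg d i j) := by
  have h : rep hg θ (m ⊗ₜ d) = algebraMap M _ m * θ.mapMatrix (lmat hg d) := Algebra.TensorProduct.lift_tmul _ _ _ _ _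
  rw [h, ← Algebra.smul_def]; rfl

lemma rep_one_tmul (d : Cyc F g n t) : rep hg θ (1 ⊗ₜ d) = θ.mapMatrix (lmat hg d) := by
  ext i j; rw [rep_tmul, one_mul]; rfl

/-- The preimages of the matrix units. -/
noncomputable def matUnit (G : DualBasis g n) (t : Fˣ) (k l : Fin n) : M ⊗[F] Cyc F g n t :=
  ∑ j, θ (1 ⊗ₜ (g ^ (-(l : ℤ))) (G.μ j)) ⊗ₜ (sz ((k : ℤ) - l) * ι (G.b j))

/-- The dual family isolates the column `l`, and the shift `s ^ (k - l)` carries it to the row `k`.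
-/
lemma rep_matUnit (G : DualBasis g n) (k l : Fin n) :
    rep G.pow_eq_one θ (matUnit θ G t k l) = Matrix.single k l 1 := by
  ext k' l'
  rw [matUnit, map_sum, Matrix.sum_apply]
  have h : ∀ j, (1 : F) ⊗ₜ[𝔣] (g ^ (-(l' : ℤ))) (G.b j) * (1 ⊗ₜ (g ^ (-(l : ℤ))) (G.μ j)) =
      1 ⊗ₜ (g ^ (-(l : ℤ))) ((g ^ ((l : ℤ) - l')) (G.b j) * G.μ j) := fun j => by
    rw [Algebra.TensorProduct.tmul_mul_tmul, one_mul, map_mul, ← AlgEquiv.mul_apply, ← zpow_add]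
    congr 5; ring
  have h2 : ∀ j, rep G.pow_eq_one θ (θ (1 ⊗ₜ (g ^ (-(l : ℤ))) (G.μ j)) ⊗ₜ (sz ((k : ℤ) - l) * ι (G.b j) : Cyc F g n t)) k' l' =
      θ (coord G.pow_eq_one (1 : Cyc F g n t) (k' - (k - l) - l')) *
        θ (1 ⊗ₜ (g ^ (-(l : ℤ))) ((g ^ ((l : ℤ) - l')) (G.b j) * G.μ j)) := fun j => by
    rw [rep_tmul, lmat_sz_mul_ι, ← map_mul, ← map_mul, ← h]
    congr 1; ring
  rw [Finset.sum_congr rfl fun j _ => h2 j, ← Finset.mul_sum, ← map_sum, ← TensorProduct.tmul_sum, ← map_sum, G.dual]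
  by_cases hl : l = l'
  · subst hl
    rw [sub_self, if_pos (dvd_zero _), map_one, ← Algebra.TensorProduct.one_def, map_one, mul_one,
      show (k' : ℤ) - (k - l) - l = k' - k by ring]
    by_cases hk : k = k'
    · subst hk
      rw [sub_self, coord_one_zero, map_one, Matrix.single_apply_same]
    · rw [coord_one_eq_zero _ (not_dvd_sub (Ne.symm hk)), map_zero, Matrix.single_apply_of_row_ne hk]
  · rw [if_neg (not_dvd_sub hl), map_zero, TensorProduct.tmul_zero, map_zero, mul_zero,
      Matrix.single_apply_of_col_ne _ _ hl]

lemma rep_bijective (G : DualBasis g n) :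
    Function.Bijective (rep G.pow_eq_one θ : M ⊗[F] Cyc F g n t → Matrix (Fin n) (Fin n) M) := by
  have hfin := finite_of_dual G (A := F) (t := t)
  have hs : Function.Surjective (rep G.pow_eq_one θ : M ⊗[F] Cyc F g n t → Matrix (Fin n) (Fin n) M) := by
    intro N
    refine ⟨∑ k, ∑ l, N k l • matUnit θ G t k l, ?_⟩
    simp only [map_sum, map_smul, rep_matUnit]
    conv_rhs => rw [Matrix.matrix_eq_sum_single N]
    simp
  refine ⟨(LinearMap.injective_iff_surjective_of_finrank_eq_finrank (f := (rep G.pow_eq_one θ : M ⊗[F] Cyc F g n t →ₐ[M] _).toLinearMap) ?_).2 hs, hs⟩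
  rw [Module.finrank_baseChange, finrank_eq G, Module.finrank_matrix]
  simp

/-- The span of the elements `a s ^ i` over a valuation ring. -/
noncomputable def intSpan (g : L ≃ₐ[𝔣] L) (n : ℕ) (t : Fˣ) (O : ValuationSubring M) : Submodule O (M ⊗[F] Cyc F g n t) :=
  Submodule.span O {x | ∃ a : L, ∃ i < n, x = 1 ⊗ₜ[F] (ι a * S ^ i)}

variable {O : ValuationSubring M}

lemma tmul_mem_intSpan {r : M} (hr : r ∈ O) {d : Cyc F g n t} (hd : (1 ⊗ₜ d : M ⊗[F] Cyc F g n t) ∈ intSpan g n t O) :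
    r ⊗ₜ d ∈ intSpan g n t O := by
  have := (intSpan g n t O).smul_mem ⟨r, hr⟩ hd
  rw [TensorProduct.smul_tmul'] at this
  rwa [show (⟨r, hr⟩ : O) • (1 : M) = r from mul_one r] at this

lemma tmul_sz_mul_mem (ht' : algebraMap F M ((t⁻¹ : Fˣ) : F) ∈ O) {p : ℤ} (h1 : -(n : ℤ) ≤ p) (h2 : p < n) (x : L) :
    (1 ⊗ₜ (sz p * ι x) : M ⊗[F] Cyc F g n t) ∈ intSpan g n t O := by
  have hpos : ∀ p : ℕ, p < n → (1 ⊗ₜ (sz p * ι x) : M ⊗[F] Cyc F g n t) ∈ intSpan g n t O := fun p hp =>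
    Submodule.subset_span ⟨_, p, hp, by rw [sz_mul_ι, sz_natCast]⟩
  rcases lt_or_ge p 0 with hp | hp
  · obtain ⟨q, hq⟩ := Int.eq_ofNat_of_zero_le (show 0 ≤ p + n by omega)
    rw [show p = q - n by omega, sz_sub_n, smul_mul_assoc, ← TensorProduct.smul_tmul, Algebra.smul_def, mul_one]
    exact tmul_mem_intSpan ht' (hpos q (by omega))
  · lift p to ℕ using hp
    exact hpos p (by exact_mod_cast h2)

/-- When `t` is a unit of `O`, the splitting identifies the integral span with the matrices over
`O`: the generators have integral matrices, and the matrix units come from integral elements,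
negative powers of `s` being handled by `t⁻¹`. -/
lemma mem_intSpan_iff (G : DualBasis g n) (ht : algebraMap F M t ∈ O) (ht' : algebraMap F M ((t⁻¹ : Fˣ) : F) ∈ O)
    (hθ : ∀ x, θ (1 ⊗ₜ x) ∈ O) {x : M ⊗[F] Cyc F g n t} :
    x ∈ intSpan g n t O ↔ ∀ i j, rep G.pow_eq_one θ x i j ∈ O := by
  constructor
  · intro hx
    let T := O.toSubring.matrix (n := Fin n)
    have hmul : ∀ {a b : M}, a ∈ O → b ∈ O → a * b ∈ O := mul_mem
    have hone : (1 : M) ∈ O := one_mem _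
    have hzero : (0 : M) ∈ O := zero_mem _
    have hS : rep G.pow_eq_one θ (1 ⊗ₜ (S : Cyc F g n t)) ∈ T := by
      intro i j
      rw [rep_tmul, one_mul, ← mul_one S, ← ι_one, ← sz_one, lmat_sz_mul_ι, map_mul]
      refine hmul ?_ (hθ _)
      have h1 := i.2
      have h2 := j.2
      by_cases h : (i : ℤ) - 1 - j = -n
      · have := coord_sub_n G.pow_eq_one (1 : Cyc F g n t) 0
        rw [zero_sub, coord_one_zero] at this
        rw [h, this, map_smul, map_one, Algebra.smul_def, mul_one]
        exact ht
      · by_cases h0 : (i : ℤ) - 1 - j = 0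
        · rw [h0, coord_one_zero, map_one]; exact hone
        · rw [coord_one_eq_zero, map_zero]
          · exact hzero
          · rintro ⟨k, hk⟩
            have : k = 0 ∨ k = -1 := by
              by_contra! hk0
              have : k ≥ 1 ∨ k ≤ -2 := by omega
              rcases this with h' | h' <;> nlinarith
            rcases this with rfl | rfl <;> omega
    have hι : ∀ a, rep G.pow_eq_one θ (1 ⊗ₜ (ι a : Cyc F g n t)) ∈ T := by
      intro a i j
      rw [rep_tmul, one_mul, ← one_mul (ι a), ← sz_zero, lmat_sz_mul_ι, map_mul, sub_zero]
      refine hmul ?_ (hθ _)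
      by_cases h : i = j
      · rw [h, sub_self, coord_one_zero, map_one]; exact hone
      · rw [coord_one_eq_zero _ (not_dvd_sub h), map_zero]; exact hzero
    change rep G.pow_eq_one θ x ∈ T
    induction hx using Submodule.span_induction with
    | mem x hx =>
      obtain ⟨a, i, -, rfl⟩ := hx
      have : (1 ⊗ₜ (ι a * S ^ i) : M ⊗[F] Cyc F g n t) = (1 ⊗ₜ ι a) * (1 ⊗ₜ S) ^ i := by
        rw [Algebra.TensorProduct.tmul_pow, Algebra.TensorProduct.tmul_mul_tmul, one_pow, one_mul]
      rw [this, map_mul, map_pow]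
      exact mul_mem (hι a) (pow_mem hS i)
    | zero => rw [map_zero]; exact zero_mem T
    | add x y _ _ hx hy => rw [map_add]; exact add_mem hx hy
    | smul r x _ hx =>
      intro i j
      rw [← algebraMap_smul M r x, map_smul]
      exact hmul r.2 (hx i j)
  · intro hx
    have : x = ∑ k, ∑ l, rep G.pow_eq_one θ x k l • matUnit θ G t k l := by
      apply (rep_bijective θ G).1
      simp only [map_sum, map_smul, rep_matUnit]
      conv_lhs => rw [Matrix.matrix_eq_sum_single (rep G.pow_eq_one θ x)]
      simp
    rw [this]
    refine sum_mem fun k _ => sum_mem fun l _ => (intSpan g n t O).smul_mem ⟨_, hx k l⟩ ?_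
    refine sum_mem fun j _ => ?_
    have h1 := k.2
    have h2 := l.2
    exact tmul_mem_intSpan (hθ _) (tmul_sz_mul_mem ht' (p := (k : ℤ) - l) (by omega) (by omega) (G.b j))

lemma exists_conj_algEquiv {M A A' B : Type*} [Field M] [Ring A] [Algebra M A] [Ring A'] [Algebra M A'] [Ring B] [Algebra M B]
    {T : A →ₐ[M] B} {T' : A' →ₐ[M] B} (hT : Function.Bijective T) (hT' : Function.Bijective T') (U : Bˣ) :
    ∃ h : A ≃ₐ[M] A', ∀ x, T' (h x) = U⁻¹.1 * T x * U.1 := by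
  let C : B ≃ₐ[M] B := MulSemiringAction.toAlgEquiv M _ (ConjAct.toConjAct U⁻¹)
  refine ⟨(AlgEquiv.ofBijective T hT).trans (C.trans (AlgEquiv.ofBijective T' hT').symm), fun x => ?_⟩
  have h : T' ((AlgEquiv.ofBijective T' hT').symm (C (T x))) = C (T x) :=
    (AlgEquiv.ofBijective T' hT').apply_symm_apply _
  refine h.trans ?_
  change ConjAct.toConjAct U⁻¹ • T x = _
  rw [ConjAct.units_smul_def]; simp

/-- Matrices over `F ⊗ L` that intertwine `c` and `c'` define an isomorphism over `M`. -/
theorem exists_algEquiv (G : DualBasis g n) (G' : DualBasis g' n) {H H' : Matrix (Fin n) (Fin n) (F ⊗[𝔣] L)}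
    (hH : H * H' = 1) {c : Cyc F g n t} {c' : Cyc F g' n t}
    (hc : lmat G.pow_eq_one c * H = H * lmat G'.pow_eq_one c') :
    ∃ h : M ⊗[F] Cyc F g n t ≃ₐ[M] M ⊗[F] Cyc F g' n t, h (1 ⊗ₜ c) = 1 ⊗ₜ c' ∧
      ∀ O : ValuationSubring M, algebraMap F M t ∈ O → algebraMap F M ((t⁻¹ : Fˣ) : F) ∈ O →
        (∀ x, θ (1 ⊗ₜ x) ∈ O) → (∀ i j, θ (H i j) ∈ O) → (∀ i j, θ (H' i j) ∈ O) →
        ∀ x, x ∈ intSpan g n t O ↔ h x ∈ intSpan g' n t O := by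
  have hH' : H' * H = 1 := mul_eq_one_comm.1 hH
  let U : (Matrix (Fin n) (Fin n) M)ˣ := Units.map (θ.mapMatrix (m := Fin n)).toRingHom.toMonoidHom ⟨H, H', hH, hH'⟩
  obtain ⟨h, hT⟩ := exists_conj_algEquiv (rep_bijective (t := t) θ G) (rep_bijective (t := t) θ G') U
  refine ⟨h, ?_, ?_⟩
  · apply (rep_bijective θ G').1
    rw [hT]
    rw [rep_one_tmul, rep_one_tmul, mul_assoc, Units.inv_mul_eq_iff_eq_mul]
    change θ.mapMatrix _ * θ.mapMatrix H = θ.mapMatrix H * _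
    rw [← map_mul, ← map_mul, hc]
  · intro O ht ht' hθ hO hO' x
    rw [mem_intSpan_iff θ G ht ht' hθ, mem_intSpan_iff θ G' ht ht' hθ]
    change rep _ θ x ∈ O.toSubring.matrix (n := Fin n) ↔ rep _ θ _ ∈ O.toSubring.matrix (n := Fin n)
    have hU : U.1 ∈ O.toSubring.matrix (n := Fin n) := hO
    have hU' : U⁻¹.1 ∈ O.toSubring.matrix (n := Fin n) := hO'
    rw [hT]
    refine ⟨fun h => mul_mem (mul_mem hU' h) hU, fun h => ?_⟩
    have := mul_mem (mul_mem hU h) hU'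
    rwa [mul_assoc, mul_assoc, Units.mul_inv, mul_one, Units.mul_inv_cancel_left] at this

end Rep

end Cyc

end Split

/-! ### From lattice-preserving comparisons to isomorphisms over the Henselization. -/

section Local

variable {𝔣 L : Type*} [Field 𝔣] [Field L] [Algebra 𝔣 L] {g g' : L ≃ₐ[𝔣] L} {n : ℕ} [NeZero n]

namespace Cyc

section Comat
variable {F : Type*} [Field F] [Algebra 𝔣 F] {t : Fˣ}

/-- The matrix of a right linear map between cyclic algebras. -/
noncomputable def comat (hg : g ^ n = 1) (ψ : Cyc F g' n t →ₗ[F] Cyc F g n t) : Matrix (Fin n) (Fin n) (F ⊗[𝔣] L) :=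
  Matrix.of fun k l => coord hg (ψ (S ^ (l : ℕ))) (k : ℕ)

lemma map_mul_inc {ψ : Cyc F g' n t →ₗ[F] Cyc F g n t} (hψ : ∀ d x, ψ (d * ι x) = ψ d * ι x) (d : Cyc F g' n t)
    (z : F ⊗[𝔣] L) : ψ (d * inc z) = ψ d * inc z := by
  induction z with
  | zero => simp
  | add x y hx hy => simp only [map_add, mul_add, hx, hy]
  | tmul a x =>
    rw [inc_tmul, inc_tmul, ← Algebra.smul_def, ← Algebra.smul_def, mul_smul_comm, mul_smul_comm, map_smul, hψ]

lemma comat_mulVec (hg : g ^ n = 1) (hg' : g' ^ n = 1) {ψ : Cyc F g' n t →ₗ[F] Cyc F g n t}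
    (hψ : ∀ d x, ψ (d * ι x) = ψ d * ι x) (d : Cyc F g' n t) :
    (comat hg ψ).mulVec (coordEquiv hg' d) = coordEquiv hg (ψ d) := by
  ext k
  conv_rhs => rw [← sum_coord hg' d, map_sum, Finset.sum_range, coordEquiv_apply, coord_sum, Finset.sum_apply]
  simp only [map_mul_inc hψ, coord_mul_inc]
  rfl

lemma matrix_ext_coordEquiv (hg : g ^ n = 1) {N N' : Matrix (Fin n) (Fin n) (F ⊗[𝔣] L)}
    (h : ∀ d : Cyc F g n t, N.mulVec (coordEquiv hg d) = N'.mulVec (coordEquiv hg d)) : N = N' := by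
  apply Matrix.mulVec_injective
  ext1 v
  obtain ⟨d, rfl⟩ := (coordEquiv (t := t) hg).surjective v
  exact h d

lemma comat_mul_comat_symm (hg : g ^ n = 1) (hg' : g' ^ n = 1) {ψ : Cyc F g' n t ≃ₗ[F] Cyc F g n t}
    (hψ : ∀ d x, ψ (d * ι x) = ψ d * ι x) : comat hg ψ.toLinearMap * comat hg' ψ.symm.toLinearMap = 1 := by
  refine matrix_ext_coordEquiv (t := t) hg fun d => ?_
  rw [← Matrix.mulVec_mulVec, comat_mulVec hg' hg (fun d x => ψ.injective ?_), comat_mulVec hg hg' hψ, Matrix.one_mulVec]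
  · simp
  · simp [hψ]

lemma lmat_mul_comat (hg : g ^ n = 1) (hg' : g' ^ n = 1) {ψ : Cyc F g' n t →ₗ[F] Cyc F g n t}
    (hψ : ∀ d x, ψ (d * ι x) = ψ d * ι x) {c : Cyc F g n t} {c' : Cyc F g' n t} (hc : ∀ d, ψ (c' * d) = c * ψ d) :
    lmat hg c * comat hg ψ = comat hg ψ * lmat hg' c' := by
  refine matrix_ext_coordEquiv (t := t) hg' fun d => ?_
  rw [← Matrix.mulVec_mulVec, ← Matrix.mulVec_mulVec, comat_mulVec hg hg' hψ, lmat_mulVec, lmat_mulVec,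
    comat_mulVec hg hg' hψ, hc]

lemma coord_mem_of_mem_lat {M : Type*} [Field M] [Algebra F M] (θ : F ⊗[𝔣] L →ₐ[F] M) {O : ValuationSubring M}
    (hθ : ∀ x, θ (1 ⊗ₜ x) ∈ O) (G : DualBasis g n) {R : Subalgebra 𝔣 F} (hR : ∀ r ∈ R, algebraMap F M r ∈ O)
    {x : Cyc F g n t} (hx : x ∈ lat G t R) (k : Fin n) : θ (coord G.pow_eq_one x (k : ℕ)) ∈ O := by
  rw [← (basis G F t).sum_repr x, coord_sum, Finset.sum_apply, map_sum]
  refine sum_mem fun p _ => ?_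
  rw [coord_smul, Pi.smul_apply, map_smul, Algebra.smul_def]
  refine mul_mem (hR _ (hx p)) ?_
  rw [basis_apply, coord_S_pow_mul, ← inc_one_tmul, coord_inc, map_mul]
  refine mul_mem ?_ (hθ _)
  by_cases h : k = p.1
  · rw [h, sub_self, coord_one_zero, map_one]; exact one_mem O
  · rw [coord_one_eq_zero _ (not_dvd_sub h), map_zero]; exact zero_mem O

end Comat

section Place
open IsDedekindDomain Polynomial

/-- A valuation ring over `𝔣(t)` in which `t` is a unit contains the local ring of a prime other than `t`. -/
lemma exists_placeRing_le {M : Type*} [Field M] [Algebra (RatFunc 𝔣) M] {O : ValuationSubring M}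
    (hC : ∀ r : 𝔣, algebraMap (RatFunc 𝔣) M (RatFunc.C r) ∈ O)
    (ht : O.valuation (algebraMap (RatFunc 𝔣) M RatFunc.X) = 1) :
    ∃ v : HeightOneSpectrum 𝔣[X], X ∉ v.asIdeal ∧ ∀ r ∈ placeRing v, algebraMap (RatFunc 𝔣) M r ∈ O := by
  let φ : 𝔣[X] →+* M := (algebraMap (RatFunc 𝔣) M).comp (algebraMap 𝔣[X] (RatFunc 𝔣))
  have hφX : φ X = algebraMap (RatFunc 𝔣) M RatFunc.X := by simp [φ]
  have hφ : ∀ p, φ p ∈ O := by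
    intro p
    induction p using Polynomial.induction_on' with
    | add p q hp hq => rw [map_add]; exact add_mem hp hq
    | monomial k a =>
      rw [← C_mul_X_pow_eq_monomial, map_mul, map_pow, hφX]
      refine mul_mem (by simpa [φ] using hC a) (pow_mem ?_ k)
      rw [← ValuationSubring.valuation_le_one_iff, ht]
  let φ' : 𝔣[X] →+* O := φ.codRestrict O.toSubring hφ
  let p := (IsLocalRing.maximalIdeal O).comap φ'
  have hp : p.IsPrime := Ideal.comap_isPrime _ _
  have hmem : ∀ q, q ∉ p → (φ q)⁻¹ ∈ O := by
    intro q hq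
    have h1 : IsUnit (φ' q) := by
      by_contra h
      exact hq ((IsLocalRing.mem_maximalIdeal _).2 h)
    have h2 : O.valuation (φ q) = 1 := (ValuationSubring.valuation_eq_one_iff O (φ' q)).1 h1
    rw [← ValuationSubring.valuation_le_one_iff, map_inv₀, h2, inv_one]
  have hXp : X ∉ p := fun h => by
    refine (IsLocalRing.mem_maximalIdeal (φ' X)).1 h ((ValuationSubring.valuation_eq_one_iff O (φ' X)).2 ?_)
    change O.valuation (φ X) = 1
    rw [hφX, ht]
  -- If `O` contracts to the zero ideal, all nonzero polynomials are units of `O` and any prime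
  -- other than `X` will do.
  obtain ⟨v, hv, hvp⟩ : ∃ v : HeightOneSpectrum 𝔣[X], X ∉ v.asIdeal ∧ ∀ s ∉ v.asIdeal, s ∉ p := by
    by_cases h0 : p = ⊥
    · obtain ⟨v, hv⟩ := exists_heightOneSpectrum 𝔣
      refine ⟨v, hv, fun s hs hsp => hs ?_⟩
      rw [h0, Ideal.mem_bot] at hsp
      rw [hsp]; exact zero_mem _
    · exact ⟨⟨p, hp, h0⟩, hXp, fun _ h => h⟩
  refine ⟨v, hv, fun r hr => ?_⟩
  obtain ⟨a, s, hs, rfl⟩ := mem_placeRing.1 hr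
  rw [map_mul, map_inv₀]
  exact mul_mem (hφ a) (hmem s (hvp s hs))

end Place

/-- The local isomorphism attached to a right linear bijection respecting the lattices. -/
theorem exists_local (G : DualBasis g n) (G' : DualBasis g' n) {M : Type*} [Field M] [Algebra (RatFunc 𝔣) M]
    (θ : RatFunc 𝔣 ⊗[𝔣] L →ₐ[RatFunc 𝔣] M) {O : ValuationSubring M} (hθ : ∀ x, θ (1 ⊗ₜ x) ∈ O)
    {c : Cyc (RatFunc 𝔣) g n (ratX 𝔣)} {c' : Cyc (RatFunc 𝔣) g' n (ratX 𝔣)}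
    (hψ : ∀ v : IsDedekindDomain.HeightOneSpectrum (Polynomial 𝔣), Polynomial.X ∉ v.asIdeal →
      ∃ ψ : Cyc (RatFunc 𝔣) g' n (ratX 𝔣) ≃ₗ[RatFunc 𝔣] Cyc (RatFunc 𝔣) g n (ratX 𝔣),
        (∀ d, ψ (c' * d) = c * ψ d) ∧ (∀ d (x : L), ψ (d * ι x) = ψ d * ι x) ∧
        ∀ d, d ∈ lat G' _ (placeRing v) ↔ ψ d ∈ lat G _ (placeRing v)) :
    ∃ h : M ⊗[RatFunc 𝔣] Cyc (RatFunc 𝔣) g n (ratX 𝔣) ≃ₐ[M] M ⊗[RatFunc 𝔣] Cyc (RatFunc 𝔣) g' n (ratX 𝔣),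
      h (1 ⊗ₜ c) = 1 ⊗ₜ c' ∧ (O.valuation (algebraMap (RatFunc 𝔣) M RatFunc.X) = 1 →
        ∀ x, x ∈ intSpan g n (ratX 𝔣) O ↔ h x ∈ intSpan g' n (ratX 𝔣) O) := by
  by_cases ht : O.valuation (algebraMap (RatFunc 𝔣) M RatFunc.X) = 1
  · have hC : ∀ r : 𝔣, algebraMap (RatFunc 𝔣) M (RatFunc.C r) ∈ O := by
      intro r
      have h1 := hθ (algebraMap 𝔣 L r)
      have h2 : (1 : RatFunc 𝔣) ⊗ₜ[𝔣] algebraMap 𝔣 L r = algebraMap (RatFunc 𝔣) _ (RatFunc.C r) := by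
        rw [Algebra.TensorProduct.algebraMap_apply, Algebra.algebraMap_eq_smul_one, ← TensorProduct.smul_tmul,
          Algebra.smul_def, mul_one]; rfl
      rwa [h2, AlgHom.commutes] at h1
    obtain ⟨v, hv, hO⟩ := exists_placeRing_le hC ht
    obtain ⟨ψ, hψ1, hψ2, hψ3⟩ := hψ v hv
    obtain ⟨h, hc, hR⟩ := exists_algEquiv θ G G' (comat_mul_comat_symm G.pow_eq_one G'.pow_eq_one hψ2)
      (lmat_mul_comat G.pow_eq_one G'.pow_eq_one (ψ := ψ.toLinearMap) hψ2 hψ1)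
    refine ⟨h, hc, fun _ => hR O ?_ ?_ hθ (fun i j => ?_) (fun i j => ?_)⟩
    · exact hO _ (ratX_mem v)
    · exact hO _ (ratX_inv_mem hv)
    · exact coord_mem_of_mem_lat θ hθ G hO ((hψ3 _).1 (lat_S_pow G' (ratX_mem v) (ratX_inv_mem hv) j)) i
    · refine coord_mem_of_mem_lat θ hθ G' hO ((hψ3 _).2 ?_) i
      rw [LinearEquiv.coe_coe, LinearEquiv.apply_symm_apply]
      exact lat_S_pow G (ratX_mem v) (ratX_inv_mem hv) j
  -- Here `t` is not a unit, so only an isomorphism of algebras carrying `c` to `c'` is required,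
  -- and the comparison at any prime supplies it.
  · obtain ⟨v, hv⟩ := exists_heightOneSpectrum 𝔣
    obtain ⟨ψ, hψ1, hψ2, hψ3⟩ := hψ v hv
    obtain ⟨h, hc, hR⟩ := exists_algEquiv θ G G' (comat_mul_comat_symm G.pow_eq_one G'.pow_eq_one hψ2)
      (lmat_mul_comat G.pow_eq_one G'.pow_eq_one (ψ := ψ.toLinearMap) hψ2 hψ1)
    exact ⟨h, hc, fun h => absurd h ht⟩

/-- The local isomorphism for scalar elements. -/
theorem exists_local_algebraMap (G : DualBasis g n) (G' : DualBasis g' n) {M : Type*} [Field M] [Algebra (RatFunc 𝔣) M]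
    (θ : RatFunc 𝔣 ⊗[𝔣] L →ₐ[RatFunc 𝔣] M) {O : ValuationSubring M} (hθ : ∀ x, θ (1 ⊗ₜ x) ∈ O) (r : RatFunc 𝔣) :
    ∃ h : M ⊗[RatFunc 𝔣] Cyc (RatFunc 𝔣) g n (ratX 𝔣) ≃ₐ[M] M ⊗[RatFunc 𝔣] Cyc (RatFunc 𝔣) g' n (ratX 𝔣),
      h (1 ⊗ₜ algebraMap _ _ r) = 1 ⊗ₜ algebraMap _ _ r ∧ (O.valuation (algebraMap (RatFunc 𝔣) M RatFunc.X) = 1 →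
        ∀ x, x ∈ intSpan g n (ratX 𝔣) O ↔ h x ∈ intSpan g' n (ratX 𝔣) O) := by
  -- Scalars act by scalar matrices on both sides, so the identity matrix intertwines them.
  have h1 : lmat G.pow_eq_one (algebraMap (RatFunc 𝔣) (Cyc (RatFunc 𝔣) g n (ratX 𝔣)) r) * 1 =
      1 * lmat G'.pow_eq_one (algebraMap (RatFunc 𝔣) (Cyc (RatFunc 𝔣) g' n (ratX 𝔣)) r) := by
    rw [← lmatHom_apply, ← lmatHom_apply, AlgHom.commutes, AlgHom.commutes, mul_one, one_mul]
  obtain ⟨h, hc, hR⟩ := exists_algEquiv θ G G' (one_mul 1) h1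
  have hO : ∀ i j : Fin n, θ ((1 : Matrix (Fin n) (Fin n) (RatFunc 𝔣 ⊗[𝔣] L)) i j) ∈ O := by
    intro i j
    rw [Matrix.one_apply]
    split_ifs
    · rw [map_one]; exact one_mem O
    · rw [map_zero]; exact zero_mem O
  refine ⟨h, hc, fun ht => hR O ?_ ?_ hθ hO hO⟩
  · rw [← ValuationSubring.valuation_le_one_iff]; exact ht.le
  · rw [← ValuationSubring.valuation_le_one_iff, Units.val_inv_eq_inv_val, map_inv₀, map_inv₀]
    exact (by rw [ht, inv_one] : (O.valuation (algebraMap (RatFunc 𝔣) M RatFunc.X))⁻¹ ≤ 1)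

end Cyc

end Local

/-! ### Transport of centralizers along isomorphisms. -/

section Centralizers

open Polynomial

/-- Elements that generate their centralizers and have the same annihilating polynomials have isomorphic centralizers. -/
lemma exists_centralizer_equiv {K D D' : Type*} [Field K] [Ring D] [Algebra K D] [Ring D'] [Algebra K D'] {c : D} {c' : D'}
    (hc : Subalgebra.centralizer K {c} = Algebra.adjoin K {c}) (hc' : Subalgebra.centralizer K {c'} = Algebra.adjoin K {c'})
    (hker : ∀ p : K[X], aeval c p = 0 ↔ aeval c' p = 0) :
    ∃ e : Subalgebra.centralizer K {c} ≃ₐ[K] Subalgebra.centralizer K {c'},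
      ∀ x : Subalgebra.centralizer K {c}, ∃ p : K[X], (x : D) = aeval c p ∧ (e x : D') = aeval c' p := by
  rw [Algebra.adjoin_singleton_eq_range_aeval] at hc hc'
  rw [hc, hc']
  have h1 := (aeval c : K[X] →ₐ[K] D).rangeRestrict_surjective
  have h2 := (aeval c' : K[X] →ₐ[K] D').rangeRestrict_surjective
  have h3 : RingHom.ker (aeval c : K[X] →ₐ[K] D).rangeRestrict = RingHom.ker (aeval c' : K[X] →ₐ[K] D').rangeRestrict := by
    ext p
    rw [RingHom.mem_ker, RingHom.mem_ker, ← Subtype.coe_inj, ← Subtype.coe_inj]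
    exact hker p
  refine ⟨(Ideal.quotientKerAlgEquivOfSurjective h1).symm.trans ((Ideal.quotientEquivAlgOfEq K h3).trans
    (Ideal.quotientKerAlgEquivOfSurjective h2)), fun x => ?_⟩
  obtain ⟨p, rfl⟩ := h1 x
  refine ⟨p, rfl, ?_⟩
  rw [AlgEquiv.trans_apply, Ideal.quotientKerAlgEquivOfSurjective_symm_apply]
  rfl

lemma exists_localCentralizer_equiv {M Λ Λ' : Type*} [Field M] [Ring Λ] [Algebra M Λ] [Ring Λ'] [Algebra M Λ'] {c : Λ} {c' : Λ'}
    (h : Λ ≃ₐ[M] Λ') (hc : h c = c') :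
    ∃ j : Subalgebra.centralizer M {c} ≃ₐ[M] Subalgebra.centralizer M {c'}, ∀ y, (j y : Λ') = h y := by
  have hmem : ∀ y, y ∈ Subalgebra.centralizer M {c} ↔ h y ∈ Subalgebra.centralizer M {c'} := fun y => by
    simp only [Subalgebra.mem_centralizer_iff, Set.mem_singleton_iff, forall_eq]
    rw [← hc, ← map_mul, ← map_mul, h.injective.eq_iff]
  refine ⟨AlgEquiv.ofBijective ((h.toAlgHom.comp (Subalgebra.centralizer M {c}).val).codRestrict _ fun y => (hmem _).1 y.2)
    ⟨fun y z hyz => ?_, fun z => ?_⟩, fun y => rfl⟩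
  · exact Subtype.ext (h.injective (congrArg Subtype.val hyz))
  · refine ⟨⟨h.symm z, (hmem _).2 ?_⟩, Subtype.ext (h.apply_symm_apply _)⟩
    rw [h.apply_symm_apply]; exact z.2

lemma map_one_tmul_aeval {K M D D' : Type*} [Field K] [Field M] [Algebra K M] [Ring D] [Algebra K D] [Ring D'] [Algebra K D']
    {c : D} {c' : D'} (h : M ⊗[K] D ≃ₐ[M] M ⊗[K] D') (hc : h (1 ⊗ₜ c) = 1 ⊗ₜ c') (p : K[X]) :
    h (1 ⊗ₜ aeval c p) = 1 ⊗ₜ aeval c' p := by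
  have h1 : (1 : M) ⊗ₜ[K] aeval c p = aeval (1 ⊗ₜ c : M ⊗[K] D) p :=
    (aeval_algHom_apply (Algebra.TensorProduct.includeRight : D →ₐ[K] M ⊗[K] D) c p).symm
  have h2 : (1 : M) ⊗ₜ[K] aeval c' p = aeval (1 ⊗ₜ c' : M ⊗[K] D') p :=
    (aeval_algHom_apply (Algebra.TensorProduct.includeRight : D' →ₐ[K] M ⊗[K] D') c' p).symm
  rw [h1, h2, ← hc]
  exact (aeval_algHom_apply (h.toAlgHom.restrictScalars K) _ p).symm

end Centralizers

/-! ### The embedding of `L` in the Henselization through `k`. -/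

section Hensel

variable {𝔣 L k : Type*} [Field 𝔣] [Field k] [Algebra 𝔣 k]

lemma HenselField.algebraMap_C (w : ValuationSubring (SeparableClosure (RatFunc k))) (r : 𝔣) :
    algebraMap (RatFunc 𝔣) (HenselField w) (RatFunc.C r) = HenselField.ofRatFunc w (RatFunc.C (algebraMap 𝔣 k r)) := by
  change HenselField.ofRatFunc w (ratFuncInclusion 𝔣 k (RatFunc.C r)) = _
  congr 1
  rw [← RatFunc.algebraMap_C, ← RatFunc.algebraMap_C, ratFuncInclusion, RatFunc.coe_mapRingHom_eq_coe_map, RatFunc.map_apply]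
  simp

lemma HenselField.ofRatFunc_C_mem {w : ValuationSubring (SeparableClosure (RatFunc k))} {v : ValuationSubring (RatFunc k)}
    (hv : IsPlace v) (hw : Prolongs w v) (a : k) : HenselField.ofRatFunc w (RatFunc.C a) ∈ HenselField.integers w := by
  have h := hv.const_mem a
  rw [← hw] at h
  exact h

/-- As `k` is algebraically closed and `L` is finite over `𝔣`, there is an embedding of `L` in `k`;
its values are constants, hence integral at every place over `k`. -/
lemma HenselField.exists_algHom [Field L] [Algebra 𝔣 L] [FiniteDimensional 𝔣 L] [IsAlgClosed k]
    (w : ValuationSubring (SeparableClosure (RatFunc k))) :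
    ∃ θ : RatFunc 𝔣 ⊗[𝔣] L →ₐ[RatFunc 𝔣] HenselField w,
      ∀ v, IsPlace v → Prolongs w v → ∀ x, θ (1 ⊗ₜ x) ∈ HenselField.integers w := by
  let σ : L →ₐ[𝔣] k := IsAlgClosed.lift
  letI : Algebra 𝔣 (HenselField w) := ((algebraMap (RatFunc 𝔣) (HenselField w)).comp (algebraMap 𝔣 (RatFunc 𝔣))).toAlgebra
  haveI : IsScalarTower 𝔣 (RatFunc 𝔣) (HenselField w) := IsScalarTower.of_algebraMap_eq fun _ => rfl
  let χ : L →ₐ[𝔣] HenselField w :=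
    { ((HenselField.ofRatFunc w).comp RatFunc.C).comp (σ : L →+* k) with
      commutes' := fun r => by
        change HenselField.ofRatFunc w (RatFunc.C (σ (algebraMap 𝔣 L r))) = _
        rw [σ.commutes, ← HenselField.algebraMap_C]; rfl }
  refine ⟨Algebra.TensorProduct.lift (Algebra.ofId _ _) χ fun _ _ => Commute.all _ _, fun v hv hw x => ?_⟩
  rw [Algebra.TensorProduct.lift_tmul, map_one, one_mul]
  exact HenselField.ofRatFunc_C_mem hv hw (σ x)

end Hensel

/-! ### The theorem when `L` is a field. -/

section FieldCase

namespace CyclicAlg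

variable {𝔣 L k : Type*} [Field 𝔣] [Field k] [Algebra 𝔣 k]

lemma preservesIntegralAt_of_algEquiv [CommRing L] [Algebra 𝔣 L] {g g' : L ≃ₐ[𝔣] L} {n : ℕ}
    {w : ValuationSubring (SeparableClosure (RatFunc k))} {c : CyclicAlg 𝔣 L g n} {c' : CyclicAlg 𝔣 L g' n}
    {e : centralizer c ≃ₐ[RatFunc 𝔣] centralizer c'}
    (h : (HenselField w ⊗[RatFunc 𝔣] CyclicAlg 𝔣 L g n) ≃ₐ[HenselField w] (HenselField w ⊗[RatFunc 𝔣] CyclicAlg 𝔣 L g' n))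
    (hc : h (1 ⊗ₜ c) = 1 ⊗ₜ c') (hR : ∀ x, x ∈ localRing g n w ↔ h x ∈ localRing g' n w)
    (he : ∀ x : centralizer c, h (1 ⊗ₜ (x : CyclicAlg 𝔣 L g n)) = 1 ⊗ₜ (e x : CyclicAlg 𝔣 L g' n)) :
    PreservesIntegralAt w e := by
  obtain ⟨j, hj⟩ := exists_localCentralizer_equiv h hc
  refine ⟨j, fun x y hxy => ?_, fun y => ?_⟩
  · rw [← he, ← hxy]; exact hj y
  · have h1 := hR y
    rw [← show _ = h y from hj y] at h1
    exact h1

variable [Field L] [Algebra 𝔣 L] {g g' : L ≃ₐ[𝔣] L} {n : ℕ} [NeZero n]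

lemma matchAt_of_algEquiv {w : ValuationSubring (SeparableClosure (RatFunc k))}
    {c : Cyc (RatFunc 𝔣) g n (ratX 𝔣)} {c' : Cyc (RatFunc 𝔣) g' n (ratX 𝔣)}
    (h : HenselField w ⊗[RatFunc 𝔣] Cyc (RatFunc 𝔣) g n (ratX 𝔣) ≃ₐ[HenselField w]
      HenselField w ⊗[RatFunc 𝔣] Cyc (RatFunc 𝔣) g' n (ratX 𝔣)) (hc : h (1 ⊗ₜ c) = 1 ⊗ₜ c')
    (hR : (HenselField.integers w).valuation (algebraMap (RatFunc 𝔣) (HenselField w) RatFunc.X) = 1 →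
        ∀ x, x ∈ Cyc.intSpan g n (ratX 𝔣) (HenselField.integers w) ↔ h x ∈ Cyc.intSpan g' n (ratX 𝔣) (HenselField.integers w)) :
    MatchAt (𝔣 := 𝔣) (L := L) (g := g) (g' := g') (n := n) w c c' := by
  refine ⟨h, hc, fun x => ?_⟩
  rw [localRing, integralRing, localRing, integralRing]
  split_ifs with ht
  · exact hR ht x
  · exact ⟨fun _ => trivial, fun _ => trivial⟩

end CyclicAlg

/-- The exponent `a` with `g ^ a = g'⁻¹` is prime to `n`, since otherwise `g'` would be trivial and
could not generate; `m` is its inverse modulo `n`. -/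
lemma exists_pow_mul_eq_one {G : Type*} [Group G] {g g' : G} {n : ℕ} (hn : n.Prime) (hg : orderOf g = n)
    (hg' : Subgroup.zpowers g' = Subgroup.zpowers g) : ∃ a m : ℕ, a * m % n = 1 ∧ g ^ a * g' = 1 := by
  have hfin : IsOfFinOrder g := orderOf_pos_iff.1 (hg ▸ hn.pos)
  have h1 : g'⁻¹ ∈ Subgroup.zpowers g := inv_mem (hg' ▸ Subgroup.mem_zpowers g')
  obtain ⟨a, ha⟩ := hfin.mem_powers_iff_mem_zpowers.2 h1
  have ha' : g ^ a = g'⁻¹ := ha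
  have hna : ¬ n ∣ a := fun h => by
    rw [← hg, orderOf_dvd_iff_pow_eq_one, ha', inv_eq_one] at h
    have : g ∈ Subgroup.zpowers g' := hg' ▸ Subgroup.mem_zpowers g
    rw [h, Subgroup.zpowers_one_eq_bot, Subgroup.mem_bot] at this
    rw [this, orderOf_one] at hg
    exact hn.one_lt.ne hg
  obtain ⟨m, -, hm⟩ := Nat.exists_mul_mod_eq_one_of_coprime ((hn.coprime_iff_not_dvd.2 hna).symm) hn.one_lt
  exact ⟨a, m, hm, by rw [ha', inv_mul_cancel]⟩

open Polynomial in
lemma map_aeval_mul {K D D' : Type*} [CommRing K] [Ring D] [Algebra K D] [Ring D'] [Algebra K D'] {c : D} {c' : D'}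
    {ψ : D' →ₗ[K] D} (hψ : ∀ d, ψ (c' * d) = c * ψ d) (p : K[X]) (d : D') : ψ (aeval c' p * d) = aeval c p * ψ d := by
  induction p using Polynomial.induction_on generalizing d with
  | C r => rw [aeval_C, aeval_C, ← Algebra.smul_def, ← Algebra.smul_def, map_smul]
  | add p q hp hq => rw [map_add, map_add, add_mul, add_mul, map_add, hp, hq]
  | monomial m r h =>
    rw [pow_succ, ← mul_assoc, map_mul (aeval c'), map_mul (aeval c), aeval_X, aeval_X, mul_assoc, h, hψ, mul_assoc]

open Polynomial in
/-- The main theorem when `L` is a field. -/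
theorem exists_match_of_field {𝔣 L k : Type*} [Field 𝔣] [Field L] [Algebra 𝔣 L] [Field k] [Algebra 𝔣 k] [IsAlgClosed k]
    {n : ℕ} (hn : n.Prime) (hL : Module.finrank 𝔣 L = n) {g g' : L ≃ₐ[𝔣] L} (hg : orderOf g = n)
    (hg' : Subgroup.zpowers g' = Subgroup.zpowers g) (c : CyclicAlg 𝔣 L g n) :
    ∃ c' : CyclicAlg 𝔣 L g' n,
      (∀ v : ValuationSubring (RatFunc k), IsPlace v →
        ∀ w : ValuationSubring (SeparableClosure (RatFunc k)), Prolongs w v →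
          CyclicAlg.MatchAt w c c') ∧
      (c ∉ Subalgebra.center (RatFunc 𝔣) (CyclicAlg 𝔣 L g n) →
        ∃ e : CyclicAlg.centralizer c ≃ₐ[RatFunc 𝔣] CyclicAlg.centralizer c',
          (∀ x : CyclicAlg.centralizer c, (x : CyclicAlg 𝔣 L g n) = c →
            (e x : CyclicAlg 𝔣 L g' n) = c') ∧
          ∀ v : ValuationSubring (RatFunc k), IsPlace v →
            ∀ w : ValuationSubring (SeparableClosure (RatFunc k)), Prolongs w v →
              CyclicAlg.PreservesIntegralAt w e) := by
  have : NeZero n := ⟨hn.ne_zero⟩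
  have hfin : FiniteDimensional 𝔣 L := FiniteDimensional.of_finrank_pos (hL ▸ hn.pos)
  have hord : orderOf g' = n := by rw [← Nat.card_zpowers, hg', Nat.card_zpowers, hg]
  obtain ⟨G⟩ := exists_dualBasis hg hL
  obtain ⟨G'⟩ := exists_dualBasis hord hL
  by_cases hc : c ∈ (algebraMap (RatFunc 𝔣) (CyclicAlg 𝔣 L g n)).range
  · obtain ⟨r, rfl⟩ := hc
    refine ⟨algebraMap (RatFunc 𝔣) _ r, fun v hv w hw => ?_, fun h => absurd (Subalgebra.algebraMap_mem _ r) h⟩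
    obtain ⟨θ, hθ⟩ := HenselField.exists_algHom (𝔣 := 𝔣) (L := L) w
    obtain ⟨h, hc, hR⟩ := Cyc.exists_local_algebraMap G G' θ (hθ v hv hw) r
    exact CyclicAlg.matchAt_of_algEquiv h hc hR
  obtain ⟨a, m, ham, hgg'⟩ := exists_pow_mul_eq_one hn hg hg'
  let c₁ : Cyc (RatFunc 𝔣) g n (ratX 𝔣) := c
  have hc₁ : c₁ ∉ (algebraMap (RatFunc 𝔣) _).range := hc
  obtain ⟨c', hc'⟩ := Cyc.exists_global G G' hn ham hgg' hc₁
  -- A single comparison `ψ` suffices: it is bijective and intertwines left multiplication by `c'`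
  -- and `c`.
  have hker : ∀ p : (RatFunc 𝔣)[X], aeval c₁ p = 0 ↔ aeval c' p = 0 := by
    obtain ⟨v, hv⟩ := Cyc.exists_heightOneSpectrum 𝔣
    obtain ⟨ψ, hψ, -⟩ := hc' v hv
    intro p
    have h := map_aeval_mul (ψ := ψ.toLinearMap) hψ p
    constructor
    · intro hp
      have h1 := h 1
      rw [hp, zero_mul, mul_one] at h1
      exact ψ.injective (h1.trans (map_zero ψ).symm)
    · intro hp
      have h1 := h (ψ.symm 1)
      rw [hp, zero_mul, map_zero] at h1
      have h2 : ψ.toLinearMap (ψ.symm 1) = 1 := ψ.apply_symm_apply 1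
      rw [h2, mul_one] at h1
      exact h1.symm
  have hc₁' : c' ∉ (algebraMap (RatFunc 𝔣) _).range := by
    rintro ⟨r, hr⟩
    have h1 : aeval c₁ (X - C r) = 0 := (hker _).2 (by rw [map_sub, aeval_X, aeval_C, hr, sub_self])
    rw [map_sub, aeval_X, aeval_C, sub_eq_zero] at h1
    exact hc₁ ⟨r, h1.symm⟩
  have hloc : ∀ v : ValuationSubring (RatFunc k), IsPlace v →
        ∀ w : ValuationSubring (SeparableClosure (RatFunc k)), Prolongs w v →
          CyclicAlg.MatchAt (𝔣 := 𝔣) (L := L) (g := g) (g' := g') (n := n) w c₁ c' := by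
    intro v hv w hw
    obtain ⟨θ, hθ⟩ := HenselField.exists_algHom (𝔣 := 𝔣) (L := L) w
    obtain ⟨h, hc, hR⟩ := Cyc.exists_local G G' θ (hθ v hv hw) hc'
    exact CyclicAlg.matchAt_of_algEquiv h hc hR
  refine ⟨c', hloc, fun _ => ?_⟩
  have hD := Cyc.isDomain_ratFunc G
  have hD' := Cyc.isDomain_ratFunc G'
  have := Cyc.finite_of_dual G (A := RatFunc 𝔣) (t := ratX 𝔣)
  have := Cyc.finite_of_dual G' (A := RatFunc 𝔣) (t := ratX 𝔣)
  obtain ⟨e, he⟩ : ∃ e : CyclicAlg.centralizer c ≃ₐ[RatFunc 𝔣] CyclicAlg.centralizer (g := g') (n := n) c',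
      ∀ x : CyclicAlg.centralizer c, ∃ p : (RatFunc 𝔣)[X], (x : CyclicAlg 𝔣 L g n) = aeval c p ∧
        (e x : CyclicAlg 𝔣 L g' n) = aeval (A := CyclicAlg 𝔣 L g' n) c' p := exists_centralizer_equiv
    (centralizer_singleton_eq_adjoin hn (Cyc.finrank_eq G) (Cyc.exists_not_commute G hn) hc₁)
    (centralizer_singleton_eq_adjoin hn (Cyc.finrank_eq G') (Cyc.exists_not_commute G' hn) hc₁') hker
  refine ⟨e, fun x hx => ?_, fun v hv w hw => ?_⟩
  · obtain ⟨p, hp, hep⟩ := he x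
    refine hep.trans ?_
    have h1 : aeval c₁ (p - X) = 0 := by
      rw [map_sub, aeval_X, sub_eq_zero]; exact hp.symm.trans hx
    rw [hker, map_sub, aeval_X, sub_eq_zero] at h1
    exact h1
  · obtain ⟨h, hc, hR⟩ := hloc v hv w hw
    refine CyclicAlg.preservesIntegralAt_of_algEquiv h hc hR fun x => ?_
    obtain ⟨p, hp, hep⟩ := he x
    have h1 := map_one_tmul_aeval h hc p
    have h2 : (x : CyclicAlg 𝔣 L g n) = aeval c p := hp
    have h3 : (e x : CyclicAlg 𝔣 L g' n) = aeval (A := CyclicAlg 𝔣 L g' n) c' p := hep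
    rw [h2, h1]
    exact congrArg _ h3.symm

end FieldCase

/-! ### The theorem when `L` is not a field: the two generators are conjugate. -/

section SplitCase

variable {𝔣 L k : Type*} [Field 𝔣] [CommRing L] [Algebra 𝔣 L] [Field k] [Algebra 𝔣 k] {g g' : L ≃ₐ[𝔣] L} {n : ℕ}

/-- The automorphisms that preserve an ideal. -/
def idealStabilizer (m : Ideal L) : Subgroup (L ≃ₐ[𝔣] L) where
  carrier := {h | ∀ x, h x ∈ m ↔ x ∈ m}
  mul_mem' ha hb x := by rw [AlgEquiv.mul_apply, ha, hb]
  one_mem' x := Iff.rfl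
  inv_mem' {a} ha x := by rw [← ha, ← AlgEquiv.mul_apply, mul_inv_cancel, AlgEquiv.one_apply]

lemma mem_idealStabilizer {m : Ideal L} {h : L ≃ₐ[𝔣] L} : h ∈ idealStabilizer m ↔ ∀ x, h x ∈ m ↔ x ∈ m := Iff.rfl

lemma mem_of_zpow_mem {G : Type*} [Group G] {H : Subgroup G} {g : G} (hn : n.Prime) (hg : g ^ n = 1) {i : ℤ}
    (hi : ¬ (n : ℤ) ∣ i) (h : g ^ i ∈ H) : g ∈ H := by
  obtain ⟨u, v, huv⟩ := (Nat.prime_iff_prime_int.1 hn).coprime_iff_not_dvd.2 hi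
  rw [← zpow_one g, ← huv, zpow_add, mul_comm u, mul_comm v, zpow_mul, zpow_mul, zpow_natCast, hg, one_zpow, one_mul]
  exact zpow_mem h v

/-- If an automorphism of prime order preserves all maximal ideals, the ring is a field. -/
lemma isField_of_forall_mem [IsSemisimpleRing L] (hn : n.Prime) (hL : Module.finrank 𝔣 L = n) (hg : orderOf g = n)
    (h : ∀ m : Ideal L, m.IsMaximal → g ∈ idealStabilizer m) : IsField L := by
  have hfin : FiniteDimensional 𝔣 L := FiniteDimensional.of_finrank_pos (hL ▸ hn.pos)
  have hg1 : g ≠ 1 := by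
    rintro rfl
    rw [orderOf_one] at hg
    exact hn.one_lt.ne hg
  obtain ⟨x, hx⟩ : ∃ x, g x - x ≠ 0 := by
    by_contra! h'
    exact hg1 (AlgEquiv.ext fun x => sub_eq_zero.1 (h' x))
  -- A semisimple ring has zero Jacobson radical, so the nonzero element `g x - x` avoids some
  -- maximal ideal. There `g` acts with order `n`, which forces the residue field to have degree at
  -- least `n`.
  obtain ⟨m, hm, hxm⟩ : ∃ m : Ideal L, m.IsMaximal ∧ g x - x ∉ m := by
    by_contra! h'
    apply hx
    have hj : Ideal.jacobson (⊥ : Ideal L) = ⊥ := by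
      rw [Ideal.jacobson_bot]; exact IsSemisimpleRing.jacobson_eq_bot L
    rw [← Ideal.mem_bot, ← hj, Ideal.jacobson, Ideal.mem_sInf]
    exact fun {I} hI => h' I hI.2
  have hgm := mem_idealStabilizer.1 (h m hm)
  letI := Ideal.Quotient.field m
  have hmap : m = m.map (g : L →+* L) := by
    refine le_antisymm (fun y hy => ?_) (Ideal.map_le_iff_le_comap.2 fun y hy => (hgm y).2 hy)
    rw [← g.apply_symm_apply y] at hy ⊢
    exact Ideal.mem_map_of_mem (g : L →+* L) ((hgm _).1 hy)
  let gm : (L ⧸ m) ≃ₐ[𝔣] (L ⧸ m) := Ideal.quotientEquivAlg m m g hmap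
  have hpow : ∀ (i : ℕ) (y : L), (gm ^ i) (Ideal.Quotient.mk m y) = Ideal.Quotient.mk m ((g ^ i) y) := by
    intro i
    induction i with
    | zero => intro y; rfl
    | succ i ih => intro y; rw [pow_succ, pow_succ, AlgEquiv.mul_apply, AlgEquiv.mul_apply, ← ih]; rfl
  have hgmn : gm ^ n = 1 := by
    ext y
    obtain ⟨y, rfl⟩ := Ideal.Quotient.mk_surjective y
    rw [hpow, ← hg, pow_orderOf_eq_one]; rfl
  have hgm1 : gm ≠ 1 := fun h1 => hxm (by
    rw [← Ideal.Quotient.eq, ← pow_one g, ← hpow, h1]; rfl)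
  have : Fact n.Prime := ⟨hn⟩
  have h1 : n ≤ Module.finrank 𝔣 (L ⧸ m) := by
    rw [← orderOf_eq_prime hgmn hgm1]
    refine orderOf_le_card_univ.trans ?_
    exact AlgEquiv.card_le
  have hs : Function.Surjective (Ideal.Quotient.mkₐ 𝔣 m).toLinearMap := Ideal.Quotient.mk_surjective
  have h2 : Module.finrank 𝔣 L = Module.finrank 𝔣 (L ⧸ m) :=
    le_antisymm (hL ▸ h1) (LinearMap.finrank_le_finrank_of_surjective hs)
  have hb : Function.Bijective (Ideal.Quotient.mk m) :=
    ⟨(LinearMap.injective_iff_surjective_of_finrank_eq_finrank h2).2 hs, hs⟩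
  exact (RingEquiv.ofBijective _ hb).toMulEquiv.isField (Field.toIsField _)

/-- The joint map to the residue field is bijective if a maximal ideal is not preserved. -/
lemma bijective_residue (hn : n.Prime) (hL : Module.finrank 𝔣 L = n) (hg : g ^ n = 1) {m : Ideal L} (hm : m.IsMaximal)
    (hgm : g ∉ idealStabilizer m) :
    Function.Bijective (fun (x : L) (i : Fin n) => Ideal.Quotient.mk m ((g ^ (i : ℕ)) x)) := by
  have : NeZero n := ⟨hn.ne_zero⟩
  have hfin : FiniteDimensional 𝔣 L := FiniteDimensional.of_finrank_pos (hL ▸ hn.pos)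
  let I : Fin n → Ideal L := fun i => m.comap ((g ^ (i : ℕ) : L ≃ₐ[𝔣] L) : L →+* L)
  have hImem : ∀ i x, x ∈ I i ↔ (g ^ (i : ℕ)) x ∈ m := fun _ _ => Iff.rfl
  have hImax : ∀ i, (I i).IsMaximal := fun i =>
    Ideal.comap_isMaximal_of_surjective _ (g ^ (i : ℕ)).surjective
  have hI : Pairwise fun i j => IsCoprime (I i) (I j) := by
    intro i j hij
    rw [Ideal.isCoprime_iff_sup_eq]
    refine (hImax i).coprime_of_ne (hImax j) fun h => hgm ?_
    refine mem_of_zpow_mem (i := (i : ℤ) - j) hn hg (Cyc.not_dvd_sub hij) fun x => ?_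
    have h1 : (g ^ (-(j : ℤ))) x ∈ I i ↔ (g ^ (-(j : ℤ))) x ∈ I j := by rw [h]
    rw [hImem, hImem, ← zpow_natCast, ← zpow_natCast, ← AlgEquiv.mul_apply, ← AlgEquiv.mul_apply, ← zpow_add, ← zpow_add,
      add_neg_cancel, zpow_zero, AlgEquiv.one_apply] at h1
    exact h1
  let Φ : L →ₗ[𝔣] (Fin n → L ⧸ m) :=
    LinearMap.pi fun i => (Ideal.Quotient.mkₐ 𝔣 m).toLinearMap ∘ₗ (g ^ (i : ℕ)).toLinearMap
  have hΦ : Function.Surjective Φ := by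
    intro y
    choose z hz using fun i => Ideal.Quotient.mk_surjective (y i)
    obtain ⟨r, hr⟩ := Ideal.exists_forall_sub_mem_ideal hI
      (fun i => (g ^ (i : ℕ)).symm (z i))
    refine ⟨r, funext fun i => ?_⟩
    have h1 := hr i
    rw [hImem, map_sub, AlgEquiv.apply_symm_apply] at h1
    rw [← hz]
    exact (Ideal.Quotient.eq).2 h1
  letI := Ideal.Quotient.field m
  have hle := LinearMap.finrank_le_finrank_of_surjective hΦ
  refine ⟨?_, hΦ⟩
  refine (LinearMap.injective_iff_surjective_of_finrank_eq_finrank ?_).2 hΦ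
  -- The target has dimension `n [L ⧸ m : 𝔣] ≥ n`, and surjectivity gives the other inequality.
  refine le_antisymm ?_ hle
  rw [hL, Module.finrank_pi_fintype]
  have := Module.finrank_pos (R := 𝔣) (M := L ⧸ m)
  simp; nlinarith

/-- In the split case, `g` and `g'` are conjugate. -/
lemma exists_conj [IsSemisimpleRing L] (hn : n.Prime) (hL : Module.finrank 𝔣 L = n) (hg : orderOf g = n)
    (hg' : Subgroup.zpowers g' = Subgroup.zpowers g) (hF : ¬ IsField L) : ∃ σ : L ≃ₐ[𝔣] L, ∀ x, σ (g x) = g' (σ x) := by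
  obtain ⟨m, hm, hgm⟩ : ∃ m : Ideal L, m.IsMaximal ∧ g ∉ idealStabilizer m := by
    by_contra! h
    exact hF (isField_of_forall_mem hn hL hg h)
  have hgm' : g' ∉ idealStabilizer m := fun h => hgm (by
    have h1 : Subgroup.zpowers g' ≤ idealStabilizer m := Subgroup.zpowers_le.2 h
    rw [hg'] at h1
    exact h1 (Subgroup.mem_zpowers g))
  have hord : orderOf g' = n := by rw [← Nat.card_zpowers, hg', Nat.card_zpowers, hg]
  have hgn : g ^ n = 1 := hg ▸ pow_orderOf_eq_one g
  have hgn' : g' ^ n = 1 := hord ▸ pow_orderOf_eq_one g'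
  let Φ : ∀ h : L ≃ₐ[𝔣] L, L →ₐ[𝔣] (Fin n → L ⧸ m) := fun h =>
    AlgHom.pi fun i => (Ideal.Quotient.mkₐ 𝔣 m).comp (h ^ (i : ℕ)).toAlgHom
  -- In these product decompositions both `g` and `g'` become the same cyclic shift of the factors,
  -- so `Φ₂⁻¹ Φ₁` conjugates one to the other.
  let Φ₁ := AlgEquiv.ofBijective (Φ g) (bijective_residue hn hL hgn hm hgm)
  let Φ₂ := AlgEquiv.ofBijective (Φ g') (bijective_residue hn hL hgn' hm hgm')
  have hσ : ∀ x (i : ℕ), Ideal.Quotient.mk m ((g' ^ i) (Φ₂.symm (Φ₁ x))) = Ideal.Quotient.mk m ((g ^ i) x) := by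
    intro x i
    have h1 : Φ₂ (Φ₂.symm (Φ₁ x)) = Φ₁ x := Φ₂.apply_symm_apply _
    have h2 := congrFun h1 ⟨i % n, Nat.mod_lt _ hn.pos⟩
    rw [pow_eq_pow_mod i hgn, pow_eq_pow_mod i hgn']
    exact h2
  refine ⟨Φ₁.trans Φ₂.symm, fun x => Φ₂.injective (funext fun i => ?_)⟩
  change Ideal.Quotient.mk m ((g' ^ (i : ℕ)) (Φ₂.symm (Φ₁ (g x)))) = Ideal.Quotient.mk m ((g' ^ (i : ℕ)) (g' (Φ₂.symm (Φ₁ x))))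
  rw [hσ, ← AlgEquiv.mul_apply, ← AlgEquiv.mul_apply, ← pow_succ, ← pow_succ, hσ]

namespace Cyc

variable {A : Type*} [CommRing A] [Algebra 𝔣 A] {t : Aˣ}

/-- The homomorphism induced by an automorphism of `L` that conjugates `g` to `g'`. -/
noncomputable def conjHom (σ : L ≃ₐ[𝔣] L) (hσ : ∀ x, σ (g x) = g' (σ x)) : Cyc A g n t →ₐ[A] Cyc A g' n t :=
  lift (ιHom.comp (σ : L →+* L)) S (fun r => by
      change ι (σ (algebraMap 𝔣 L r)) = _
      rw [σ.commutes, ι_algebraMap])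
    (fun a => by
      change S * ι (σ a) = ι (σ (g a)) * S
      rw [S_mul_ι, hσ]) S_pow

lemma conjHom_ι (σ : L ≃ₐ[𝔣] L) (hσ : ∀ x, σ (g x) = g' (σ x)) (a : L) :
    conjHom σ hσ (ι a : Cyc A g n t) = ι (σ a) := by rw [conjHom, lift_ι]; rfl

lemma conjHom_S (σ : L ≃ₐ[𝔣] L) (hσ : ∀ x, σ (g x) = g' (σ x)) :
    conjHom σ hσ (S : Cyc A g n t) = S := by rw [conjHom, lift_S]

lemma conj_symm {σ : L ≃ₐ[𝔣] L} (hσ : ∀ x, σ (g x) = g' (σ x)) (x : L) : σ.symm (g' x) = g (σ.symm x) := by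
  rw [AlgEquiv.symm_apply_eq, hσ, AlgEquiv.apply_symm_apply]

/-- The isomorphism induced by an automorphism of `L` that conjugates `g` to `g'`. -/
noncomputable def conjEquiv (σ : L ≃ₐ[𝔣] L) (hσ : ∀ x, σ (g x) = g' (σ x)) : Cyc A g n t ≃ₐ[A] Cyc A g' n t :=
  AlgEquiv.ofAlgHom (conjHom σ hσ) (conjHom σ.symm (conj_symm hσ))
    (algHom_ext (fun a => by simp [conjHom_ι]) (by simp [conjHom_S]))
    (algHom_ext (fun a => by simp [conjHom_ι]) (by simp [conjHom_S]))

end Cyc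

open CyclicAlg in
/-- A homomorphism that permutes the generators respects the integral structures. -/
lemma map_mem_localRing {w : ValuationSubring (SeparableClosure (RatFunc k))}
    (h : (HenselField w ⊗[RatFunc 𝔣] CyclicAlg 𝔣 L g n) →ₐ[HenselField w] (HenselField w ⊗[RatFunc 𝔣] CyclicAlg 𝔣 L g' n))
    {σ : L → L} (hι : ∀ a, h (1 ⊗ₜ ofL g n a) = 1 ⊗ₜ ofL g' n (σ a)) (hs : h (1 ⊗ₜ s g n) = 1 ⊗ₜ s g' n)
    {x} (hx : x ∈ localRing g n w) : h x ∈ localRing g' n w := by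
  rw [localRing, integralRing] at hx ⊢
  split_ifs at hx ⊢ with ht
  · induction hx using Submodule.span_induction with
    | mem x hx =>
      obtain ⟨a, i, hi, rfl⟩ := hx
      refine Submodule.subset_span ⟨σ a, i, hi, ?_⟩
      have h1 : (1 ⊗ₜ (ofL g n a * s g n ^ i) : HenselField w ⊗[RatFunc 𝔣] CyclicAlg 𝔣 L g n) = (1 ⊗ₜ ofL g n a) * (1 ⊗ₜ s g n) ^ i := by
        rw [Algebra.TensorProduct.tmul_pow, Algebra.TensorProduct.tmul_mul_tmul, one_pow, one_mul]
      rw [h1, map_mul, map_pow, hι, hs, Algebra.TensorProduct.tmul_pow, Algebra.TensorProduct.tmul_mul_tmul, one_pow, one_mul]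
    | zero => rw [map_zero]; exact zero_mem _
    | add x y _ _ hx hy => rw [map_add]; exact add_mem hx hy
    | smul r x _ hx =>
      rw [← algebraMap_smul (HenselField w) r x, map_smul, algebraMap_smul]
      exact Submodule.smul_mem _ _ hx
  · trivial

open CyclicAlg in
/-- The main theorem when `g` and `g'` are conjugate. -/
theorem exists_match_of_conj (σ : L ≃ₐ[𝔣] L) (hσ : ∀ x, σ (g x) = g' (σ x)) (c : CyclicAlg 𝔣 L g n) :
    ∃ c' : CyclicAlg 𝔣 L g' n, (∀ w : ValuationSubring (SeparableClosure (RatFunc k)), MatchAt w c c') ∧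
      ∃ e : CyclicAlg.centralizer c ≃ₐ[RatFunc 𝔣] CyclicAlg.centralizer c',
        (∀ x : CyclicAlg.centralizer c, (x : CyclicAlg 𝔣 L g n) = c → (e x : CyclicAlg 𝔣 L g' n) = c') ∧
          ∀ w : ValuationSubring (SeparableClosure (RatFunc k)), CyclicAlg.PreservesIntegralAt w e := by
  let ε : CyclicAlg 𝔣 L g n ≃ₐ[RatFunc 𝔣] CyclicAlg 𝔣 L g' n := Cyc.conjEquiv (t := ratX 𝔣) σ hσ
  have hε : ∀ a, ε (ofL g n a) = ofL g' n (σ a) := Cyc.conjHom_ι σ hσ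
  have hεs : ε (s g n) = s g' n := Cyc.conjHom_S σ hσ
  let h : ∀ w : ValuationSubring (SeparableClosure (RatFunc k)), (HenselField w ⊗[RatFunc 𝔣] CyclicAlg 𝔣 L g n) ≃ₐ[HenselField w]
    (HenselField w ⊗[RatFunc 𝔣] CyclicAlg 𝔣 L g' n) := fun w => Algebra.TensorProduct.congr AlgEquiv.refl ε
  have hh : ∀ w (d : CyclicAlg 𝔣 L g n), h w (1 ⊗ₜ d) = 1 ⊗ₜ ε d := fun w d => rfl
  have hh' : ∀ w (d : CyclicAlg 𝔣 L g' n), (h w).symm (1 ⊗ₜ d) = 1 ⊗ₜ ε.symm d := fun w d => rfl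
  have hR : ∀ w x, x ∈ localRing g n w ↔ h w x ∈ localRing g' n w := fun w x => by
    refine ⟨fun hx => map_mem_localRing (h w).toAlgHom (σ := σ) (fun a => ?_) ?_ hx, fun hx => ?_⟩
    · exact (hh w _).trans (by rw [hε])
    · exact (hh w _).trans (by rw [hεs])
    · rw [← (h w).symm_apply_apply x]
      refine map_mem_localRing (h w).symm.toAlgHom (σ := σ.symm) (fun a => ?_) ?_ hx
      · refine (hh' w _).trans ?_
        rw [(AlgEquiv.symm_apply_eq ε).2]
        rw [hε, AlgEquiv.apply_symm_apply]
      · refine (hh' w _).trans ?_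
        rw [(AlgEquiv.symm_apply_eq ε).2]
        rw [hεs]
  obtain ⟨e, he⟩ := exists_localCentralizer_equiv ε (c := c) rfl
  refine ⟨ε c, fun w => ⟨h w, hh w c, hR w⟩, e, fun x hx => (he x).trans (congrArg ε hx), fun w => ?_⟩
  refine preservesIntegralAt_of_algEquiv (h w) (hh w c) (hR w) fun x => ?_
  rw [hh]
  exact congrArg _ (he x).symm

end SplitCase

theorem mainTheorem11 {𝔣 L k : Type*} [Field 𝔣] [PerfectField 𝔣]
    [CommRing L] [Algebra 𝔣 L] [IsSemisimpleRing L]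
    [Field k] [Algebra 𝔣 k] [IsAlgClosed k]
    (n : ℕ) (hn : n.Prime) (hL : Module.finrank 𝔣 L = n)
    (g g' : L ≃ₐ[𝔣] L) (hg : orderOf g = n)
    (hg' : Subgroup.zpowers g' = Subgroup.zpowers g)
    (c : CyclicAlg 𝔣 L g n) :
    ∃ c' : CyclicAlg 𝔣 L g' n,
      (∀ v : ValuationSubring (RatFunc k), IsPlace v →
        ∀ w : ValuationSubring (SeparableClosure (RatFunc k)), Prolongs w v →
          CyclicAlg.MatchAt w c c') ∧
      (c ∉ Subalgebra.center (RatFunc 𝔣) (CyclicAlg 𝔣 L g n) →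
        ∃ e : CyclicAlg.centralizer c ≃ₐ[RatFunc 𝔣] CyclicAlg.centralizer c',
          (∀ x : CyclicAlg.centralizer c, (x : CyclicAlg 𝔣 L g n) = c →
            (e x : CyclicAlg 𝔣 L g' n) = c') ∧
          ∀ v : ValuationSubring (RatFunc k), IsPlace v →
            ∀ w : ValuationSubring (SeparableClosure (RatFunc k)), Prolongs w v →
              CyclicAlg.PreservesIntegralAt w e) := by
  by_cases hF : IsField L
  · exact @exists_match_of_field 𝔣 L k _ hF.toField _ _ _ _ n hn hL g g' hg hg' c
  · obtain ⟨σ, hσ⟩ := exists_conj hn hL hg hg' hF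
    obtain ⟨c', h, e, hec, he⟩ := exists_match_of_conj (k := k) σ hσ c
    exact ⟨c', fun _ _ w _ => h w, fun _ => ⟨e, hec, fun _ _ w _ => he w⟩⟩
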